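/- **Setting.** An interval is a closed interval $[a,b]\subset\mathbb R$ with $a<b$; let $\mathcal I^1$ be the graph of all intervals, two being adjacent when they have exactly one point in common. A $3$-interval is a product $I=I_1\times I_2\times I_3$ of intervals; two $3$-intervals $I,J$ are adjacent if, for some $i$, $I_i$ and $J_i$ have exactly one point in common. This gives the graph $\mathcal I^3$. A combination is a finite formal sum $\gamma=\sum_I k_I I$ of intervals with $k_I\in\mathbb N$. Put $|\gamma|=\sum k_I$ and $\operatorname{supp}\gamma=\{I: k_I>0\}$. The graph $G_\gamma$ has vertices $(I,m)$, $1\le m\le k_I$, with $(I,m)$ and $(J,l)$ adjacent iff $I,J$ are adjacent in $\mathcal I^1$. Let $\alpha(\gamma)$ be the independence number of $G_\gamma$ and $|E(\gamma)|$ its number of edges. For $s\ge 3$ let $\mathcal I(s)=\{[0,1],[s,s+1]\}\cup\{[i,j]:1\le i<j\le s\}$ and $\mathcal S(s)=\{[i,i+1]:0\le i\le s\}\cup\{[1,3],[s-2,s]\}$ ($i,j$ integers). For $3\le s\le 9$ let $L(s,12)$ be the set of all combinations $\lambda$ with $|\lambda|=12$, $\alpha(\lambda)\le 5$ and $\mathcal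 S(s)\subseteq\operatorname{supp}\lambda\subseteq\mathcal I(s)$. The group $\operatorname{Aut}(s)$ of automorphisms of the graph $\mathcal I(s)$ acts on combinations of elements of $\mathcal I(s)$ by $f_*(\sum k_I I)=\sum k_I f(I)$. For each $s$ let $\hat L(s,12)$ be a system of representatives of $L(s,12)$ modulo $\operatorname{Aut}(s)$, that is, a set consisting of exactly one element from each $\operatorname{Aut}(s)$-orbit that meets $L(s,12)$. Let $\hat L(12)=\bigcup_{s=3}^{9}\hat L(s,12)$ and $$N(12)=\Big\{(\gamma_1,\gamma_2,\gamma_3)\in\hat L(12)^3:\ |E(\gamma_1)|+|E(\gamma_2)|+|E(\gamma_3)|\ge\tbinom{12}{2}\Big\}.$$ Finally let $$\lambda^\clubsuit=2[0,1]+2[1,2]+[1,3]+[1,4]+[2,3]+[2,4]+2[3,4]+2[4,5],$$ $$\lambda^\spadesuit=[0,1]+[1,2]+2[1,3]+2[2,3]+2[3,4]+2[3,5]+[4,5]+[5,6].$$ **Proposition.** For every choice of the systems of representatives $\hat L(s,12)$, $3\le s\le 9$: if $(\gamma_1,\gamma_2,\gamma_3)\in N(12)$ and there is a finite clique $\mathcal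 C$ in $\mathcal I^3$ with $\gamma_i=\sum_{I\in\mathcal C}I_i$ for $i=1,2,3$, then $$(\gamma_1,\gamma_2,\gamma_3)=(\lambda^\clubsuit,\lambda^\clubsuit,\lambda^\clubsuit)\quad\text{or}\quad(\gamma_1,\gamma_2,\gamma_3)=(\lambda^\spadesuit,\lambda^\spadesuit,\lambda^\spadesuit).$$ -/

import Mathlib

open scoped BigOperators

/-- An ordinary closed interval `[lo, hi]` of the real line, of positive length. -/
@[ext]
structure Itv where
  lo : ℝ
  hi : ℝ
  lo_lt_hi : lo < hi

namespace Itv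

/-- The interval as a set of real numbers. -/
def toSet (I : Itv) : Set ℝ := Set.Icc I.lo I.hi

/-- Two intervals touch if they have exactly one point in common. -/
def Touch (I J : Itv) : Prop := ∃ x : ℝ, I.toSet ∩ J.toSet = {x}

theorem Touch.symm {I J : Itv} (h : I.Touch J) : J.Touch I := by
  obtain ⟨x, hx⟩ := h
  exact ⟨x, by rw [Set.inter_comm]; exact hx⟩

theorem not_touch_self (I : Itv) : ¬ I.Touch I := by
  rintro ⟨x, hx⟩
  rw [Set.inter_self] at hx
  have h1 : I.lo ∈ I.toSet := Set.left_mem_Icc.2 I.lo_lt_hi.le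
  have h2 : I.hi ∈ I.toSet := Set.right_mem_Icc.2 I.lo_lt_hi.le
  rw [hx, Set.mem_singleton_iff] at h1 h2
  exact I.lo_lt_hi.ne (h1.trans h2.symm)

end Itv

/-- The graph of all intervals: adjacency means meeting in exactly one point. -/
def itvGraph : SimpleGraph Itv where
  Adj I J := I.Touch J
  symm := ⟨fun _ _ h => h.symm⟩
  loopless := ⟨fun I h => I.not_touch_self h⟩

/-- The graph of all `n`-intervals `I = I₁ × ⋯ × Iₙ`, each given by its factors: `I` and `J` are
adjacent if for some `i` the factors `Iᵢ` and `Jᵢ` have exactly one point in common. -/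
def boxGraph (n : ℕ) : SimpleGraph (Fin n → Itv) where
  Adj I J := ∃ i, (I i).Touch (J i)
  symm := ⟨fun _ _ ⟨i, h⟩ => ⟨i, h.symm⟩⟩
  loopless := ⟨fun I ⟨i, h⟩ => (I i).not_touch_self h⟩

/-! Combinations: a finite formal sum `∑ kₓ x` of elements of `X` is an element of `X →₀ ℕ`. -/

namespace Comb

/-- The graph of a combination `γ` of vertices of `G`: every vertex `x` is replaced by `γ x`
pairwise non-adjacent copies `(x, i)`, and `(x, i)`, `(y, j)` are adjacent iff `x`, `y` are. -/
def graph {X : Type*} (G : SimpleGraph X) (γ : X →₀ ℕ) : SimpleGraph (Σ x : X, Fin (γ x)) :=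
  G.comap Sigma.fst

/-- `|γ| = ∑ kₓ`. -/
def size {X : Type*} (γ : X →₀ ℕ) : ℕ := γ.sum fun _ k => k

/-- `α(γ)`, the independence number of the graph of a combination of intervals. -/
noncomputable def alpha (γ : Itv →₀ ℕ) : ℕ := (graph itvGraph γ).indepNum

/-- `|E(γ)|`, the number of edges of the graph of a combination of intervals. -/
noncomputable def numEdges (γ : Itv →₀ ℕ) : ℕ := (graph itvGraph γ).edgeSet.ncard

end Comb

/-- The family `I(s) = {[0,1], [s,s+1]} ∪ {[i,j] : 1 ≤ i < j ≤ s}`. -/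
def itvFamily (s : ℕ) : Set Itv :=
  {I | (I.lo = 0 ∧ I.hi = 1) ∨ (I.lo = s ∧ I.hi = s + 1) ∨
    ∃ i j : ℕ, 1 ≤ i ∧ i < j ∧ j ≤ s ∧ I.lo = i ∧ I.hi = j}

/-- The family `S(s) = {[i,i+1] : 0 ≤ i ≤ s} ∪ {[1,3], [s-2,s]}`. -/
def coreFamily (s : ℕ) : Set Itv :=
  {I | (∃ i : ℕ, i ≤ s ∧ I.lo = i ∧ I.hi = i + 1) ∨ (I.lo = 1 ∧ I.hi = 3) ∨
    (I.lo = (s : ℝ) - 2 ∧ I.hi = s)}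

/-- `S(s) ⊆ supp γ ⊆ I(s)`. -/
def SuppBetween (s : ℕ) (γ : Itv →₀ ℕ) : Prop :=
  coreFamily s ⊆ (γ.support : Set Itv) ∧ (γ.support : Set Itv) ⊆ itvFamily s

/-- The set `L` of combinations `γ` of intervals such that `12 ≤ |γ| ≤ 17`, `α(γ) ≤ 5`, and
`S(s) ⊆ supp γ ⊆ I(s)` for some `3 ≤ s ≤ 9`. -/
def setL : Set (Itv →₀ ℕ) :=
  {γ | (12 ≤ Comb.size γ ∧ Comb.size γ ≤ 17) ∧ Comb.alpha γ ≤ 5 ∧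
    ∃ s : ℕ, 3 ≤ s ∧ s ≤ 9 ∧ SuppBetween s γ}

/-- The set `L(s,v)` of those `γ ∈ L` for which `S(s) ⊆ supp γ ⊆ I(s)` and `|γ| = v`. -/
def setLsv (s v : ℕ) : Set (Itv →₀ ℕ) :=
  {γ | γ ∈ setL ∧ SuppBetween s γ ∧ Comb.size γ = v}

/-- The automorphisms of the graph `I(s)`. -/
abbrev FamilyAut (s : ℕ) : Type := itvGraph.induce (itvFamily s) ≃g itvGraph.induce (itvFamily s)

/-- The combination `f_*(γ) = ∑ k_I f(I)`, for an automorphism `f` of `I(s)` and a combination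
`γ = ∑ k_I I` of elements of `I(s)`. -/
noncomputable def pushComb {s : ℕ} (f : FamilyAut s) (γ : Itv →₀ ℕ) : Itv →₀ ℕ :=
  (γ.subtypeDomain (· ∈ itvFamily s)).mapDomain fun I => (f I : Itv)

/-- `μ` lies in the orbit of `γ` under the automorphism group of `I(s)`. -/
def SameOrbit (s : ℕ) (γ μ : Itv →₀ ℕ) : Prop := ∃ f : FamilyAut s, pushComb f γ = μ

/-- `R` is a system of representatives of `L(s,v)` modulo the automorphism group of `I(s)`:
it consists of exactly one element from each orbit that meets `L(s,v)`. (For `s = 4` the set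
`L(s,v)` is not a union of orbits; a representative may be any element of its orbit.) -/
def IsSelection (s v : ℕ) (R : Set (Itv →₀ ℕ)) : Prop :=
  (∀ μ ∈ R, ∃ γ ∈ setLsv s v, SameOrbit s γ μ) ∧
    ∀ γ ∈ setLsv s v, ∃! μ, μ ∈ R ∧ SameOrbit s γ μ

/-- The union over `3 ≤ s ≤ 9` of the chosen systems of representatives `R s`. -/
def unionReps (R : ℕ → Set (Itv →₀ ℕ)) : Set (Itv →₀ ℕ) :=
  {γ | ∃ s : ℕ, 3 ≤ s ∧ s ≤ 9 ∧ γ ∈ R s}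

/-- The set `N(v)`: triples of chosen representatives whose graphs have together at least
`v choose 2` edges. -/
def setN (R : ℕ → Set (Itv →₀ ℕ)) (v : ℕ) : Set (Fin 3 → (Itv →₀ ℕ)) :=
  {γ | (∀ i, γ i ∈ unionReps R) ∧ v.choose 2 ≤ ∑ i, Comb.numEdges (γ i)}

/-- The construction problem has a solution for `(γ₁, γ₂, γ₃)`: there is a (finite) clique `C` in
the graph of 3-intervals with `γᵢ = ∑_{I ∈ C} Iᵢ` for every `i`. -/
def ConstructionSolvable (γ : Fin 3 → (Itv →₀ ℕ)) : Prop :=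
  ∃ C : Finset (Fin 3 → Itv), (boxGraph 3).IsClique (C : Set (Fin 3 → Itv)) ∧
    ∀ i, γ i = ∑ I ∈ C, Finsupp.single (I i) 1

/-- The interval `[a, b]` with natural end-points, as a combination. -/
noncomputable def itvTerm (a b : ℕ) (h : a < b := by decide) : Itv →₀ ℕ :=
  Finsupp.single ⟨a, b, Nat.cast_lt.2 h⟩ 1

/-- `λ^♣`. -/
noncomputable def lamClub : Itv →₀ ℕ :=
  2 • itvTerm 0 1 + 2 • itvTerm 1 2 + itvTerm 1 3 + itvTerm 1 4 + itvTerm 2 3 + itvTerm 2 4 +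
    2 • itvTerm 3 4 + 2 • itvTerm 4 5

/-- `λ^♠`. -/
noncomputable def lamSpade : Itv →₀ ℕ :=
  itvTerm 0 1 + itvTerm 1 2 + 2 • itvTerm 1 3 + 2 • itvTerm 2 3 + 2 • itvTerm 3 4 +
    2 • itvTerm 3 5 + itvTerm 4 5 + itvTerm 5 6

namespace CodeSearch

/-- The interval `[a, b]` with natural end-points is coded by the pair `(a, b)`. -/
abbrev Code : Type := ℕ × ℕ

/-- Two codes touch if one of the intervals ends where the other begins. -/
def Touch (p q : Code) : Prop := p.2 = q.1 ∨ q.2 = p.1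

instance (p q : Code) : Decidable (Touch p q) := inferInstanceAs (Decidable (_ ∨ _))

theorem Touch.symm {p q : Code} (h : Touch p q) : Touch q p := Or.symm h

/-- Touching of codes of intervals of positive length is triangle-free. -/
theorem Touch.triangle_free {p q r : Code} (hp : p.1 < p.2) (hq : q.1 < q.2) (hr : r.1 < r.2)
    (hpq : Touch p q) (hqr : Touch q r) (hpr : Touch p r) : False := by
  unfold Touch at *; omega

/-! ### Programs

The search programs are written with explicit recursors and raw operations on natural numbers, so
that the kernel evaluates them quickly. -/

/-- `force k n = k n`, with `n` evaluated first. -/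
noncomputable def force (k : ℕ → Bool) (n : ℕ) : Bool :=
  Nat.rec (motive := fun _ => Bool) (k 0) (fun m _ => k (Nat.succ m)) n

/-- `k n` if `n` is positive, `true` otherwise. -/
noncomputable def zeroOr (k : ℕ → Bool) (n : ℕ) : Bool :=
  Nat.rec (motive := fun _ => Bool) true (fun m _ => k (Nat.succ m)) n

noncomputable def band (a b : Bool) : Bool := Bool.rec (motive := fun _ => Bool) false b a

/-- The reverse of the first list, followed by the second. -/
noncomputable def revApp {α : Type} (l₁ l₂ : List α) : List α :=
  List.rec (motive := fun _ => List α → List α) (fun l => l) (fun a _ ih l => ih (a :: l)) l₁ l₂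

theorem force_eq (k : ℕ → Bool) (n : ℕ) : force k n = k n := by cases n <;> rfl

theorem zeroOr_eq_true {k : ℕ → Bool} {n : ℕ} (h : zeroOr k n = true) (hn : n ≠ 0) :
    k n = true := by
  cases n with
  | zero => exact absurd rfl hn
  | succ n => exact h

theorem band_eq_true {a b : Bool} : band a b = true ↔ a = true ∧ b = true := by
  cases a <;> cases b <;> simp [band]

theorem revApp_eq {α : Type} (l₁ l₂ : List α) : revApp l₁ l₂ = l₁.reverse ++ l₂ := by
  induction l₁ generalizing l₂ with
  | nil => rfl
  | cons a l₁ ih =>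
    have : revApp (a :: l₁) l₂ = revApp l₁ (a :: l₂) := rfl
    rw [this, ih]; simp

/-- Bit `u` of `n` is moved to the place `64 + 12 u`, for `u < k`. -/
def spread (n : ℕ) : ℕ → ℕ
  | 0 => 0
  | k + 1 => Nat.lor (spread n k)
      (Nat.shiftLeft (Nat.land (Nat.shiftRight n k) 1) (Nat.add 64 (Nat.mul 12 k)))

/-- A code with its position `idx` in the list of all codes of the search, and shifts and masks that
belong to it. The state of a search holds, for every code `q` with position `k` and every position
`u < 12` where a code has been placed that `q` does not touch, the bits `208 + 12 k + u` and
`400 + 144 k + 12 u`. -/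
structure Geo where
  lo : ℕ
  hi : ℕ
  idx : ℕ
  sh : ℕ
  shS : ℕ
  nb : ℕ
  nbS : ℕ

/-- A code that may still be placed: bit `32 k + t` of `mp` says that combination `t` allows more
than `k` further copies. -/
structure Item where
  mp : ℕ
  g : Geo

/-- A position: `non` holds the earlier positions not adjacent to it, `nonS` the same bits spread
out, and `tw` says that the preceding position carries the same code. -/
structure Row where
  d : ℕ
  d5 : ℕ
  dd : ℕ
  non : ℕ
  nonS : ℕ
  tw : Bool

def mkRow (d non : ℕ) (tw : Bool) : Row :=
  ⟨d, Nat.mul 5 d, Nat.add 64 (Nat.mul 12 d), non, spread non 12, tw⟩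

/-- Sequences of rows with common beginnings, arranged as a tree: `node d non tw msk child sib`
begins with the row `mkRow d non tw`, goes on in `child`, and is meant for the combinations in
`msk`; `sib` holds the alternatives. -/
inductive SearchTree where
  | nil : SearchTree
  | leaf (specs : Option (List (ℕ × ℕ))) : SearchTree
  | node (d non : ℕ) (tw : Bool) (msk : ℕ) (child sib : SearchTree) : SearchTree

/-- What remains to be searched: the candidate combinations, the state, and the items, those before
the one placed last (in reverse order) and the others. -/
abbrev Cont : Type := ℕ → ℕ → List Item → List Item → Bool

noncomputable def place (d d5 dd idx nb nbS S : ℕ) (k : ℕ → Bool) (b a : ℕ) : Bool :=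
  Bool.rec (motive := fun _ => Bool) true
    (force k (Nat.lor S (Nat.lor (Nat.shiftLeft idx d5)
      (Nat.lor (Nat.shiftLeft (Nat.lor nb b) d) (Nat.shiftLeft (Nat.lor nbS a) dd)))))
    (Nat.beq (Nat.land S (Nat.mul a b)) 0)

noncomputable def tryPlace (r : Row) (idx sh shS nb nbS S : ℕ) (k : ℕ → Bool) : Bool :=
  Row.rec (motive := fun _ => Bool) (fun d d5 dd non nonS _ =>
    place d d5 dd idx nb nbS S k (Nat.land nonS (Nat.shiftRight S shS))
      (Nat.land non (Nat.shiftRight S sh))) r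

noncomputable def tryGeo (r : Row) (next : Cont) (S : ℕ) (pre tl : List Item) (mp : ℕ) (g : Geo)
    (m : ℕ) : Bool :=
  Geo.rec (motive := fun _ => Bool) (fun _ _ idx sh shS nb nbS =>
    tryPlace r idx sh shS nb nbS S
      fun S' => next m S' pre (List.cons (Item.mk (Nat.shiftRight mp 32) g) tl)) g

noncomputable def tryItem (r : Row) (next : Cont) (m S : ℕ) (pre tl : List Item) (it : Item) :
    Bool :=
  Item.rec (motive := fun _ => Bool) (fun mp g =>
    zeroOr (tryGeo r next S pre tl mp g) (Nat.land m mp)) it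

noncomputable def tryAll (r : Row) (next : Cont) (m S : ℕ) (suf pre : List Item) : Bool :=
  List.rec (motive := fun _ => List Item → Bool) (fun _ => true)
    (fun it tl ih pre => band (tryItem r next m S pre tl it) (ih (List.cons it pre))) suf pre

noncomputable def tryRow (r : Row) (next : Cont) (S : ℕ) (pre suf : List Item) (m : ℕ) : Bool :=
  Row.rec (motive := fun _ => Bool) (fun _ _ _ _ _ tw =>
    Bool.rec (motive := fun _ => Bool) (tryAll r next m S (revApp pre suf) [])
      (tryAll r next m S suf pre) tw) r

/-! The uncovered pairs are to be embedded in a third combination. -/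

abbrev EmbCont : Type := ℕ → ℕ → List Item → Bool

noncomputable def embGeo (d need : ℕ) (next : EmbCont) (T : ℕ) (pre tl : List Item) (mp : ℕ)
    (g : Geo) (m : ℕ) : Bool :=
  Geo.rec (motive := fun _ => Bool) (fun _ _ idx sh _ nb _ =>
    Bool.rec (motive := fun _ => Bool) true
      (force (fun T' => next m T' (revApp pre (List.cons (Item.mk (Nat.shiftRight mp 32) g) tl)))
        (Nat.lor T (Nat.lor (Nat.shiftLeft idx (Nat.mul 5 d)) (Nat.shiftLeft nb d))))
      (Nat.beq (Nat.land need (Nat.shiftRight T sh)) 0)) g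

noncomputable def embItem (d need : ℕ) (next : EmbCont) (m T : ℕ) (pre tl : List Item)
    (it : Item) : Bool :=
  Item.rec (motive := fun _ => Bool) (fun mp g =>
    zeroOr (embGeo d need next T pre tl mp g) (Nat.land m mp)) it

noncomputable def embAll (d : ℕ) (next : EmbCont) (m T : ℕ) (suf pre : List Item) (need : ℕ) :
    Bool :=
  List.rec (motive := fun _ => List Item → Bool) (fun _ => true)
    (fun it tl ih pre => band (embItem d need next m T pre tl it) (ih (List.cons it pre))) suf pre

noncomputable def emb (S : ℕ) (ds : List ℕ) : EmbCont :=
  List.rec (motive := fun _ => EmbCont) (fun _ _ _ => false)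
    (fun d _ ih m T items => force (embAll d ih m T items [])
      (Nat.land (Nat.shiftRight S (Nat.add 64 (Nat.mul 12 d))) (Nat.sub (Nat.pow 2 d) 1))) ds

noncomputable def leafTest (grp : ℕ → List Item) (specs : Option (List (ℕ × ℕ))) (S : ℕ) : Bool :=
  Option.rec (motive := fun _ => Bool) false
    (fun l => List.rec (motive := fun _ => Bool) true
      (fun sp _ ih => band (emb S [0, 1, 2, 3, 4, 5, 6, 7, 8, 9, 10, 11] sp.2 0 (grp sp.1)) ih) l)
    specs

noncomputable def run (grp : ℕ → List Item) (t : SearchTree) : Cont :=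
  SearchTree.rec (motive := fun _ => Cont) (fun _ _ _ _ => true)
    (fun specs _ S _ _ => leafTest grp specs S)
    (fun d non tw msk _ _ ihc ihs m S pre suf =>
      band (zeroOr (tryRow (mkRow d non tw) ihc S pre suf) (Nat.land m msk)) (ihs m S pre suf)) t

/-! The first stage: the complement of one combination is to be covered by two triangle-free
graphs, given by symmetric `12 × 12` matrices of bits. -/

structure Edge where
  u : ℕ
  v : ℕ

noncomputable def colorEdge (next : ℕ → ℕ → Bool) (u v bit M N : ℕ) : Bool :=
  Bool.rec (motive := fun _ => Bool) true (force (fun M' => next M' N) (Nat.lor M bit))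
    (Nat.beq (Nat.land (Nat.land (Nat.shiftRight M u) (Nat.shiftRight M v)) 4095) 0)

noncomputable def color (es : List Edge) : ℕ → ℕ → Bool :=
  List.rec (motive := fun _ => ℕ → ℕ → Bool) (fun _ _ => false)
    (fun e _ ih M N => Edge.rec (motive := fun _ => Bool) (fun u v =>
      band (colorEdge ih (Nat.mul 12 u) (Nat.mul 12 v)
          (Nat.lor (Nat.shiftLeft 1 (Nat.add (Nat.mul 12 u) v))
            (Nat.shiftLeft 1 (Nat.add (Nat.mul 12 v) u))) M N)
        (colorEdge (fun N' M' => ih M' N') (Nat.mul 12 u) (Nat.mul 12 v)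
          (Nat.lor (Nat.shiftLeft 1 (Nat.add (Nat.mul 12 u) v))
            (Nat.shiftLeft 1 (Nat.add (Nat.mul 12 v) u))) N M)) e) es

/-! ### The rows of a list of codes -/

/-- The codes in the list that `p` does not touch, as bits at `i`, `i + k`, `i + 2 k`, … -/
def nonMask (p : Code) (k : ℕ) : ℕ → List Code → ℕ
  | _, [] => 0
  | i, q :: l => Nat.lor (nonMask p k (i + k) l) (if Touch p q then 0 else 2 ^ i)

/-- The rows of `l`, when the codes in `pre` have been placed before. -/
def rowsFrom : List Code → List Code → List (ℕ × ℕ × Bool)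
  | _, [] => []
  | pre, a :: l => (pre.length, nonMask a 1 0 pre, decide (pre.getLast? = some a)) ::
      rowsFrom (pre ++ [a]) l

/-- The tree has a branch with these rows, meant for all combinations in `M`, that ends in a `leaf`
without specification (if `q` is `none`) or with one for the given group and combination. -/
def SearchTree.mem (M : ℕ) (q : Option (ℕ × ℕ)) : SearchTree → List (ℕ × ℕ × Bool) → Bool
  | .nil, _ => false
  | .leaf none, rows => rows.isEmpty && q.isNone
  | .leaf (some l), rows => rows.isEmpty &&
      q.any fun x => l.any fun sp => (sp.1 == x.1) && sp.2.testBit x.2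
  | .node _ _ _ _ _ s, [] => s.mem M q []
  | .node d non tw msk c s, r :: rows =>
      (non.beq r.2.1 && (tw == r.2.2) && d.beq r.1 && (Nat.land msk M).beq M && c.mem M q rows) ||
        s.mem M q (r :: rows)

/-! ### Soundness of the search -/

theorem testBit_spread {n k i : ℕ} (h : (spread n k).testBit i = true) :
    ∃ u < k, i = 64 + 12 * u ∧ n.testBit u = true := by
  induction k with
  | zero => simp [spread] at h
  | succ k ih =>
    have e : spread n (k + 1) = spread n k ||| (((n >>> k) &&& 1) <<< (64 + 12 * k)) := rfl
    rw [e, Nat.testBit_or, Bool.or_eq_true] at h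
    rcases h with h | h
    · obtain ⟨u, hu, h⟩ := ih h
      exact ⟨u, by omega, h⟩
    · rw [Nat.testBit_shiftLeft, Bool.and_eq_true, decide_eq_true_eq, Nat.testBit_and,
        Bool.and_eq_true, Nat.testBit_one_eq_true_iff_self_eq_zero, Nat.testBit_shiftRight] at h
      obtain ⟨h1, h2, h3⟩ := h
      have : i = 64 + 12 * k := by omega
      subst this
      exact ⟨k, by omega, rfl, by simpa using h2⟩

theorem testBit_nonMask {a : Code} {k i : ℕ} {l : List Code} {v : ℕ}
    (h : (nonMask a k i l).testBit v = true) :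
    ∃ j, ∃ hj : j < l.length, v = i + k * j ∧ ¬ Touch a l[j] := by
  induction l generalizing i with
  | nil => simp [nonMask] at h
  | cons b l ih =>
    have e : nonMask a k i (b :: l) =
      nonMask a k (i + k) l ||| (if Touch a b then 0 else 2 ^ i) := rfl
    rw [e, Nat.testBit_or, Bool.or_eq_true] at h
    rcases h with h | h
    · obtain ⟨j, hj, h1, h2⟩ := ih h
      exact ⟨j + 1, by simpa using hj, by rw [h1]; ring, by simpa using h2⟩
    · split_ifs at h with hab
      · simp at h
      · rw [Nat.testBit_two_pow, decide_eq_true_eq] at h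
        exact ⟨0, by simp, by omega, hab⟩

/-- If the bits of `b` stand at multiples of `12` and `a < 2 ^ 12`, then `a * b` holds a copy of `a`
at each bit of `b`. -/
theorem testBit_mul_sparse {a : ℕ} (ha : a < 2 ^ 12) (b : ℕ) :
    (∀ i, b.testBit i = true → i % 12 = 0) → ∀ i, (a * b).testBit i = true →
      b.testBit (12 * (i / 12)) = true ∧ a.testBit (i % 12) = true := by
  induction b using Nat.strong_induction_on with
  | _ b ih =>
    intro hb i hi
    rcases Nat.eq_zero_or_pos b with rfl | hpos
    · simp at hi
    have hdiv : ∀ j, (b / 2 ^ 12).testBit j = b.testBit (12 + j) := fun j => by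
      rw [Nat.testBit_div_two_pow, Nat.add_comm]
    have hmod : b % 2 ^ 12 ≤ 1 := by
      have : b % 2 ^ 12 = (b % 2 ^ 12) % 2 := by
        apply Nat.eq_of_testBit_eq
        intro j
        have e2 : b % 2 ^ 12 % 2 = b % 2 ^ 12 % 2 ^ 1 := rfl
        rw [e2, Nat.testBit_mod_two_pow, Nat.testBit_mod_two_pow, Nat.testBit_mod_two_pow]
        by_cases hj : b.testBit j = true
        · have := hb j hj
          by_cases h12 : j < 12
          · have : j = 0 := by omega
            simp [this]
          · simp [h12]
        · simp [hj]
      omega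
    have hab : a * b = 2 ^ 12 * (a * (b / 2 ^ 12)) + a * (b % 2 ^ 12) := by
      conv_lhs => rw [← Nat.div_add_mod b (2 ^ 12)]
      ring
    have hlt : a * (b % 2 ^ 12) < 2 ^ 12 := by
      calc a * (b % 2 ^ 12) ≤ a * 1 := Nat.mul_le_mul_left _ hmod
        _ < 2 ^ 12 := by simpa using ha
    rw [hab, Nat.testBit_two_pow_mul_add _ hlt] at hi
    split_ifs at hi with h12
    · have hi0 : i / 12 = 0 := by omega
      have him : i % 12 = i := by omega
      have h1 : b % 2 ^ 12 = 1 := by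
        rcases Nat.le_one_iff_eq_zero_or_eq_one.1 hmod with h | h
        · rw [h] at hi; simp at hi
        · exact h
      rw [h1, Nat.mul_one] at hi
      refine ⟨?_, by rwa [him]⟩
      rw [hi0]
      have : (b % 2 ^ 12).testBit 0 = true := by rw [h1]; rfl
      rw [Nat.testBit_mod_two_pow] at this
      simpa using this
    · have hblt : b / 2 ^ 12 < b := Nat.div_lt_self hpos (by norm_num)
      obtain ⟨h1, h2⟩ := ih _ hblt (fun j hj => by
        rw [hdiv] at hj
        have := hb _ hj
        omega) (i - 12) hi
      rw [hdiv] at h1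
      have e1 : 12 + 12 * ((i - 12) / 12) = 12 * (i / 12) := by omega
      have e2 : (i - 12) % 12 = i % 12 := by omega
      rw [e1] at h1
      rw [e2] at h2
      exact ⟨h1, h2⟩

theorem testBit_mul_spread {a b : ℕ} (ha : a < 2 ^ 12)
    (hb : ∀ i, b.testBit i = true → 64 ≤ i ∧ (i - 64) % 12 = 0) {i : ℕ}
    (h : (a * b).testBit i = true) : 64 ≤ i ∧ b.testBit (64 + 12 * ((i - 64) / 12)) = true ∧
      a.testBit ((i - 64) % 12) = true := by
  have hb64 : b = 2 ^ 64 * (b / 2 ^ 64) := by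
    rw [Nat.mul_div_cancel']
    apply Nat.dvd_of_mod_eq_zero
    apply Nat.eq_of_testBit_eq
    intro j
    rw [Nat.testBit_mod_two_pow, Nat.zero_testBit]
    by_contra hc
    rw [Bool.not_eq_false, Bool.and_eq_true, decide_eq_true_eq] at hc
    have := (hb j hc.2).1
    omega
  rw [hb64, Nat.mul_left_comm, Nat.testBit_two_pow_mul, Bool.and_eq_true, decide_eq_true_eq] at h
  obtain ⟨h3, h4⟩ := testBit_mul_sparse ha (b / 2 ^ 64) (fun j hj => by
    rw [Nat.testBit_div_two_pow] at hj
    have := (hb _ hj).2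
    rwa [Nat.add_sub_cancel] at this) _ h.2
  rw [Nat.testBit_div_two_pow, Nat.add_comm] at h3
  exact ⟨h.1, h3, h4⟩

/-- The code of an item. -/
def Item.code (it : Item) : Code := (it.g.lo, it.g.hi)

/-- The entries of `g` are right for the list `Q` of all codes. -/
def Geo.Valid (Q : List Code) (g : Geo) : Prop :=
  g.idx < 16 ∧ Q[g.idx]? = some (g.lo, g.hi) ∧ g.sh = 208 + 12 * g.idx ∧
    g.shS = 336 + 144 * g.idx ∧ g.nb = nonMask (g.lo, g.hi) 12 208 Q ∧
    g.nbS = nonMask (g.lo, g.hi) 144 336 Q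

/-- The items offer combination `t` enough copies to place the codes in `rem`. -/
def Offers (Q : List Code) (t : ℕ) (items : List Item) (rem : List Code) : Prop :=
  ∀ it ∈ items, it.g.Valid Q ∧ ∀ k < rem.count it.code, it.mp.testBit (32 * k + t) = true

theorem Offers.step {Q : List Code} {t : ℕ} {l₁ l₂ : List Item} {it : Item} {rem : List Code}
    (h : Offers Q t (l₁ ++ it :: l₂) (it.code :: rem))
    (hnd : ((l₁ ++ it :: l₂).map Item.code).Nodup) :
    Offers Q t (l₁ ++ ⟨it.mp >>> 32, it.g⟩ :: l₂) rem := by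
  have hcode : Item.code ⟨it.mp >>> 32, it.g⟩ = it.code := rfl
  have hne : ∀ x, x ∈ l₁ ∨ x ∈ l₂ → x.code ≠ it.code := by
    intro x hx he
    rw [List.map_append, List.map_cons] at hnd
    have hnd' := List.nodup_middle.1 hnd
    rw [List.nodup_cons] at hnd'
    apply hnd'.1
    rw [← he, ← List.map_append]
    exact List.mem_map_of_mem (by simpa using hx)
  intro x hx
  rw [List.mem_append, List.mem_cons] at hx
  rcases hx with hx | rfl | hx
  · obtain ⟨h1, h2⟩ := h x (by simp [hx])
    refine ⟨h1, fun k hk => h2 k ?_⟩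
    rw [List.count_cons_of_ne (hne x (Or.inl hx)).symm]; exact hk
  · obtain ⟨h1, h2⟩ := h it (by simp)
    refine ⟨h1, fun k hk => ?_⟩
    rw [hcode] at hk
    have := h2 (k + 1) (by rw [List.count_cons_self]; omega)
    show (it.mp >>> 32).testBit _ = true
    rw [Nat.testBit_shiftRight]
    rwa [show 32 + (32 * k + t) = 32 * (k + 1) + t by ring]
  · obtain ⟨h1, h2⟩ := h x (by simp [hx])
    refine ⟨h1, fun k hk => h2 k ?_⟩
    rw [List.count_cons_of_ne (hne x (Or.inr hx)).symm]; exact hk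

/-- A box is given by three codes; boxes are neighbours if their codes touch in some coordinate. -/
abbrev Box : Type := Code × Code × Code

abbrev Nb (x y : Box) : Prop :=
  Touch x.1 y.1 ∨ Touch x.2.1 y.2.1 ∨ Touch x.2.2 y.2.2

theorem Nb.symm {x y : Box} (h : Nb x y) : Nb y x :=
  h.imp Touch.symm (Or.imp Touch.symm Touch.symm)

/-- `S` describes the boxes placed so far: a bit in the range from `64` to `207` stands for a pair
that touches in neither of the first two coordinates, and a higher bit for a code in `Q` and a box
whose second code it does not touch. -/
structure Describes (Q : List Code) (S : ℕ) (l : List Box) : Prop where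
  pairs : ∀ i, 64 ≤ i → i < 208 → S.testBit i = true → ∃ u v, ∃ hu : u < l.length,
    ∃ hv : v < l.length, u ≠ v ∧ i = 64 + 12 * u + v ∧ ¬ Touch l[u].1 l[v].1 ∧
      ¬ Touch l[u].2.1 l[v].2.1
  near : ∀ i, 208 ≤ i → i < 400 → S.testBit i = true → ∃ k u, ∃ hk : k < Q.length,
    ∃ hu : u < l.length, i = 208 + 12 * k + u ∧ ¬ Touch Q[k] l[u].2.1
  far : ∀ i, 400 ≤ i → S.testBit i = true → ∃ k u, ∃ hk : k < Q.length,
    ∃ hu : u < l.length, i = 400 + 144 * k + 12 * u ∧ ¬ Touch Q[k] l[u].2.1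

theorem testBit_one_shiftLeft (n i : ℕ) : (1 <<< n).testBit i = decide (n = i) := by
  rw [Nat.one_shiftLeft, Nat.testBit_two_pow]

theorem lt_two_pow_of_testBit {a n : ℕ} (h : ∀ i, a.testBit i = true → i < n) : a < 2 ^ n := by
  apply Nat.lt_pow_two_of_testBit
  intro i hi
  by_contra hc
  have := h i (by simpa using hc)
  omega

/-- The state after placing a code at position `d`. -/
def newState (d idx nb nbS S b a : ℕ) : ℕ :=
  S ||| ((idx <<< (5 * d)) ||| ((nb ||| b) <<< d ||| (nbS ||| a) <<< (64 + 12 * d)))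

theorem place_eq_true {d idx nb nbS S b a : ℕ} {k : ℕ → Bool}
    (h : place d (5 * d) (64 + 12 * d) idx nb nbS S k b a = true) (h' : S &&& (a * b) = 0) :
    k (newState d idx nb nbS S b a) = true := by
  have h0 : Nat.beq (Nat.land S (Nat.mul a b)) 0 = true := by
    rw [Nat.beq_eq]; exact h'
  unfold place at h
  rw [h0] at h
  rw [← force_eq k]
  exact h

theorem Describes.place {Q : List Code} {S : ℕ} {l : List Box} (hS : Describes Q S l) {x : Box}
    {g : Geo} (hg : g.Valid Q) (hQ : Q.length ≤ 16) (hx : x.2.1 = (g.lo, g.hi))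
    (hpos : ∀ y ∈ l ++ [x], y.2.2.1 < y.2.2.2)
    (hnb : (l ++ [x]).Pairwise Nb) (hlen : l.length < 12) {tw : Bool} {k : ℕ → Bool}
    (h : tryPlace (mkRow l.length (nonMask x.1 1 0 (l.map Prod.fst)) tw)
      g.idx g.sh g.shS g.nb g.nbS S k = true) :
    ∃ S', k S' = true ∧ Describes Q S' (l ++ [x]) := by
  obtain ⟨hidx, hQg, hsh, hshS, hgnb, hgnbS⟩ := hg
  obtain ⟨hidxQ, hQg⟩ := List.getElem?_eq_some_iff.1 hQg
  obtain ⟨⟨a1, a2⟩, ⟨b1, b2⟩, c⟩ := x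
  obtain ⟨rfl, rfl⟩ : b1 = g.lo ∧ b2 = g.hi := by simpa using hx
  rw [List.pairwise_append] at hnb
  obtain ⟨hnb1, -, hnb2⟩ := hnb
  set n := l.length with hn
  set non := nonMask (a1, a2) 1 0 (l.map Prod.fst) with hnon
  set nonS := spread non 12 with hnonS
  set a := non &&& (S >>> g.sh) with ha
  set b := nonS &&& (S >>> g.shS) with hb
  have hbit_non : ∀ v, non.testBit v = true → ∃ hv : v < l.length, ¬ Touch (a1, a2) l[v].1 := by
    intro v hv
    obtain ⟨j, hj, h1, h2⟩ := testBit_nonMask hv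
    rw [Nat.zero_add, Nat.one_mul] at h1
    subst h1
    exact ⟨by simpa using hj, by simpa using h2⟩
  have hbit_a : ∀ v, a.testBit v = true → ∃ hv : v < l.length,
      ¬ Touch (a1, a2) l[v].1 ∧ ¬ Touch (g.lo, g.hi) l[v].2.1 := by
    intro v hv
    rw [ha, Nat.testBit_and, Bool.and_eq_true, Nat.testBit_shiftRight, hsh] at hv
    obtain ⟨hv', h3⟩ := hbit_non v hv.1
    obtain ⟨j, u, hj, hu, h1, h2⟩ := hS.near _ (by omega) (by omega) hv.2
    obtain ⟨e1, e2⟩ : j = g.idx ∧ u = v := by omega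
    subst e1 e2
    rw [hQg] at h2
    exact ⟨hu, h3, h2⟩
  have hbit_b : ∀ i, b.testBit i = true → ∃ u, ∃ hu : u < l.length, i = 64 + 12 * u ∧
      ¬ Touch (a1, a2) l[u].1 ∧ ¬ Touch (g.lo, g.hi) l[u].2.1 := by
    intro i hi
    rw [hb, Nat.testBit_and, Bool.and_eq_true, Nat.testBit_shiftRight, hshS] at hi
    obtain ⟨v, hv, rfl, h3⟩ := testBit_spread hi.1
    obtain ⟨hv', h4⟩ := hbit_non v h3
    obtain ⟨j, u, hj, hu, h1, h2⟩ := hS.far _ (by omega) hi.2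
    obtain ⟨e1, e2⟩ : j = g.idx ∧ u = v := by omega
    subst e1 e2
    rw [hQg] at h2
    exact ⟨u, hu, rfl, h4, h2⟩
  have hthird : ∀ v, ∀ hv : v < l.length, ¬ Touch (a1, a2) l[v].1 →
      ¬ Touch (g.lo, g.hi) l[v].2.1 → Touch l[v].2.2 c := by
    intro v hv h1 h2
    rcases hnb2 _ (List.getElem_mem hv) _ (List.mem_singleton_self _) with h | h | h
    · exact absurd h.symm h1
    · exact absurd h.symm h2
    · exact h
  have ha12 : a < 2 ^ 12 := lt_two_pow_of_testBit fun i hi => by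
    obtain ⟨hv, -⟩ := hbit_a i hi
    omega
  have hpairs : ∀ u v, ∀ hu : u < l.length, ∀ hv : v < l.length, u ≠ v → Nb l[u] l[v] := by
    intro u v hu hv hne
    rw [List.pairwise_iff_getElem] at hnb1
    rcases Nat.lt_or_gt_of_ne hne with h | h
    · exact hnb1 _ _ hu hv h
    · exact (hnb1 _ _ hv hu h).symm
  have hk : S &&& (a * b) = 0 → k (newState n g.idx g.nb g.nbS S b a) = true :=
    fun h' => place_eq_true h h'
  clear h
  clear_value a b nonS non
  have hzero : S &&& (a * b) = 0 := by
    apply Nat.eq_of_testBit_eq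
    intro i
    rw [Nat.zero_testBit, Nat.testBit_and]
    by_contra hc
    rw [Bool.not_eq_false, Bool.and_eq_true] at hc
    obtain ⟨h1, h2⟩ := hc
    obtain ⟨hi64, h3, h4⟩ := testBit_mul_spread ha12 (fun j hj => by
      obtain ⟨u, -, hu, -⟩ := hbit_b _ hj
      omega) h2
    obtain ⟨u, hu, hu', hu1, hu2⟩ := hbit_b _ h3
    obtain ⟨hv, hv1, hv2⟩ := hbit_a _ h4
    obtain ⟨u', v', hu'', hv'', hne, hi, h5, h6⟩ := hS.pairs i hi64 (by omega) h1
    have e1 : u' = u := by omega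
    have e2 : (i - 64) % 12 = v' := by omega
    have hv1' : ¬ Touch (a1, a2) l[v'].1 := by simpa only [e2] using hv1
    have hv2' : ¬ Touch (g.lo, g.hi) l[v'].2.1 := by simpa only [e2] using hv2
    subst e1
    have t1 := hthird _ hu hu1 hu2
    have t2 := hthird _ hv'' hv1' hv2'
    rcases hpairs _ _ hu hv'' hne with h | h | h
    · exact h5 h
    · exact h6 h
    · exact Touch.triangle_free (hpos _ (by simp)) (hpos _ (by simp))
        (hpos ((a1, a2), (g.lo, g.hi), c) (by simp)) h t2 t1
  have hlt : ∀ u, u < l.length → u < (l ++ [((a1, a2), (g.lo, g.hi), c)]).length := by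
    intro u hu; rw [List.length_append]; omega
  have hlt' : l.length < (l ++ [((a1, a2), (g.lo, g.hi), c)]).length := by simp
  have hbits : ∀ i, 64 ≤ i → (newState n g.idx g.nb g.nbS S b a).testBit i = true →
      S.testBit i = true ∨
      (∃ j, ∃ hj : j < Q.length, i = 208 + 12 * j + n ∧ ¬ Touch (g.lo, g.hi) Q[j]) ∨
      (∃ u, ∃ hu : u < l.length, i = 64 + 12 * u + n ∧ ¬ Touch (a1, a2) l[u].1 ∧
        ¬ Touch (g.lo, g.hi) l[u].2.1) ∨
      (∃ j, ∃ hj : j < Q.length, i = 400 + 144 * j + 12 * n ∧ ¬ Touch (g.lo, g.hi) Q[j]) ∨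
      (∃ u, ∃ hu : u < l.length, i = 64 + 12 * n + u ∧ ¬ Touch (a1, a2) l[u].1 ∧
        ¬ Touch (g.lo, g.hi) l[u].2.1) := by
    intro i hi1 hi
    simp only [newState, Nat.testBit_or, Nat.testBit_shiftLeft, Bool.or_eq_true, Bool.and_eq_true,
      decide_eq_true_eq] at hi
    rcases hi with hi | ⟨-, hi⟩ | ⟨h1, hi | hi⟩ | ⟨h1, hi | hi⟩
    · exact Or.inl hi
    · exfalso
      have : g.idx < 2 ^ (i - 5 * n) := lt_of_lt_of_le hidx
        (by calc 16 = 2 ^ 4 := by norm_num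
              _ ≤ 2 ^ (i - 5 * n) := Nat.pow_le_pow_right (by norm_num) (by omega))
      rw [Nat.testBit_lt_two_pow this] at hi
      exact absurd hi (by simp)
    · rw [hgnb] at hi
      obtain ⟨j, hj, h2, h3⟩ := testBit_nonMask hi
      exact Or.inr (Or.inl ⟨j, hj, by omega, h3⟩)
    · obtain ⟨u, hu, h2, h3⟩ := hbit_b _ hi
      exact Or.inr (Or.inr (Or.inl ⟨u, hu, by omega, h3⟩))
    · rw [hgnbS] at hi
      obtain ⟨j, hj, h2, h3⟩ := testBit_nonMask hi
      exact Or.inr (Or.inr (Or.inr (Or.inl ⟨j, hj, by omega, h3⟩)))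
    · obtain ⟨hv, h3⟩ := hbit_a _ hi
      exact Or.inr (Or.inr (Or.inr (Or.inr ⟨_, hv, by omega, h3⟩)))
  refine ⟨_, hk hzero, ?_, ?_, ?_⟩
  · intro i hi1 hi2 hi
    rcases hbits i hi1 hi with hi | ⟨j, hj, h1, -⟩ | ⟨u, hu, h1, h2, h3⟩ | ⟨j, hj, h1, -⟩ |
      ⟨u, hu, h1, h2, h3⟩
    · obtain ⟨u, v, hu, hv, h1, h2, h3, h4⟩ := hS.pairs i hi1 hi2 hi
      refine ⟨u, v, hlt u hu, hlt v hv, h1, h2, ?_, ?_⟩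
      · rwa [List.getElem_append_left hu, List.getElem_append_left hv]
      · rwa [List.getElem_append_left hu, List.getElem_append_left hv]
    · omega
    · refine ⟨u, l.length, hlt u hu, hlt', by omega, by omega, ?_, ?_⟩
      · rw [List.getElem_append_left hu, List.getElem_concat_length rfl]
        exact fun h => h2 h.symm
      · rw [List.getElem_append_left hu, List.getElem_concat_length rfl]
        exact fun h => h3 h.symm
    · omega
    · refine ⟨l.length, u, hlt', hlt u hu, by omega, by omega, ?_, ?_⟩
      · rwa [List.getElem_append_left hu, List.getElem_concat_length rfl]
      · rwa [List.getElem_append_left hu, List.getElem_concat_length rfl]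
  · intro i hi1 hi2 hi
    rcases hbits i (by omega) hi with hi | ⟨j, hj, h1, h2⟩ | ⟨u, hu, h1, -⟩ | ⟨j, hj, h1, -⟩ |
      ⟨u, hu, h1, -⟩
    · obtain ⟨j, u, hj, hu, h1, h2⟩ := hS.near i hi1 hi2 hi
      refine ⟨j, u, hj, hlt u hu, h1, ?_⟩
      rwa [List.getElem_append_left hu]
    · refine ⟨j, l.length, hj, hlt', h1, ?_⟩
      rw [List.getElem_concat_length rfl]
      exact fun h => h2 h.symm
    · omega
    · omega
    · omega
  · intro i hi1 hi
    rcases hbits i (by omega) hi with hi | ⟨j, hj, h1, h2⟩ | ⟨u, hu, h1, -⟩ | ⟨j, hj, h1, h2⟩ |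
      ⟨u, hu, h1, -⟩
    · obtain ⟨j, u, hj, hu, h1, h2⟩ := hS.far i hi1 hi
      refine ⟨j, u, hj, hlt u hu, h1, ?_⟩
      rwa [List.getElem_append_left hu]
    · omega
    · omega
    · refine ⟨j, l.length, hj, hlt', h1, ?_⟩
      rw [List.getElem_concat_length rfl]
      exact fun h => h2 h.symm
    · omega

theorem tryAll_eq_true {r : Row} {next : Cont} {m S : ℕ} {p₁ tl pre : List Item} {it : Item}
    (h : tryAll r next m S (p₁ ++ it :: tl) pre = true) :
    tryItem r next m S (p₁.reverse ++ pre) tl it = true := by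
  induction p₁ generalizing pre with
  | nil => exact (band_eq_true.1 h).1
  | cons a p₁ ih =>
    have := ih (band_eq_true.1 h).2
    simpa using this

theorem tryRow_eq_true {r : Row} {next : Cont} {m S : ℕ} {pre suf p₁ tl : List Item} {it : Item}
    (h : tryRow r next S pre suf m = true) (hQ : pre.reverse ++ suf = p₁ ++ it :: tl)
    (htw : r.tw = true → pre.length ≤ p₁.length) :
    tryItem r next m S p₁.reverse tl it = true := by
  obtain ⟨d, d5, dd, non, nonS, tw⟩ := r
  cases tw with
  | false =>
    have h' : tryAll ⟨d, d5, dd, non, nonS, false⟩ next m S (revApp pre suf) [] = true := h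
    rw [revApp_eq, hQ] at h'
    simpa using tryAll_eq_true h'
  | true =>
    have h' : tryAll ⟨d, d5, dd, non, nonS, true⟩ next m S suf pre = true := h
    have hle := htw rfl
    rw [List.append_eq_append_iff] at hQ
    rcases hQ with ⟨q, rfl, rfl⟩ | ⟨q, h1, h2⟩
    · simpa using tryAll_eq_true h'
    · have h3 : q = [] := by
        have := congrArg List.length h1
        rw [List.length_reverse, List.length_append] at this
        exact List.length_eq_zero_iff.1 (by omega)
      subst h3
      rw [List.append_nil] at h1
      rw [List.nil_append] at h2
      subst h2
      rw [← h1, List.reverse_reverse]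
      simpa using tryAll_eq_true (p₁ := []) h'

theorem land_testBit {m n t : ℕ} (hm : m.testBit t = true) (hn : n.testBit t = true) :
    (Nat.land m n).testBit t = true := by
  change (m &&& n).testBit t = true
  rw [Nat.testBit_and, hm, hn]; rfl

theorem ne_zero_of_testBit {m t : ℕ} (hm : m.testBit t = true) : m ≠ 0 := by
  rintro rfl; simp at hm

/-- A search that succeeds has come to a leaf on its way along the given boxes. -/
theorem run_sound {grp : ℕ → List Item} {t M : ℕ} {q : Option (ℕ × ℕ)} {Q : List Code}
    (hnd : Q.Nodup) (hQ16 : Q.length ≤ 16) (hM : M.testBit t = true) (tree : SearchTree) : ∀ (l rest : List Box) (m S : ℕ) (pre suf : List Item),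
    tree.mem M q (rowsFrom (l.map Prod.fst) (rest.map Prod.fst)) = true →
    run grp tree m S pre suf = true → m.testBit t = true → Describes Q S l →
    (∀ y ∈ l ++ rest, y.2.2.1 < y.2.2.2) → (l ++ rest).Pairwise Nb → (l ++ rest).length ≤ 12 →
    (l ++ rest).Pairwise (fun x y => x.1 = y.1 → Q.idxOf x.2.1 ≤ Q.idxOf y.2.1) →
    (pre.reverse ++ suf).map Item.code = Q → (∀ y ∈ rest, y.2.1 ∈ Q) →
    Offers Q t (pre.reverse ++ suf) (rest.map fun y => y.2.1) →
    (∀ x, l.getLast? = some x → pre.length ≤ Q.idxOf x.2.1) →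
    ∃ S' specs, leafTest grp specs S' = true ∧ Describes Q S' (l ++ rest) ∧
      match q with
      | none => specs = none
      | some x => ∃ sl, specs = some sl ∧ ∃ sp ∈ sl, sp.1 = x.1 ∧ sp.2.testBit x.2 = true := by
  induction tree with
  | nil =>
    intro l rest m S pre suf hmem
    simp [SearchTree.mem] at hmem
  | leaf specs =>
    intro l rest m S pre suf hmem hrun hm hS
    intros
    have hrest : rest = [] := by
      cases rest with
      | nil => rfl
      | cons x rest => cases specs <;> simp [SearchTree.mem, rowsFrom] at hmem
    subst hrest
    refine ⟨S, specs, hrun, by simpa using hS, ?_⟩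
    cases specs with
    | none =>
      cases q with
      | none => rfl
      | some x => simp [SearchTree.mem] at hmem
    | some sl =>
      cases q with
      | none => simp [SearchTree.mem] at hmem
      | some x =>
        refine ⟨sl, rfl, ?_⟩
        simp only [SearchTree.mem, Bool.and_eq_true, Option.any_some, List.any_eq_true,
          beq_iff_eq] at hmem
        exact hmem.2
  | node d non tw msk c s ihc ihs =>
    intro l rest m S pre suf hmem hrun hm hS hpos hnb hlen htw hQ hrest hoff hlast
    obtain ⟨hr1, hr2⟩ := band_eq_true.1 hrun
    cases rest with
    | nil =>
      refine ihs l [] m S pre suf ?_ hr2 hm hS hpos hnb hlen htw hQ hrest hoff hlast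
      simpa [SearchTree.mem, rowsFrom] using hmem
    | cons x rest =>
      rw [List.map_cons, rowsFrom, SearchTree.mem, Bool.or_eq_true, Bool.and_eq_true,
        Bool.and_eq_true, Bool.and_eq_true, Bool.and_eq_true, beq_iff_eq, Nat.beq_eq,
        Nat.beq_eq, Nat.beq_eq] at hmem
      rcases hmem with ⟨⟨⟨⟨he1, he2⟩, he3⟩, hmsk⟩, hmem⟩ | hmem
      swap
      · exact ihs l (x :: rest) m S pre suf hmem hr2 hm hS hpos hnb hlen htw hQ hrest hoff hlast
      subst he1 he2 he3
      replace hmsk : msk.testBit t = true := by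
        rw [← hmsk] at hM
        change (msk &&& M).testBit t = true at hM
        rw [Nat.testBit_and, Bool.and_eq_true] at hM
        exact hM.1
      have hm' := land_testBit hm hmsk
      have hr3 := zeroOr_eq_true hr1 (ne_zero_of_testBit hm')
      obtain ⟨it, hit, hcode⟩ : ∃ it ∈ pre.reverse ++ suf, it.code = x.2.1 := by
        have := hrest x (by simp)
        rwa [← hQ, List.mem_map] at this
      obtain ⟨p₁, tl, hsplit⟩ := List.append_of_mem hit
      have hQ' : Q = p₁.map Item.code ++ it.code :: tl.map Item.code := by
        rw [← hQ, hsplit, List.map_append, List.map_cons]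
      have hidx : Q.idxOf x.2.1 = p₁.length := by
        rw [← hcode, hQ', List.idxOf_append_of_notMem, List.idxOf_cons_self, List.length_map,
          Nat.add_zero]
        intro hc
        rw [hQ'] at hnd
        exact (List.nodup_cons.1 (List.nodup_middle.1 hnd)).1 (List.mem_append_left _ hc)
      have hr4 := tryRow_eq_true hr3 hsplit (by
        intro htrue
        have hl : (l.map Prod.fst).getLast? = some x.1 := of_decide_eq_true htrue
        rw [List.getLast?_map, Option.map_eq_some_iff] at hl
        obtain ⟨y, hy, hyx⟩ := hl
        rw [← hidx]
        refine (hlast y hy).trans ?_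
        have hyl : y ∈ l := List.mem_of_getLast? hy
        rw [List.pairwise_append] at htw
        exact htw.2.2 y hyl x (by simp) hyx)
      rw [hsplit] at hoff hQ
      obtain ⟨hvalid, hmp⟩ := hoff it (by simp)
      have hmp0 : it.mp.testBit t = true := by
        have := hmp 0 (by rw [List.map_cons, hcode, List.count_cons_self]; omega)
        simpa using this
      have hm'' := land_testBit hm' hmp0
      have hr5 : tryGeo _ (run grp c) S p₁.reverse tl it.mp it.g _ = true :=
        zeroOr_eq_true (k := tryGeo _ (run grp c) S p₁.reverse tl it.mp it.g) hr4
          (ne_zero_of_testBit hm'')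
      have hsub : (l ++ [x]).Sublist (l ++ x :: rest) := by
        apply List.Sublist.append_left
        simp
      rw [List.length_append, List.length_cons] at hlen
      have hx : x.2.1 = (it.g.lo, it.g.hi) := hcode.symm
      rw [List.length_map] at hr5
      obtain ⟨S', hS'1, hS'2⟩ := hS.place (tw := decide ((l.map Prod.fst).getLast? = some x.1))
        hvalid hQ16 hx (fun y hy => hpos y (hsub.subset hy))
        (hnb.sublist hsub) (by omega) hr5
      have happ : l ++ x :: rest = (l ++ [x]) ++ rest := by simp
      rw [happ] at hpos hnb htw ⊢
      refine ihc (l ++ [x]) rest _ S' p₁.reverse _ ?_ hS'1 hm'' hS'2 hpos hnb ?_ htw ?_ ?_ ?_ ?_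
      · simpa using hmem
      · simp only [List.length_append, List.length_singleton]; omega
      · rw [List.reverse_reverse, ← hQ]
        simp [Item.code]
      · exact fun y hy => hrest y (by simp [hy])
      · rw [List.reverse_reverse]
        refine Offers.step (it := it) ?_ (hQ ▸ hnd)
        rw [List.map_cons] at hoff
        rwa [hcode]
      · intro y hy
        rw [List.getLast?_concat, Option.some.injEq] at hy
        subst hy
        rw [hidx, List.length_reverse]

theorem embAll_eq_true {d need m T : ℕ} {next : EmbCont} {p₁ tl pre : List Item} {it : Item}
    (h : embAll d next m T (p₁ ++ it :: tl) pre need = true) :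
    embItem d need next m T (p₁.reverse ++ pre) tl it = true := by
  induction p₁ generalizing pre with
  | nil => exact (band_eq_true.1 h).1
  | cons a p₁ ih =>
    have := ih (band_eq_true.1 h).2
    simpa using this

/-- The uncovered pairs can be embedded in a third combination if there are boxes. -/
theorem emb_sound {S t : ℕ} {W : List Box} {Q Q' : List Code} (hS : Describes Q S W) (hlen : W.length = 12)
    (hnb : W.Pairwise Nb) : ∀ (n k m T : ℕ) (items : List Item), k + n = 12 →
    emb S (List.range' k n) m T items = true → m.testBit t = true →
    (∀ i, 208 ≤ i → T.testBit i = true → ∃ j u, ∃ hj : j < Q'.length, ∃ hu : u < W.length,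
      i = 208 + 12 * j + u ∧ ¬ Touch Q'[j] W[u].2.2) →
    (items.map Item.code).Nodup → (∀ y ∈ W.drop k, y.2.2 ∈ items.map Item.code) →
    Offers Q' t items ((W.drop k).map fun y => y.2.2) → False := by
  intro n
  induction n with
  | zero =>
    intro k m T items _ h
    exact absurd h (by simp [emb])
  | succ n ih =>
    intro k m T items hk h hm hT hnd hmem hoff
    have hkl : k < W.length := by omega
    rw [List.drop_eq_getElem_cons hkl] at hmem hoff
    obtain ⟨it, hit, hcode⟩ : ∃ it ∈ items, it.code = W[k].2.2 :=
      List.mem_map.1 (hmem W[k] List.mem_cons_self)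
    obtain ⟨p₁, tl, rfl⟩ := List.append_of_mem hit
    obtain ⟨⟨hidx, hQg, hsh, -, hgnb, -⟩, hmp⟩ := hoff it (by simp)
    obtain ⟨hidxQ, hQg⟩ := List.getElem?_eq_some_iff.1 hQg
    have hmp0 : it.mp.testBit t = true := by
      have := hmp 0 (by rw [List.map_cons, hcode, List.count_cons_self]; omega)
      simpa using this
    have hm' := land_testBit hm hmp0
    have hcode' : (it.g.lo, it.g.hi) = W[k].2.2 := hcode
    set need := Nat.land (Nat.shiftRight S (Nat.add 64 (Nat.mul 12 k))) (Nat.sub (Nat.pow 2 k) 1)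
      with hneed
    have h1 : embAll k (emb S (List.range' (k + 1) n)) m T (p₁ ++ it :: tl) [] need = true := by
      rw [← force_eq (embAll k (emb S (List.range' (k + 1) n)) m T (p₁ ++ it :: tl) [])]
      exact h
    have h2 := zeroOr_eq_true (embAll_eq_true h1) (ne_zero_of_testBit hm')
    have hz : need &&& (T >>> it.g.sh) = 0 := by
      apply Nat.eq_of_testBit_eq
      intro v
      rw [Nat.zero_testBit, Nat.testBit_and]
      by_contra hc
      rw [Bool.not_eq_false, Bool.and_eq_true, Nat.testBit_shiftRight, hsh] at hc
      obtain ⟨hv, hTv⟩ := hc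
      change ((S >>> (64 + 12 * k)) &&& (2 ^ k - 1)).testBit v = true at hv
      rw [Nat.testBit_and, Bool.and_eq_true, Nat.testBit_shiftRight,
        Nat.testBit_two_pow_sub_one, decide_eq_true_eq] at hv
      obtain ⟨hv1, hv2⟩ := hv
      obtain ⟨u', v', hu', hv', -, he, h5, h6⟩ := hS.pairs _ (by omega) (by omega) hv1
      have e1 : u' = k := by omega
      have e2 : v' = v := by omega
      clear he
      subst e1 e2
      obtain ⟨j, u, hj, hu, he, h7⟩ := hT _ (by omega) hTv
      obtain ⟨e3, e4⟩ : j = it.g.idx ∧ u = v' := by omega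
      subst e3 e4
      rw [hQg, hcode'] at h7
      have hnb' : Nb W[u] W[u'] := List.pairwise_iff_getElem.1 hnb _ _ hv' hu' hv2
      rcases hnb' with h | h | h
      · exact h5 h.symm
      · exact h6 h.symm
      · exact h7 h.symm
    set T' := T ||| ((it.g.idx <<< (5 * k)) ||| (it.g.nb <<< k)) with hT'
    have h3 : emb S (List.range' (k + 1) n) (Nat.land m it.mp) T'
        (p₁ ++ ⟨it.mp >>> 32, it.g⟩ :: tl) = true := by
      rw [List.append_nil] at h2
      have h0 : Nat.beq (Nat.land need (Nat.shiftRight T it.g.sh)) 0 = true := by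
        rw [Nat.beq_eq]; exact hz
      unfold embGeo at h2
      change Bool.rec (motive := fun _ => Bool) _ _ (Nat.beq (Nat.land need
        (Nat.shiftRight T it.g.sh)) 0) = true at h2
      rw [h0] at h2
      dsimp only at h2
      rw [force_eq, revApp_eq, List.reverse_reverse] at h2
      exact h2
    refine ih (k + 1) _ T' _ (by omega) h3 hm' ?_ ?_ ?_ ?_
    · intro i hi hTi
      simp only [hT', Nat.testBit_or, Nat.testBit_shiftLeft, Bool.or_eq_true, Bool.and_eq_true,
        decide_eq_true_eq] at hTi
      rcases hTi with hTi | ⟨-, hTi⟩ | ⟨hki, hTi⟩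
      · exact hT i hi hTi
      · exfalso
        have : it.g.idx < 2 ^ (i - 5 * k) := lt_of_lt_of_le hidx
          (by calc 16 = 2 ^ 4 := by norm_num
                _ ≤ 2 ^ (i - 5 * k) := Nat.pow_le_pow_right (by norm_num) (by omega))
        rw [Nat.testBit_lt_two_pow this] at hTi
        exact absurd hTi (by simp)
      · rw [hgnb] at hTi
        obtain ⟨j, hj, h4, h5⟩ := testBit_nonMask hTi
        refine ⟨j, k, hj, hkl, by omega, fun h => h5 ?_⟩
        rw [hcode']
        exact h.symm
    · simpa [Item.code] using hnd
    · intro y hy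
      have := hmem y (List.mem_cons_of_mem _ hy)
      simpa [Item.code] using this
    · refine Offers.step (it := it) ?_ hnd
      rwa [List.map_cons, ← hcode] at hoff

/-- The bits of `M` stand for pairs that are related by `R`. -/
def BitsIn (M : ℕ) (R : ℕ → ℕ → Prop) : Prop :=
  ∀ i, M.testBit i = true → ∃ u v, u < 12 ∧ v < 12 ∧ i = 12 * u + v ∧ R u v

theorem BitsIn.insert {M : ℕ} {R : ℕ → ℕ → Prop} (h : BitsIn M R) {u v : ℕ} (hu : u < 12)
    (hv : v < 12) (h1 : R u v) (h2 : R v u) :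
    BitsIn (M ||| (1 <<< (12 * u + v) ||| 1 <<< (12 * v + u))) R := by
  intro i hi
  rw [Nat.testBit_or, Nat.testBit_or, testBit_one_shiftLeft, testBit_one_shiftLeft,
    Bool.or_eq_true, Bool.or_eq_true, decide_eq_true_eq, decide_eq_true_eq] at hi
  rcases hi with hi | hi | hi
  · exact h i hi
  · exact ⟨u, v, hu, hv, hi.symm, h1⟩
  · exact ⟨v, u, hv, hu, hi.symm, h2⟩

theorem colorEdge_eq_true {next : ℕ → ℕ → Bool} {u v bit M N : ℕ} {R : ℕ → ℕ → Prop}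
    (hM : BitsIn M R) (hR : ∀ w < 12, R u w → R v w → False)
    (h : colorEdge next (12 * u) (12 * v) bit M N = true) : next (M ||| bit) N = true := by
  have h0 : Nat.beq (Nat.land (Nat.land (Nat.shiftRight M (12 * u)) (Nat.shiftRight M (12 * v)))
      4095) 0 = true := by
    rw [Nat.beq_eq]
    change ((M >>> (12 * u)) &&& (M >>> (12 * v))) &&& (2 ^ 12 - 1) = 0
    apply Nat.eq_of_testBit_eq
    intro i
    rw [Nat.zero_testBit, Nat.testBit_and, Nat.testBit_and, Nat.testBit_two_pow_sub_one,
      Nat.testBit_shiftRight, Nat.testBit_shiftRight]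
    by_contra hc
    rw [Bool.not_eq_false, Bool.and_eq_true, Bool.and_eq_true, decide_eq_true_eq] at hc
    obtain ⟨⟨h1, h2⟩, hi⟩ := hc
    obtain ⟨a, b, ha, hb, e1, hab⟩ := hM _ h1
    obtain ⟨c, d, hc, hd, e2, hcd⟩ := hM _ h2
    obtain ⟨rfl, rfl⟩ : a = u ∧ b = i := by omega
    obtain ⟨rfl, rfl⟩ : c = v ∧ d = b := by omega
    exact hR _ hi hab hcd
  unfold colorEdge at h
  rw [h0] at h
  rw [← force_eq (fun M' => next M' N)]
  exact h

/-- Two triangle-free symmetric relations that cover the given edges are found by `color`. -/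
theorem color_sound {R R' : ℕ → ℕ → Prop} (hR : ∀ u v, R u v → R v u)
    (hR' : ∀ u v, R' u v → R' v u) (es : List Edge)
    (h3 : ∀ u v w, u < 12 → v < 12 → w < 12 → R u v → R v w → R u w → False)
    (h3' : ∀ u v w, u < 12 → v < 12 → w < 12 → R' u v → R' v w → R' u w → False)
    (hes : ∀ e ∈ es, e.u < 12 ∧ e.v < 12 ∧ (R e.u e.v ∨ R' e.u e.v)) :
    ∀ M N, BitsIn M R → BitsIn N R' → color es M N = true → False := by
  induction es with
  | nil => intro M N _ _ h; exact absurd h (by simp [color])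
  | cons e es ih =>
    intro M N hM hN h
    obtain ⟨u, v⟩ := e
    obtain ⟨hu, hv, huv⟩ := hes ⟨u, v⟩ (by simp)
    have ih := ih fun e he => hes e (List.mem_cons_of_mem _ he)
    obtain ⟨h1, h2⟩ := band_eq_true.1 h
    rcases huv with huv | huv
    · exact ih _ _ (hM.insert hu hv huv (hR _ _ huv)) hN (colorEdge_eq_true hM
        (fun w hw ha hb => h3 u v w hu hv hw huv hb ha) h1)
    · exact ih _ _ hM (hN.insert hu hv huv (hR' _ _ huv)) (colorEdge_eq_true hN
        (fun w hw ha hb => h3' u v w hu hv hw huv hb ha) h2)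

/-! ### Solutions of the construction problem for codes -/

/-- There are boxes with the given codes in the three coordinates, any two of them neighbours. -/
def Sol (X Y Z : List Code) : Prop :=
  ∃ l : List Box, (l.map fun x => x.1).Perm X ∧ (l.map fun x => x.2.1).Perm Y ∧
    (l.map fun x => x.2.2).Perm Z ∧ l.Pairwise Nb

theorem Sol.swap {X Y Z : List Code} (h : Sol X Y Z) : Sol Y X Z := by
  obtain ⟨l, h1, h2, h3, h4⟩ := h
  refine ⟨l.map fun x => (x.2.1, x.1, x.2.2), ?_, ?_, ?_, ?_⟩
  · rwa [List.map_map]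
  · rwa [List.map_map]
  · rwa [List.map_map]
  · rw [List.pairwise_map]
    exact h4.imp fun h => by
      rcases h with h | h | h
      exacts [Or.inr (Or.inl h), Or.inl h, Or.inr (Or.inr h)]

theorem Sol.rotate {X Y Z : List Code} (h : Sol X Y Z) : Sol Y Z X := by
  obtain ⟨l, h1, h2, h3, h4⟩ := h
  refine ⟨l.map fun x => (x.2.1, x.2.2, x.1), ?_, ?_, ?_, ?_⟩
  · rwa [List.map_map]
  · rwa [List.map_map]
  · rwa [List.map_map]
  · rw [List.pairwise_map]
    exact h4.imp fun h => by
      rcases h with h | h | h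
      exacts [Or.inr (Or.inr h), Or.inl h, Or.inr (Or.inl h)]

theorem Sol.perm {X Y Z X' : List Code} (h : Sol X Y Z) (hX : X.Perm X') : Sol X' Y Z := by
  obtain ⟨l, h1, h2, h3, h4⟩ := h
  exact ⟨l, h1.trans hX, h2, h3, h4⟩

theorem Sol.map {X Y Z : List Code} (h : Sol X Y Z) {f : Code → Code}
    (hf : ∀ p ∈ X, ∀ q ∈ X, Touch p q → Touch (f p) (f q)) : Sol (X.map f) Y Z := by
  obtain ⟨l, h1, h2, h3, h4⟩ := h
  refine ⟨l.map fun x => (f x.1, x.2), ?_, ?_, ?_, ?_⟩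
  · have := h1.map f
    rwa [List.map_map] at this ⊢
  · rwa [List.map_map]
  · rwa [List.map_map]
  · rw [List.pairwise_map]
    refine h4.imp_of_mem fun hx hy h => h.imp_left fun h => hf _ ?_ _ ?_ h
    · exact h1.mem_iff.1 (List.mem_map_of_mem hx)
    · exact h1.mem_iff.1 (List.mem_map_of_mem hy)

theorem exists_perm_map_eq {α β : Type*} [DecidableEq β] (f : α → β) (r : α → α → Prop)
    (W : List β) : ∀ l : List α, l.Pairwise r → (l.map f).Perm W →
      ∃ l' : List α, l'.Perm l ∧ l'.map f = W ∧ l'.Pairwise fun x y => f x = f y → r x y := by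
  induction W with
  | nil =>
    intro l _ h
    rw [List.perm_nil, List.map_eq_nil_iff] at h
    subst h
    exact ⟨[], .nil, rfl, .nil⟩
  | cons w W ih =>
    intro l hl h
    have hw : w ∈ l.map f := h.mem_iff.2 (by simp)
    obtain ⟨i, hi⟩ : ∃ i, l.findIdx? (fun x => decide (f x = w)) = some i := by
      obtain ⟨x, hx, rfl⟩ := List.mem_map.1 hw
      cases hfi : l.findIdx? (fun y => decide (f y = f x)) with
      | some i => exact ⟨i, rfl⟩
      | none =>
        rw [List.findIdx?_eq_none_iff] at hfi
        simpa using hfi x hx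
    rw [List.findIdx?_eq_some_iff_getElem] at hi
    obtain ⟨hil, hfi, hmin⟩ := hi
    have hfi : f l[i] = w := by simpa using hfi
    have hperm : l.Perm (l[i] :: (l.take i ++ l.drop (i + 1))) := by
      conv_lhs => rw [← List.take_append_drop i l, List.drop_eq_getElem_cons hil]
      exact List.perm_middle
    have hsub : (l.take i ++ l.drop (i + 1)).Sublist l := by
      conv_rhs => rw [← List.take_append_drop i l, List.drop_eq_getElem_cons hil]
      exact (List.sublist_cons_self _ _).append_left _
    obtain ⟨l', h1, h2, h3⟩ := ih _ (hl.sublist hsub) (by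
      have := (hperm.map f).symm.trans h
      rw [List.map_cons, hfi] at this
      exact this.cons_inv)
    refine ⟨l[i] :: l', (h1.cons _).trans hperm.symm, by rw [List.map_cons, hfi, h2], ?_⟩
    refine List.pairwise_cons.2 ⟨fun y hy he => ?_, h3⟩
    rw [h1.mem_iff, List.mem_append] at hy
    rcases hy with hy | hy
    · obtain ⟨j, hj, rfl⟩ := List.mem_take_iff_getElem.1 hy
      have := hmin j (by omega)
      rw [← he, hfi] at this
      simp at this
    · obtain ⟨j, hj, rfl⟩ := List.mem_drop_iff_getElem.1 hy
      exact List.pairwise_iff_getElem.1 hl _ _ hil (by omega) (by omega)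

/-- The number of pairs that touch. -/
def edgeCount : List Code → ℕ
  | [] => 0
  | a :: l => l.countP (fun b => decide (Touch a b)) + edgeCount l

theorem edgeCount_perm {l l' : List Code} (h : l.Perm l') : edgeCount l = edgeCount l' := by
  induction h with
  | nil => rfl
  | cons a h ih => rw [edgeCount, edgeCount, ih, h.countP_eq]
  | swap a b l =>
    simp only [edgeCount, List.countP_cons]
    have : Touch a b ↔ Touch b a := ⟨Touch.symm, Touch.symm⟩
    simp only [this]
    omega
  | trans _ _ ih1 ih2 => exact ih1.trans ih2

theorem length_le_countP {a : Box} {l : List Box} (h : ∀ b ∈ l, Nb a b) :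
    l.length ≤ l.countP (fun b => decide (Touch a.1 b.1)) +
      l.countP (fun b => decide (Touch a.2.1 b.2.1)) +
      l.countP (fun b => decide (Touch a.2.2 b.2.2)) := by
  induction l with
  | nil => simp
  | cons b l ih =>
    have ih := ih fun x hx => h x (List.mem_cons_of_mem _ hx)
    have hb := h b (by simp)
    simp only [List.countP_cons, List.length_cons, decide_eq_true_eq]
    rcases hb with hb | hb | hb <;> rw [if_pos hb] <;> omega

theorem Sol.choose_le {X Y Z : List Code} (h : Sol X Y Z) :
    X.length.choose 2 ≤ edgeCount X + edgeCount Y + edgeCount Z := by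
  obtain ⟨l, h1, h2, h3, h4⟩ := h
  rw [← h1.length_eq, ← edgeCount_perm h1, ← edgeCount_perm h2, ← edgeCount_perm h3,
    List.length_map]
  clear h1 h2 h3
  induction l with
  | nil => simp
  | cons a l ih =>
    rw [List.pairwise_cons] at h4
    have ih := ih h4.2
    replace h4 := h4.1
    have hc := length_le_countP h4
    simp only [List.map_cons, edgeCount, List.countP_map, List.length_cons]
    have hch : (l.length + 1).choose 2 = l.length + l.length.choose 2 := by
      rw [Nat.choose_succ_succ' l.length 1, Nat.choose_one_right]
    simp only [Function.comp_def]
    omega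

/-- All codes are those of intervals of positive length. -/
abbrev Pos (X : List Code) : Prop := ∀ p ∈ X, p.1 < p.2

/-! ### One combination -/

def pairsBelow (n : ℕ) : List Edge :=
  (List.range n).flatMap fun v => (List.range v).map fun u => ⟨u, v⟩

def coEdges (W : List Code) (es : List Edge) : List Edge :=
  es.filter fun e => !decide (Touch (W.getD e.u (0, 0)) (W.getD e.v (0, 0)))

theorem Sol.color_eq_false {X Y Z : List Code} {es : List Edge} (hlen : X.length = 12) (hY : Pos Y)
    (hZ : Pos Z) (hes : ∀ e ∈ es, e.u < e.v ∧ e.v < 12) (h : Sol X Y Z) :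
    color (coEdges X es) 0 0 = false := by
  rw [← Bool.not_eq_true]
  intro hc
  obtain ⟨l, h1, h2, h3, h4⟩ := h
  obtain ⟨l', hl', hX, -⟩ := exists_perm_map_eq (fun x : Box => x.1) (fun _ _ => True) X l
    (List.pairwise_of_forall fun _ _ => trivial) h1
  have h4 : l'.Pairwise Nb := (hl'.pairwise_iff Nb.symm).2 h4
  have hlen' : l'.length = 12 := by rw [← hlen, ← hX, List.length_map]
  have hYl : ∀ u (hu : u < l'.length), l'[u].2.1.1 < l'[u].2.1.2 := fun u hu =>
    hY _ (h2.mem_iff.1 (List.mem_map.2 ⟨_, hl'.mem_iff.1 (List.getElem_mem hu), rfl⟩))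
  have hZl : ∀ u (hu : u < l'.length), l'[u].2.2.1 < l'[u].2.2.2 := fun u hu =>
    hZ _ (h3.mem_iff.1 (List.mem_map.2 ⟨_, hl'.mem_iff.1 (List.getElem_mem hu), rfl⟩))
  refine color_sound (R := fun u v => ∃ hu : u < l'.length, ∃ hv : v < l'.length,
      Touch l'[u].2.1 l'[v].2.1) (R' := fun u v => ∃ hu : u < l'.length, ∃ hv : v < l'.length,
      Touch l'[u].2.2 l'[v].2.2) ?_ ?_ (coEdges X es) ?_ ?_ ?_ 0 0 ?_ ?_ hc
  · exact fun u v ⟨hu, hv, h⟩ => ⟨hv, hu, h.symm⟩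
  · exact fun u v ⟨hu, hv, h⟩ => ⟨hv, hu, h.symm⟩
  · exact fun u v w _ _ _ ⟨hu, hv, h⟩ ⟨_, hw, h'⟩ ⟨_, _, h''⟩ =>
      Touch.triangle_free (hYl u hu) (hYl v hv) (hYl w hw) h h' h''
  · exact fun u v w _ _ _ ⟨hu, hv, h⟩ ⟨_, hw, h'⟩ ⟨_, _, h''⟩ =>
      Touch.triangle_free (hZl u hu) (hZl v hv) (hZl w hw) h h' h''
  · intro e he
    rw [coEdges, List.mem_filter] at he
    obtain ⟨he1, he2⟩ := he
    obtain ⟨huv, hv⟩ := hes e he1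
    refine ⟨by omega, hv, ?_⟩
    have hu' : e.u < l'.length := by omega
    have hv' : e.v < l'.length := by omega
    have he3 : ¬ Touch l'[e.u].1 l'[e.v].1 := by
      simpa [← hX, List.getD_eq_getElem?_getD, hu', hv'] using he2
    rcases List.pairwise_iff_getElem.1 h4 _ _ hu' hv' huv with h | h | h
    · exact absurd h he3
    · exact Or.inl ⟨hu', hv', h⟩
    · exact Or.inr ⟨hu', hv', h⟩
  · intro i hi; simp at hi
  · intro i hi; simp at hi

/-! ### Two and three combinations -/

/-- The items fit the list of codes, as combination `t`. -/
structure Fits (t : ℕ) (items : List Item) (Y : List Code) : Prop where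
  nodup : (items.map Item.code).Nodup
  length_le : items.length ≤ 16
  mem : ∀ p ∈ Y, p ∈ items.map Item.code
  offers : Offers (items.map Item.code) t items Y

theorem Offers.perm {Q : List Code} {t : ℕ} {items : List Item} {Y Y' : List Code}
    (h : Offers Q t items Y)
    (hY : Y.Perm Y') : Offers Q t items Y' := fun it hit =>
  ⟨(h it hit).1, fun k hk => (h it hit).2 k (by rwa [hY.count_eq])⟩

theorem Fits.perm {t : ℕ} {items : List Item} {Y Y' : List Code} (h : Fits t items Y)
    (hY : Y.Perm Y') : Fits t items Y' :=
  ⟨h.nodup, h.length_le, fun p hp => h.mem p (hY.mem_iff.2 hp), h.offers.perm hY⟩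

theorem Sol.run {X Y Z : List Code} {grp : ℕ → List Item} {tree : SearchTree} {m t M : ℕ}
    {items : List Item} {q : Option (ℕ × ℕ)} (hlen : X.length = 12) (hZ : Pos Z)
    (hY : Fits t items Y) (hm : m.testBit t = true)
    (hM : M.testBit t = true)
    (hmem : tree.mem M q (rowsFrom [] X) = true) (hrun : run grp tree m 0 [] items = true)
    (hq : ∀ x ∈ q, Fits x.2 (grp x.1) Z) (h : Sol X Y Z) : False := by
  obtain ⟨l, h1, h2, h3, h4⟩ := h
  set Q := items.map Item.code with hQ
  set r : Box → Box → Prop := fun x y => Q.idxOf x.2.1 ≤ Q.idxOf y.2.1 with hr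
  have hdec : DecidableRel r := fun x y => inferInstanceAs (Decidable (_ ≤ _))
  have : Std.Total r := ⟨fun x y => le_total _ _⟩
  have : IsTrans Box r := ⟨fun x y z h h' => le_trans h h'⟩
  obtain ⟨l', hl', hX, hr'⟩ := exists_perm_map_eq (fun x : Box => x.1) r X (l.insertionSort r)
    (List.pairwise_insertionSort r l) (((List.perm_insertionSort r l).map _).trans h1)
  have hl' := hl'.trans (List.perm_insertionSort r l)
  have h4 : l'.Pairwise Nb := (hl'.pairwise_iff Nb.symm).2 h4
  have h2 := (hl'.map _).trans h2
  have h3 := (hl'.map _).trans h3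
  have hlen' : l'.length = 12 := by rw [← hlen, ← hX, List.length_map]
  obtain ⟨S, specs, hS1, hS2, hS3⟩ := run_sound (q := q) hY.nodup
    (by rw [List.length_map]; exact hY.length_le) hM tree [] l' m 0 [] items
    (by rw [show l'.map Prod.fst = X from hX]; exact hmem) hrun hm
    ⟨fun i _ _ hi => by simp at hi, fun i _ _ hi => by simp at hi, fun i _ hi => by simp at hi⟩
    (fun y hy => hZ _ (h3.mem_iff.1 (List.mem_map_of_mem hy))) h4 (by simp [hlen']) hr' rfl
    (fun y hy => hY.mem _ (h2.mem_iff.1 (List.mem_map_of_mem hy)))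
    (hY.offers.perm h2.symm) (by simp)
  cases q with
  | none =>
    subst hS3
    exact absurd hS1 (by simp [leafTest])
  | some x =>
    obtain ⟨sl, rfl, sp, hsp, hsp1, hsp2⟩ := hS3
    have hemb : emb S (List.range' 0 12) sp.2 0 (grp sp.1) = true := by
      have hS4 : List.rec (motive := fun _ => Bool) true (fun sp _ ih =>
        band (emb S [0, 1, 2, 3, 4, 5, 6, 7, 8, 9, 10, 11] sp.2 0 (grp sp.1)) ih) sl = true := hS1
      clear hS1 hS2
      induction sl with
      | nil => simp at hsp
      | cons a sl ih =>
        obtain ⟨h5, h6⟩ := band_eq_true.1 hS4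
        rcases List.mem_cons.1 hsp with rfl | hsp
        · exact h5
        · exact ih hsp h6
    have hZ' := (hq x rfl).perm h3.symm
    rw [hsp1] at hemb
    exact emb_sound hS2 hlen' h4 12 0 _ 0 _ rfl hemb hsp2
      (fun i _ hi => by simp at hi) hZ'.nodup
      (fun y hy => hZ'.mem _ (List.mem_map_of_mem (by simpa using hy))) (by simpa using hZ'.offers)

/-! ### Data for the search -/

def items3 : List Item := [
  ⟨18446744078004518913, ⟨0, 1, 0, 208, 336,
  0x10010000000010000000000000000000000000000000000000000000000000000,
  0x1000000000000000000000000000000000001000000000000000000000000000000000000000000000000000000000000000000000000000000000000000000000000000000000001000000000000000000000000000000000000000000000000000000000000000000000000000000000000⟩⟩,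
  ⟨18446744078004518913, ⟨1, 2, 1, 220, 480,
  0x10000010010000000000000000000000000000000000000000000000000000000,
  0x1000000000000000000000000000000000000000000000000000000000000000000000001000000000000000000000000000000000001000000000000000000000000000000000000000000000000000000000000000000000000000000000000000000000000000000000000000000000000⟩⟩,
  ⟨4294967297, ⟨1, 3, 2, 232, 624,
  0x10010010000000000000000000000000000000000000000000000000000000,
  0x1000000000000000000000000000000000001000000000000000000000000000000000001000000000000000000000000000000000000000000000000000000000000000000000000000000000000000000000000000000000000000000000000⟩⟩,
  ⟨4294967297, ⟨2, 3, 3, 244, 768,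
  0x10010000010000000000000000000000000000000000000000000000000000,
  0x1000000000000000000000000000000000001000000000000000000000000000000000000000000000000000000000000000000000001000000000000000000000000000000000000000000000000000000000000000000000000000000000000⟩⟩,
  ⟨4294967297, ⟨3, 4, 4, 256, 912,
  0x10000000010010000000000000000000000000000000000000000000000000000,
  0x1000000000000000000000000000000000000000000000000000000000000000000000000000000000000000000000000000000000001000000000000000000000000000000000001000000000000000000000000000000000000000000000000000000000000000000000000000000000000⟩⟩]

def items4 : List Item := [
  ⟨332041394383333884159, ⟨0, 1, 0, 208, 336,
  0x10010010010000000000010000000000000000000000000000000000000000000000000000,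
  0x1000000000000000000000000000000000001000000000000000000000000000000000001000000000000000000000000000000000001000000000000000000000000000000000000000000000000000000000000000000000000000000000000000000000000000000000000000000000000000000000000000000000001000000000000000000000000000000000000000000000000000000000000000000000000000000000000⟩⟩,
  ⟨276701162200859934975, ⟨1, 2, 1, 220, 480,
  0x10010000000010010010000000000000000000000000000000000000000000000000000000,
  0x1000000000000000000000000000000000001000000000000000000000000000000000000000000000000000000000000000000000000000000000000000000000000000000000001000000000000000000000000000000000001000000000000000000000000000000000001000000000000000000000000000000000000000000000000000000000000000000000000000000000000000000000000000000000000000000000000⟩⟩,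
  ⟨206158430463, ⟨1, 3, 2, 232, 624,
  0x10000010010010010010000000000000000000000000000000000000000000000000000000,
  0x1000000000000000000000000000000000000000000000000000000000000000000000001000000000000000000000000000000000001000000000000000000000000000000000001000000000000000000000000000000000001000000000000000000000000000000000001000000000000000000000000000000000000000000000000000000000000000000000000000000000000000000000000000000000000000000000000⟩⟩,
  ⟨274877907154, ⟨1, 4, 3, 244, 768,
  0x10010010010010010000000000000000000000000000000000000000000000000000000,
  0x1000000000000000000000000000000000001000000000000000000000000000000000001000000000000000000000000000000000001000000000000000000000000000000000001000000000000000000000000000000000001000000000000000000000000000000000000000000000000000000000000000000000000000000000000000000000000000000000000000000000000⟩⟩,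
  ⟨18446744266983080191, ⟨2, 3, 4, 256, 912,
  0x10000010010010010000010000000000000000000000000000000000000000000000000000,
  0x1000000000000000000000000000000000000000000000000000000000000000000000001000000000000000000000000000000000001000000000000000000000000000000000001000000000000000000000000000000000001000000000000000000000000000000000000000000000000000000000000000000000001000000000000000000000000000000000000000000000000000000000000000000000000000000000000⟩⟩,
  ⟨34359738623, ⟨2, 4, 5, 268, 1056,
  0x10010010010010000010000000000000000000000000000000000000000000000000000,
  0x1000000000000000000000000000000000001000000000000000000000000000000000001000000000000000000000000000000000001000000000000000000000000000000000001000000000000000000000000000000000000000000000000000000000000000000000001000000000000000000000000000000000000000000000000000000000000000000000000000000000000⟩⟩,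
  ⟨743029342463, ⟨3, 4, 6, 280, 1200,
  0x10010000010000010010000000000000000000000000000000000000000000000000000,
  0x1000000000000000000000000000000000001000000000000000000000000000000000000000000000000000000000000000000000001000000000000000000000000000000000000000000000000000000000000000000000001000000000000000000000000000000000001000000000000000000000000000000000000000000000000000000000000000000000000000000000000⟩⟩,
  ⟨824633721087, ⟨4, 5, 7, 292, 1344,
  0x10000000010000010010010000000000000000000000000000000000000000000000000000,
  0x1000000000000000000000000000000000000000000000000000000000000000000000000000000000000000000000000000000000001000000000000000000000000000000000000000000000000000000000000000000000001000000000000000000000000000000000001000000000000000000000000000000000001000000000000000000000000000000000000000000000000000000000000000000000000000000000000⟩⟩]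

def items5 : List Item := [
  ⟨351809361281023, ⟨0, 1, 0, 208, 336,
  0x10010010010010010010000000000000010000000000000000000000000000000000000000000000000000,
  0x1000000000000000000000000000000000001000000000000000000000000000000000001000000000000000000000000000000000001000000000000000000000000000000000001000000000000000000000000000000000001000000000000000000000000000000000001000000000000000000000000000000000000000000000000000000000000000000000000000000000000000000000000000000000000000000000000000000000000000000000000000000000000000000000000000000000001000000000000000000000000000000000000000000000000000000000000000000000000000000000000⟩⟩,
  ⟨310130998640639, ⟨1, 2, 1, 220, 480,
  0x10010010010000000000010010010010000000000000000000000000000000000000000000000000000000,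
  0x1000000000000000000000000000000000001000000000000000000000000000000000001000000000000000000000000000000000001000000000000000000000000000000000000000000000000000000000000000000000000000000000000000000000000000000000000000000000000000000000000000000000001000000000000000000000000000000000001000000000000000000000000000000000001000000000000000000000000000000000001000000000000000000000000000000000000000000000000000000000000000000000000000000000000000000000000000000000000000000000000⟩⟩,
  ⟨202914438793696247807, ⟨1, 3, 2, 232, 624,
  0x10010000000010010010010010010010000000000000000000000000000000000000000000000000000000,
  0x1000000000000000000000000000000000001000000000000000000000000000000000000000000000000000000000000000000000000000000000000000000000000000000000001000000000000000000000000000000000001000000000000000000000000000000000001000000000000000000000000000000000001000000000000000000000000000000000001000000000000000000000000000000000001000000000000000000000000000000000001000000000000000000000000000000000000000000000000000000000000000000000000000000000000000000000000000000000000000000000000⟩⟩,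
  ⟨62560, ⟨1, 4, 3, 244, 768,
  0x10000010010010010010010010010010000000000000000000000000000000000000000000000000000000,
  0x1000000000000000000000000000000000000000000000000000000000000000000000001000000000000000000000000000000000001000000000000000000000000000000000001000000000000000000000000000000000001000000000000000000000000000000000001000000000000000000000000000000000001000000000000000000000000000000000001000000000000000000000000000000000001000000000000000000000000000000000001000000000000000000000000000000000000000000000000000000000000000000000000000000000000000000000000000000000000000000000000⟩⟩,
  ⟨1099511629184, ⟨1, 5, 4, 256, 912,
  0x10010010010010010010010010010000000000000000000000000000000000000000000000000000000,
  0x1000000000000000000000000000000000001000000000000000000000000000000000001000000000000000000000000000000000001000000000000000000000000000000000001000000000000000000000000000000000001000000000000000000000000000000000001000000000000000000000000000000000001000000000000000000000000000000000001000000000000000000000000000000000001000000000000000000000000000000000000000000000000000000000000000000000000000000000000000000000000000000000000000000000000⟩⟩,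
  ⟨85899476991, ⟨2, 3, 5, 268, 1056,
  0x10010000000010010010010010010000010000000000000000000000000000000000000000000000000000,
  0x1000000000000000000000000000000000001000000000000000000000000000000000000000000000000000000000000000000000000000000000000000000000000000000000001000000000000000000000000000000000001000000000000000000000000000000000001000000000000000000000000000000000001000000000000000000000000000000000001000000000000000000000000000000000001000000000000000000000000000000000000000000000000000000000000000000000001000000000000000000000000000000000000000000000000000000000000000000000000000000000000⟩⟩,
  ⟨512, ⟨2, 4, 6, 280, 1200,
  0x10000010010010010010010010010000010000000000000000000000000000000000000000000000000000,
  0x1000000000000000000000000000000000000000000000000000000000000000000000001000000000000000000000000000000000001000000000000000000000000000000000001000000000000000000000000000000000001000000000000000000000000000000000001000000000000000000000000000000000001000000000000000000000000000000000001000000000000000000000000000000000001000000000000000000000000000000000000000000000000000000000000000000000001000000000000000000000000000000000000000000000000000000000000000000000000000000000000⟩⟩,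
  ⟨61440, ⟨2, 5, 7, 292, 1344,
  0x10010010010010010010010010000010000000000000000000000000000000000000000000000000000,
  0x1000000000000000000000000000000000001000000000000000000000000000000000001000000000000000000000000000000000001000000000000000000000000000000000001000000000000000000000000000000000001000000000000000000000000000000000001000000000000000000000000000000000001000000000000000000000000000000000001000000000000000000000000000000000000000000000000000000000000000000000001000000000000000000000000000000000000000000000000000000000000000000000000000000000000⟩⟩,
  ⟨18446814644317323263, ⟨3, 4, 8, 304, 1488,
  0x10000010010010010000010010000010010000000000000000000000000000000000000000000000000000,
  0x1000000000000000000000000000000000000000000000000000000000000000000000001000000000000000000000000000000000001000000000000000000000000000000000001000000000000000000000000000000000001000000000000000000000000000000000000000000000000000000000000000000000001000000000000000000000000000000000001000000000000000000000000000000000000000000000000000000000000000000000001000000000000000000000000000000000001000000000000000000000000000000000000000000000000000000000000000000000000000000000000⟩⟩,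
  ⟨149834229219327, ⟨3, 5, 9, 316, 1632,
  0x10010010010010000010010000010010000000000000000000000000000000000000000000000000000,
  0x1000000000000000000000000000000000001000000000000000000000000000000000001000000000000000000000000000000000001000000000000000000000000000000000001000000000000000000000000000000000000000000000000000000000000000000000001000000000000000000000000000000000001000000000000000000000000000000000000000000000000000000000000000000000001000000000000000000000000000000000001000000000000000000000000000000000000000000000000000000000000000000000000000000000000⟩⟩,
  ⟨281474976841727, ⟨4, 5, 10, 328, 1776,
  0x10010000010000010010000010010010000000000000000000000000000000000000000000000000000,
  0x1000000000000000000000000000000000001000000000000000000000000000000000000000000000000000000000000000000000001000000000000000000000000000000000000000000000000000000000000000000000001000000000000000000000000000000000001000000000000000000000000000000000000000000000000000000000000000000000001000000000000000000000000000000000001000000000000000000000000000000000001000000000000000000000000000000000000000000000000000000000000000000000000000000000000⟩⟩,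
  ⟨291920337305599, ⟨5, 6, 11, 340, 1920,
  0x10000000010000010010000010010010010000000000000000000000000000000000000000000000000000,
  0x1000000000000000000000000000000000000000000000000000000000000000000000000000000000000000000000000000000000001000000000000000000000000000000000000000000000000000000000000000000000001000000000000000000000000000000000001000000000000000000000000000000000000000000000000000000000000000000000001000000000000000000000000000000000001000000000000000000000000000000000001000000000000000000000000000000000001000000000000000000000000000000000000000000000000000000000000000000000000000000000000⟩⟩]

def items6 : List Item := [
  ⟨841813591039, ⟨0, 1, 0, 208, 336,
  0x10010010010010010010010010010000000000000010000000000000000000000000000000000000000000000000000,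
  0x1000000000000000000000000000000000001000000000000000000000000000000000001000000000000000000000000000000000001000000000000000000000000000000000001000000000000000000000000000000000001000000000000000000000000000000000001000000000000000000000000000000000001000000000000000000000000000000000001000000000000000000000000000000000001000000000000000000000000000000000000000000000000000000000000000000000000000000000000000000000000000000000000000000000000000000000000000000000000000000000000000000000000000000000001000000000000000000000000000000000000000000000000000000000000000000000000000000000000⟩⟩,
  ⟨1023, ⟨1, 2, 1, 220, 480,
  0x10010010010010010010000000000010010010010000000000000000000000000000000000000000000000000000000,
  0x1000000000000000000000000000000000001000000000000000000000000000000000001000000000000000000000000000000000001000000000000000000000000000000000001000000000000000000000000000000000001000000000000000000000000000000000001000000000000000000000000000000000000000000000000000000000000000000000000000000000000000000000000000000000000000000000000000000000000000000000001000000000000000000000000000000000001000000000000000000000000000000000001000000000000000000000000000000000001000000000000000000000000000000000000000000000000000000000000000000000000000000000000000000000000000000000000000000000000⟩⟩,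
  ⟨115964118015, ⟨1, 3, 2, 232, 624,
  0x10010010010000000000010010010010010010010000000000000000000000000000000000000000000000000000000,
  0x1000000000000000000000000000000000001000000000000000000000000000000000001000000000000000000000000000000000001000000000000000000000000000000000000000000000000000000000000000000000000000000000000000000000000000000000000000000000000000000000000000000000001000000000000000000000000000000000001000000000000000000000000000000000001000000000000000000000000000000000001000000000000000000000000000000000001000000000000000000000000000000000001000000000000000000000000000000000001000000000000000000000000000000000000000000000000000000000000000000000000000000000000000000000000000000000000000000000000⟩⟩,
  ⟨17179870180, ⟨1, 4, 3, 244, 768,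
  0x10010000000010010010010010010010010010010000000000000000000000000000000000000000000000000000000,
  0x1000000000000000000000000000000000001000000000000000000000000000000000000000000000000000000000000000000000000000000000000000000000000000000000001000000000000000000000000000000000001000000000000000000000000000000000001000000000000000000000000000000000001000000000000000000000000000000000001000000000000000000000000000000000001000000000000000000000000000000000001000000000000000000000000000000000001000000000000000000000000000000000001000000000000000000000000000000000001000000000000000000000000000000000000000000000000000000000000000000000000000000000000000000000000000000000000000000000000⟩⟩,
  ⟨64, ⟨1, 5, 4, 256, 912,
  0x10000010010010010010010010010010010010010000000000000000000000000000000000000000000000000000000,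
  0x1000000000000000000000000000000000000000000000000000000000000000000000001000000000000000000000000000000000001000000000000000000000000000000000001000000000000000000000000000000000001000000000000000000000000000000000001000000000000000000000000000000000001000000000000000000000000000000000001000000000000000000000000000000000001000000000000000000000000000000000001000000000000000000000000000000000001000000000000000000000000000000000001000000000000000000000000000000000001000000000000000000000000000000000000000000000000000000000000000000000000000000000000000000000000000000000000000000000000⟩⟩,
  ⟨1023, ⟨2, 3, 5, 268, 1056,
  0x10010010010000000000010010010010010010000010000000000000000000000000000000000000000000000000000,
  0x1000000000000000000000000000000000001000000000000000000000000000000000001000000000000000000000000000000000001000000000000000000000000000000000000000000000000000000000000000000000000000000000000000000000000000000000000000000000000000000000000000000000001000000000000000000000000000000000001000000000000000000000000000000000001000000000000000000000000000000000001000000000000000000000000000000000001000000000000000000000000000000000001000000000000000000000000000000000000000000000000000000000000000000000001000000000000000000000000000000000000000000000000000000000000000000000000000000000000⟩⟩,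
  ⟨288, ⟨2, 4, 6, 280, 1200,
  0x10010000000010010010010010010010010010000010000000000000000000000000000000000000000000000000000,
  0x1000000000000000000000000000000000001000000000000000000000000000000000000000000000000000000000000000000000000000000000000000000000000000000000001000000000000000000000000000000000001000000000000000000000000000000000001000000000000000000000000000000000001000000000000000000000000000000000001000000000000000000000000000000000001000000000000000000000000000000000001000000000000000000000000000000000001000000000000000000000000000000000001000000000000000000000000000000000000000000000000000000000000000000000001000000000000000000000000000000000000000000000000000000000000000000000000000000000000⟩⟩,
  ⟨512, ⟨2, 5, 7, 292, 1344,
  0x10000010010010010010010010010010010010000010000000000000000000000000000000000000000000000000000,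
  0x1000000000000000000000000000000000000000000000000000000000000000000000001000000000000000000000000000000000001000000000000000000000000000000000001000000000000000000000000000000000001000000000000000000000000000000000001000000000000000000000000000000000001000000000000000000000000000000000001000000000000000000000000000000000001000000000000000000000000000000000001000000000000000000000000000000000001000000000000000000000000000000000001000000000000000000000000000000000000000000000000000000000000000000000001000000000000000000000000000000000000000000000000000000000000000000000000000000000000⟩⟩,
  ⟨18446744224033407999, ⟨3, 4, 8, 304, 1488,
  0x10010000000010010010010010000010010000010010000000000000000000000000000000000000000000000000000,
  0x1000000000000000000000000000000000001000000000000000000000000000000000000000000000000000000000000000000000000000000000000000000000000000000000001000000000000000000000000000000000001000000000000000000000000000000000001000000000000000000000000000000000001000000000000000000000000000000000001000000000000000000000000000000000000000000000000000000000000000000000001000000000000000000000000000000000001000000000000000000000000000000000000000000000000000000000000000000000001000000000000000000000000000000000001000000000000000000000000000000000000000000000000000000000000000000000000000000000000⟩⟩,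
  ⟨34359738778, ⟨3, 5, 9, 316, 1632,
  0x10000010010010010010010010000010010000010010000000000000000000000000000000000000000000000000000,
  0x1000000000000000000000000000000000000000000000000000000000000000000000001000000000000000000000000000000000001000000000000000000000000000000000001000000000000000000000000000000000001000000000000000000000000000000000001000000000000000000000000000000000001000000000000000000000000000000000001000000000000000000000000000000000000000000000000000000000000000000000001000000000000000000000000000000000001000000000000000000000000000000000000000000000000000000000000000000000001000000000000000000000000000000000001000000000000000000000000000000000000000000000000000000000000000000000000000000000000⟩⟩,
  ⟨528, ⟨3, 6, 10, 328, 1776,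
  0x10010010010010010010010000010010000010010000000000000000000000000000000000000000000000000000,
  0x1000000000000000000000000000000000001000000000000000000000000000000000001000000000000000000000000000000000001000000000000000000000000000000000001000000000000000000000000000000000001000000000000000000000000000000000001000000000000000000000000000000000001000000000000000000000000000000000000000000000000000000000000000000000001000000000000000000000000000000000001000000000000000000000000000000000000000000000000000000000000000000000001000000000000000000000000000000000001000000000000000000000000000000000000000000000000000000000000000000000000000000000000⟩⟩,
  ⟨1023, ⟨4, 5, 11, 340, 1920,
  0x10000010010010010000010000010010000010010010000000000000000000000000000000000000000000000000000,
  0x1000000000000000000000000000000000000000000000000000000000000000000000001000000000000000000000000000000000001000000000000000000000000000000000001000000000000000000000000000000000001000000000000000000000000000000000000000000000000000000000000000000000001000000000000000000000000000000000000000000000000000000000000000000000001000000000000000000000000000000000001000000000000000000000000000000000000000000000000000000000000000000000001000000000000000000000000000000000001000000000000000000000000000000000001000000000000000000000000000000000000000000000000000000000000000000000000000000000000⟩⟩,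
  ⟨1023, ⟨4, 6, 12, 352, 2064,
  0x10010010010010000010000010010000010010010000000000000000000000000000000000000000000000000000,
  0x1000000000000000000000000000000000001000000000000000000000000000000000001000000000000000000000000000000000001000000000000000000000000000000000001000000000000000000000000000000000000000000000000000000000000000000000001000000000000000000000000000000000000000000000000000000000000000000000001000000000000000000000000000000000001000000000000000000000000000000000000000000000000000000000000000000000001000000000000000000000000000000000001000000000000000000000000000000000001000000000000000000000000000000000000000000000000000000000000000000000000000000000000⟩⟩,
  ⟨1023, ⟨5, 6, 13, 364, 2208,
  0x10010000010000010000010010000010010010010000000000000000000000000000000000000000000000000000,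
  0x1000000000000000000000000000000000001000000000000000000000000000000000000000000000000000000000000000000000001000000000000000000000000000000000000000000000000000000000000000000000001000000000000000000000000000000000000000000000000000000000000000000000001000000000000000000000000000000000001000000000000000000000000000000000000000000000000000000000000000000000001000000000000000000000000000000000001000000000000000000000000000000000001000000000000000000000000000000000001000000000000000000000000000000000000000000000000000000000000000000000000000000000000⟩⟩,
  ⟨1023, ⟨6, 7, 14, 376, 2352,
  0x10000000010000010010010010010010010010010010000000000000000000000000000000000000000000000000000,
  0x1000000000000000000000000000000000000000000000000000000000000000000000000000000000000000000000000000000000001000000000000000000000000000000000000000000000000000000000000000000000001000000000000000000000000000000000001000000000000000000000000000000000001000000000000000000000000000000000001000000000000000000000000000000000001000000000000000000000000000000000001000000000000000000000000000000000001000000000000000000000000000000000001000000000000000000000000000000000001000000000000000000000000000000000001000000000000000000000000000000000000000000000000000000000000000000000000000000000000⟩⟩]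

def items7 : List Item := [
  ⟨31, ⟨0, 1, 0, 208, 336,
  0x10010010010010010010010010010000000000000010000000000000000000000000000000000000000000000000000,
  0x1000000000000000000000000000000000001000000000000000000000000000000000001000000000000000000000000000000000001000000000000000000000000000000000001000000000000000000000000000000000001000000000000000000000000000000000001000000000000000000000000000000000001000000000000000000000000000000000001000000000000000000000000000000000001000000000000000000000000000000000000000000000000000000000000000000000000000000000000000000000000000000000000000000000000000000000000000000000000000000000000000000000000000000000001000000000000000000000000000000000000000000000000000000000000000000000000000000000000⟩⟩,
  ⟨31, ⟨1, 2, 1, 220, 480,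
  0x10010010010010010010010010000010010010010000000000000000000000000000000000000000000000000000000,
  0x1000000000000000000000000000000000001000000000000000000000000000000000001000000000000000000000000000000000001000000000000000000000000000000000001000000000000000000000000000000000001000000000000000000000000000000000001000000000000000000000000000000000001000000000000000000000000000000000001000000000000000000000000000000000000000000000000000000000000000000000001000000000000000000000000000000000001000000000000000000000000000000000001000000000000000000000000000000000001000000000000000000000000000000000000000000000000000000000000000000000000000000000000000000000000000000000000000000000000⟩⟩,
  ⟨31, ⟨1, 3, 2, 232, 624,
  0x10010010010010010000000000010010010010010000000000000000000000000000000000000000000000000000000,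
  0x1000000000000000000000000000000000001000000000000000000000000000000000001000000000000000000000000000000000001000000000000000000000000000000000001000000000000000000000000000000000001000000000000000000000000000000000000000000000000000000000000000000000000000000000000000000000000000000000000000000000000000000000000000000000001000000000000000000000000000000000001000000000000000000000000000000000001000000000000000000000000000000000001000000000000000000000000000000000001000000000000000000000000000000000000000000000000000000000000000000000000000000000000000000000000000000000000000000000000⟩⟩,
  ⟨16, ⟨1, 4, 3, 244, 768,
  0x10010010010000000010010010010010010010010000000000000000000000000000000000000000000000000000000,
  0x1000000000000000000000000000000000001000000000000000000000000000000000001000000000000000000000000000000000001000000000000000000000000000000000000000000000000000000000000000000000000000000000000000000000000000000000001000000000000000000000000000000000001000000000000000000000000000000000001000000000000000000000000000000000001000000000000000000000000000000000001000000000000000000000000000000000001000000000000000000000000000000000001000000000000000000000000000000000001000000000000000000000000000000000000000000000000000000000000000000000000000000000000000000000000000000000000000000000000⟩⟩,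
  ⟨10, ⟨1, 5, 4, 256, 912,
  0x10010000000010010010010010010010010010010000000000000000000000000000000000000000000000000000000,
  0x1000000000000000000000000000000000001000000000000000000000000000000000000000000000000000000000000000000000000000000000000000000000000000000000001000000000000000000000000000000000001000000000000000000000000000000000001000000000000000000000000000000000001000000000000000000000000000000000001000000000000000000000000000000000001000000000000000000000000000000000001000000000000000000000000000000000001000000000000000000000000000000000001000000000000000000000000000000000001000000000000000000000000000000000000000000000000000000000000000000000000000000000000000000000000000000000000000000000000⟩⟩,
  ⟨31, ⟨2, 3, 5, 268, 1056,
  0x10010010010010010000000000010010010010000010000000000000000000000000000000000000000000000000000,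
  0x1000000000000000000000000000000000001000000000000000000000000000000000001000000000000000000000000000000000001000000000000000000000000000000000001000000000000000000000000000000000001000000000000000000000000000000000000000000000000000000000000000000000000000000000000000000000000000000000000000000000000000000000000000000000001000000000000000000000000000000000001000000000000000000000000000000000001000000000000000000000000000000000001000000000000000000000000000000000000000000000000000000000000000000000001000000000000000000000000000000000000000000000000000000000000000000000000000000000000⟩⟩,
  ⟨17179869215, ⟨3, 4, 6, 280, 1200,
  0x10010010010000000010010010000010010000010010000000000000000000000000000000000000000000000000000,
  0x1000000000000000000000000000000000001000000000000000000000000000000000001000000000000000000000000000000000001000000000000000000000000000000000000000000000000000000000000000000000000000000000000000000000000000000000001000000000000000000000000000000000001000000000000000000000000000000000001000000000000000000000000000000000000000000000000000000000000000000000001000000000000000000000000000000000001000000000000000000000000000000000000000000000000000000000000000000000001000000000000000000000000000000000001000000000000000000000000000000000000000000000000000000000000000000000000000000000000⟩⟩,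
  ⟨4294967299, ⟨3, 5, 7, 292, 1344,
  0x10010000000010010010010010000010010000010010000000000000000000000000000000000000000000000000000,
  0x1000000000000000000000000000000000001000000000000000000000000000000000000000000000000000000000000000000000000000000000000000000000000000000000001000000000000000000000000000000000001000000000000000000000000000000000001000000000000000000000000000000000001000000000000000000000000000000000001000000000000000000000000000000000000000000000000000000000000000000000001000000000000000000000000000000000001000000000000000000000000000000000000000000000000000000000000000000000001000000000000000000000000000000000001000000000000000000000000000000000000000000000000000000000000000000000000000000000000⟩⟩,
  ⟨8, ⟨3, 6, 8, 304, 1488,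
  0x10000010010010010010010010000010010000010010000000000000000000000000000000000000000000000000000,
  0x1000000000000000000000000000000000000000000000000000000000000000000000001000000000000000000000000000000000001000000000000000000000000000000000001000000000000000000000000000000000001000000000000000000000000000000000001000000000000000000000000000000000001000000000000000000000000000000000001000000000000000000000000000000000000000000000000000000000000000000000001000000000000000000000000000000000001000000000000000000000000000000000000000000000000000000000000000000000001000000000000000000000000000000000001000000000000000000000000000000000000000000000000000000000000000000000000000000000000⟩⟩,
  ⟨17179869215, ⟨4, 5, 9, 316, 1632,
  0x10010000000010010010010000010010000010010010000000000000000000000000000000000000000000000000000,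
  0x1000000000000000000000000000000000001000000000000000000000000000000000000000000000000000000000000000000000000000000000000000000000000000000000001000000000000000000000000000000000001000000000000000000000000000000000001000000000000000000000000000000000001000000000000000000000000000000000000000000000000000000000000000000000001000000000000000000000000000000000001000000000000000000000000000000000000000000000000000000000000000000000001000000000000000000000000000000000001000000000000000000000000000000000001000000000000000000000000000000000000000000000000000000000000000000000000000000000000⟩⟩,
  ⟨16, ⟨4, 6, 10, 328, 1776,
  0x10000010010010010010010000010010000010010010000000000000000000000000000000000000000000000000000,
  0x1000000000000000000000000000000000000000000000000000000000000000000000001000000000000000000000000000000000001000000000000000000000000000000000001000000000000000000000000000000000001000000000000000000000000000000000001000000000000000000000000000000000001000000000000000000000000000000000000000000000000000000000000000000000001000000000000000000000000000000000001000000000000000000000000000000000000000000000000000000000000000000000001000000000000000000000000000000000001000000000000000000000000000000000001000000000000000000000000000000000000000000000000000000000000000000000000000000000000⟩⟩,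
  ⟨31, ⟨5, 6, 11, 340, 1920,
  0x10000010010010000010000010010000010010010010000000000000000000000000000000000000000000000000000,
  0x1000000000000000000000000000000000000000000000000000000000000000000000001000000000000000000000000000000000001000000000000000000000000000000000001000000000000000000000000000000000000000000000000000000000000000000000001000000000000000000000000000000000000000000000000000000000000000000000001000000000000000000000000000000000001000000000000000000000000000000000000000000000000000000000000000000000001000000000000000000000000000000000001000000000000000000000000000000000001000000000000000000000000000000000001000000000000000000000000000000000000000000000000000000000000000000000000000000000000⟩⟩,
  ⟨31, ⟨5, 7, 12, 352, 2064,
  0x10010010010000010000010010000010010010010000000000000000000000000000000000000000000000000000,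
  0x1000000000000000000000000000000000001000000000000000000000000000000000001000000000000000000000000000000000001000000000000000000000000000000000000000000000000000000000000000000000001000000000000000000000000000000000000000000000000000000000000000000000001000000000000000000000000000000000001000000000000000000000000000000000000000000000000000000000000000000000001000000000000000000000000000000000001000000000000000000000000000000000001000000000000000000000000000000000001000000000000000000000000000000000000000000000000000000000000000000000000000000000000⟩⟩,
  ⟨31, ⟨6, 7, 13, 364, 2208,
  0x10010000000010000010010010010010010010010000000000000000000000000000000000000000000000000000,
  0x1000000000000000000000000000000000001000000000000000000000000000000000000000000000000000000000000000000000000000000000000000000000000000000000001000000000000000000000000000000000000000000000000000000000000000000000001000000000000000000000000000000000001000000000000000000000000000000000001000000000000000000000000000000000001000000000000000000000000000000000001000000000000000000000000000000000001000000000000000000000000000000000001000000000000000000000000000000000001000000000000000000000000000000000000000000000000000000000000000000000000000000000000⟩⟩,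
  ⟨31, ⟨7, 8, 14, 376, 2352,
  0x10000000010010010010010010010010010010010010000000000000000000000000000000000000000000000000000,
  0x1000000000000000000000000000000000000000000000000000000000000000000000000000000000000000000000000000000000001000000000000000000000000000000000001000000000000000000000000000000000001000000000000000000000000000000000001000000000000000000000000000000000001000000000000000000000000000000000001000000000000000000000000000000000001000000000000000000000000000000000001000000000000000000000000000000000001000000000000000000000000000000000001000000000000000000000000000000000001000000000000000000000000000000000001000000000000000000000000000000000000000000000000000000000000000000000000000000000000⟩⟩]

/-- The items of the combinations of one family, which are numbered in `slots`. -/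
def group : ℕ → List Item
  | 3 => items3
  | 4 => items4
  | 5 => items5
  | 6 => items6
  | 7 => items7
  | _ => []

def searchTree1 : SearchTree :=
  .node 0 0 false 1 (.node 1 1 false 1 (.node 2 3 false 1 (.node 3 7 false 1 (.node 4 15 false 1
  (.node 5 29 false 1 (.node 6 15 false 1 (.node 7 94 false 1 (.node 8 230 false 1 (.node 9 357
  false 1 (.node 10 947 false 1 (.node 11 2040 false 1 (.leaf none) .nil) .nil) .nil) .nil) .nil)
  .nil) (.node 5 30 false 1 (.node 6 60 false 1 (.node 7 89 false 1 (.node 8 179 false 1 (.node 9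
  498 false 1 (.node 10 871 false 1 (.node 11 1993 false 1 (.leaf none) .nil) .nil) .nil) .nil)
  .nil) (.node 6 59 false 1 (.node 7 29 false 1 (.node 8 248 false 1 (.node 9 439 false 1 (.node
  10 495 false 1 (.node 11 1891 false 1 (.leaf (some [(3, 1)])) .nil) .nil) .nil) .nil) .nil)
  .nil)) .nil)) .nil) .nil) .nil) (.node 1 1 true 1 (.node 2 3 false 1 (.node 3 7 false 1 (.node 4
  15 false 1 (.node 5 15 false 1 (.node 6 39 false 1 (.node 7 83 false 1 (.node 8 236 false 1
  (.node 9 380 false 1 (.node 10 980 false 1 (.node 11 2040 false 1 (.leaf none) .nil) .nil) .nil)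
  .nil) .nil) (.node 6 55 false 1 (.node 7 59 false 1 (.node 8 240 false 1 (.node 9 496 true 1
  (.node 10 940 false 1 (.node 11 1948 false 1 (.leaf none) .nil) .nil) .nil) .nil) .nil) (.node 6
  59 false 1 (.node 7 115 false 1 (.node 8 248 false 1 (.node 9 380 false 1 (.node 10 916 false 1
  (.node 11 1956 false 1 (.leaf none) .nil) .nil) .nil) .nil) .nil) .nil))) (.node 5 23 false 1
  (.node 6 15 false 1 (.node 7 91 false 1 (.node 8 227 false 1 (.node 9 504 false 1 (.node 10 996
  false 1 (.node 11 1660 false 1 (.leaf none) .nil) .nil) .nil) .nil) .nil) (.node 6 59 false 1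
  (.node 7 79 false 1 (.node 8 156 false 1 (.node 9 316 false 1 (.node 10 1016 false 1 (.node 11
  1956 false 1 (.leaf (some [(3, 1)])) .nil) .nil) .nil) (.node 8 216 false 1 (.node 9 472 true 1
  (.node 10 956 false 1 (.node 11 2016 false 1 (.leaf (some [(3, 1)])) .nil) .nil) .nil) .nil))
  .nil) .nil)) (.node 5 27 false 1 (.node 6 47 false 1 (.node 7 55 false 1 (.node 8 248 false 1
  (.node 9 348 false 1 (.node 10 964 false 1 (.node 11 1988 true 1 (.leaf (some [(3, 1), (5, 6)]))
  .nil) .nil) .nil) .nil) .nil) .nil) .nil))) .nil) (.node 3 7 true 1 (.node 4 15 false 1 (.node 5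
  15 false 1 (.node 6 19 false 1 (.node 7 83 true 1 (.node 8 227 false 1 (.node 9 252 false 1
  (.node 10 764 true 1 (.node 11 2016 false 1 (.leaf none) .nil) .nil) (.node 9 492 false 1 (.node
  10 1004 true 1 (.node 11 1756 false 1 (.leaf none) .nil) .nil) .nil)) .nil) .nil) (.node 6 44
  false 1 (.node 7 108 true 1 (.node 8 220 false 1 (.node 9 243 false 1 (.node 10 819 false 1
  (.node 11 2000 false 1 (.leaf none) .nil) .nil) .nil) .nil) .nil) (.node 6 60 false 1 (.node 7
  124 true 1 (.node 8 240 false 1 (.node 9 496 true 1 (.node 10 787 false 1 (.node 11 1827 false 1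
  (.leaf none) .nil) .nil) .nil) (.node 8 19 false 1 (.node 9 275 true 1 (.node 10 992 false 1
  (.node 11 2016 true 1 (.leaf (some [(4, 33)])) .nil) .nil) .nil) .nil)) (.node 7 51 false 1
  (.node 8 224 false 1 (.node 9 480 true 1 (.node 10 976 false 1 (.node 11 2000 true 1 (.leaf
  (some [(5, 7)])) .nil) .nil) .nil) .nil) .nil)) .nil))) .nil) .nil) .nil)) (.node 2 3 true 1
  (.node 3 7 false 1 (.node 4 15 false 1 (.node 5 15 false 1 (.node 6 55 false 1 (.node 7 112
  false 1 (.node 8 240 true 1 (.node 9 472 false 1 (.node 10 1000 false 1 (.node 11 1976 false 1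
  (.leaf none) .nil) .nil) .nil) .nil) (.node 7 96 false 1 (.node 8 224 true 1 (.node 9 480 true 1
  (.node 10 920 false 1 (.node 11 1944 true 1 (.leaf (some [(4, 67), (5, 7)])) .nil) (.node 10 984
  false 1 (.node 11 1960 false 1 (.leaf (some [(5, 1)])) .nil) .nil)) .nil) .nil) .nil)) .nil)
  (.node 5 23 false 1 (.node 6 47 false 1 (.node 7 24 false 1 (.node 8 152 true 1 (.node 9 456
  false 1 (.node 10 968 true 1 (.node 11 2032 false 1 (.leaf (some [(5, 3)])) .nil) .nil) .nil)
  .nil) .nil) .nil) .nil)) (.node 4 15 true 1 (.node 5 7 false 1 (.node 6 39 true 1 (.node 7 96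
  false 1 (.node 8 224 true 1 (.node 9 480 true 1 (.node 10 920 false 1 (.node 11 1944 true 1
  (.leaf (some [(3, 1), (4, 99), (5, 9223)])) .nil) .nil) .nil) .nil) .nil) .nil) .nil) .nil))
  .nil) .nil)) .nil)) .nil

def searchTree2 : SearchTree :=
  .node 0 0 false 255 (.node 1 1 false 238 (.node 2 3 false 238 (.node 3 7 false 238 (.node 4 15
  false 238 (.node 5 27 false 172 (.node 6 51 false 172 (.node 7 114 false 172 (.node 8 188 false
  172 (.node 9 469 false 172 (.node 10 965 false 172 (.node 11 1519 false 172 (.leaf none) .nil)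
  .nil) .nil) .nil) .nil) .nil) (.node 5 29 false 238 (.node 6 15 false 238 (.node 7 94 false 238
  (.node 8 230 false 238 (.node 9 357 false 238 (.node 10 947 false 238 (.node 11 2040 false 238
  (.leaf none) .nil) .nil) .nil) .nil) .nil) .nil) (.node 5 30 false 238 (.node 6 59 false 32
  (.node 7 29 false 32 (.node 8 248 false 32 (.node 9 439 false 32 (.node 10 495 false 32 (.node
  11 1891 false 32 (.leaf none) .nil) .nil) .nil) .nil) .nil) (.node 6 60 false 238 (.node 7 89
  false 238 (.node 8 179 false 238 (.node 9 498 false 238 (.node 10 871 false 238 (.node 11 1993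
  false 238 (.leaf none) .nil) .nil) .nil) .nil) .nil) .nil)) .nil))) .nil) .nil) .nil) (.node 1 1
  true 255 (.node 2 3 false 255 (.node 3 7 false 255 (.node 4 15 false 255 (.node 5 15 false 255
  (.node 6 27 false 255 (.node 7 103 false 255 (.node 8 180 false 255 (.node 9 436 true 255 (.node
  10 980 false 255 (.node 11 1912 false 255 (.leaf none) .nil) .nil) .nil) .nil) .nil) (.node 6 39
  false 254 (.node 7 83 false 254 (.node 8 220 false 158 (.node 9 440 false 158 (.node 10 952 true
  158 (.node 11 2020 false 158 (.leaf none) .nil) .nil) .nil) (.node 8 236 false 238 (.node 9 380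
  false 238 (.node 10 980 false 238 (.node 11 2040 false 238 (.leaf none) .nil) .nil) .nil) .nil))
  (.node 7 91 false 162 (.node 8 184 false 162 (.node 9 440 true 162 (.node 10 980 false 162
  (.node 11 1908 false 162 (.leaf none) .nil) .nil) .nil) .nil) .nil)) (.node 6 55 false 254
  (.node 7 59 false 254 (.node 8 240 false 254 (.node 9 496 true 254 (.node 10 940 false 254
  (.node 11 1948 false 254 (.leaf none) .nil) .nil) .nil) .nil) .nil) (.node 6 59 false 254 (.node
  7 115 false 254 (.node 8 248 false 254 (.node 9 380 false 254 (.node 10 916 false 254 (.node 11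
  1956 false 254 (.leaf none) .nil) .nil) .nil) .nil) .nil) .nil)))) (.node 5 23 false 255 (.node
  6 15 false 238 (.node 7 91 false 238 (.node 8 227 false 238 (.node 9 504 false 238 (.node 10 996
  false 238 (.node 11 1660 false 238 (.leaf none) .nil) .nil) .nil) .nil) .nil) (.node 6 39 false
  255 (.node 7 99 false 255 (.node 8 204 false 255 (.node 9 460 true 255 (.node 10 952 false 255
  (.node 11 1976 true 255 (.leaf none) .nil) .nil) .nil) .nil) .nil) (.node 6 59 false 254 (.node
  7 79 false 242 (.node 8 60 false 146 (.node 9 412 false 146 (.node 10 992 false 146 (.node 11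
  2016 true 146 (.leaf none) .nil) .nil) .nil) (.node 8 156 false 226 (.node 9 316 false 226
  (.node 10 1016 false 226 (.node 11 1956 false 226 (.leaf none) .nil) .nil) .nil) (.node 8 216
  false 226 (.node 9 472 true 226 (.node 10 956 false 226 (.node 11 2016 false 226 (.leaf none)
  .nil) .nil) .nil) .nil))) (.node 7 111 false 238 (.node 8 204 false 238 (.node 9 348 false 238
  (.node 10 948 false 238 (.node 11 2032 false 238 (.leaf none) .nil) .nil) .nil) .nil) .nil))
  .nil))) (.node 5 27 false 158 (.node 6 15 false 158 (.node 7 103 false 158 (.node 8 180 false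
  158 (.node 9 436 true 158 (.node 10 980 false 158 (.node 11 1912 false 158 (.leaf none) .nil)
  .nil) .nil) .nil) .nil) .nil) .nil))) .nil) .nil) .nil) .nil)) .nil

def searchTree3 : SearchTree :=
  .node 0 0 false 255 (.node 1 1 true 255 (.node 2 3 false 255 (.node 3 7 false 255 (.node 4 15
  false 255 (.node 5 27 false 254 (.node 6 47 false 254 (.node 7 55 false 254 (.node 8 248 false
  254 (.node 9 348 false 226 (.node 10 964 false 226 (.node 11 1988 true 226 (.leaf none) .nil)
  .nil) (.node 9 484 false 252 (.node 10 996 true 252 (.node 11 2012 false 252 (.leaf none) .nil)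
  .nil) .nil)) .nil) .nil) .nil) (.node 5 15 false 1 (.node 6 39 false 1 (.node 7 91 false 1
  (.node 8 184 false 1 (.node 9 440 true 1 (.node 10 980 false 1 (.node 11 1908 false 1 (.leaf
  (some [(3, 1), (4, 1)])) .nil) .nil) .nil) .nil) .nil) .nil) (.node 5 23 false 33 (.node 6 59
  false 33 (.node 7 79 false 33 (.node 8 60 false 33 (.node 9 412 false 33 (.node 10 992 false 33
  (.node 11 2016 true 1 (.leaf (some [(3, 1), (4, 1)])) (.node 11 2016 true 32 (.leaf (some [(3,
  1), (4, 33)])) .nil)) .nil) .nil) .nil) .nil) .nil) .nil))) .nil) (.node 3 7 true 255 (.node 4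
  15 false 255 (.node 5 15 false 255 (.node 6 19 false 255 (.node 7 83 true 255 (.node 8 220 false
  130 (.node 9 316 false 130 (.node 10 992 false 130 (.node 11 2016 true 130 (.leaf none) .nil)
  .nil) .nil) (.node 8 224 false 143 (.node 9 480 true 143 (.node 10 992 true 143 (.node 11 1852
  false 143 (.leaf none) .nil) .nil) .nil) (.node 8 227 false 255 (.node 9 252 false 255 (.node 10
  764 true 255 (.node 11 2016 false 255 (.leaf none) .nil) .nil) (.node 9 492 false 255 (.node 10
  1004 true 255 (.node 11 1756 false 255 (.leaf none) .nil) .nil) .nil)) .nil))) .nil) (.node 6 28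
  false 139 (.node 7 92 true 139 (.node 8 224 false 139 (.node 9 480 true 139 (.node 10 992 true
  139 (.node 11 1843 false 139 (.leaf none) .nil) .nil) .nil) .nil) .nil) (.node 6 44 false 255
  (.node 7 108 true 255 (.node 8 220 false 255 (.node 9 243 false 255 (.node 10 819 false 255
  (.node 11 2000 false 255 (.leaf none) .nil) .nil) .nil) .nil) .nil) (.node 6 60 false 255 (.node
  7 108 false 255 (.node 8 227 false 255 (.node 9 403 false 255 (.node 10 976 false 255 (.node 11
  2000 true 255 (.leaf none) .nil) .nil) .nil) (.node 8 240 false 255 (.node 9 496 true 255 (.node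
  10 931 false 255 (.node 11 1939 false 255 (.leaf none) .nil) .nil) .nil) .nil)) (.node 7 124
  false 191 (.node 8 224 false 191 (.node 9 480 true 191 (.node 10 931 false 191 (.node 11 1875
  false 191 (.leaf none) .nil) .nil) .nil) .nil) (.node 7 124 true 255 (.node 8 19 false 142
  (.node 9 275 true 142 (.node 10 992 false 142 (.node 11 2016 true 142 (.leaf none) .nil) .nil)
  .nil) (.node 8 240 false 255 (.node 9 496 true 255 (.node 10 787 false 255 (.node 11 1827 false
  255 (.leaf none) .nil) .nil) .nil) .nil)) .nil))) .nil)))) .nil) .nil) .nil)) (.node 2 3 true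
  255 (.node 3 7 false 255 (.node 4 15 false 255 (.node 5 15 false 255 (.node 6 23 false 255
  (.node 7 56 false 255 (.node 8 184 true 255 (.node 9 472 false 255 (.node 10 992 false 255
  (.node 11 2016 true 255 (.leaf none) .nil) .nil) .nil) .nil) .nil) (.node 6 55 false 255 (.node
  7 96 false 252 (.node 8 224 true 252 (.node 9 480 true 252 (.node 10 920 false 128 (.node 11
  1944 true 128 (.leaf none) .nil) (.node 10 984 false 252 (.node 11 1960 false 252 (.leaf none)
  .nil) .nil)) .nil) .nil) (.node 7 112 false 255 (.node 8 240 true 255 (.node 9 472 false 255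
  (.node 10 1000 false 255 (.node 11 1976 false 255 (.leaf none) .nil) .nil) .nil) .nil) .nil))
  .nil)) (.node 5 23 false 255 (.node 6 15 false 128 (.node 7 96 false 128 (.node 8 224 true 128
  (.node 9 480 true 128 (.node 10 952 false 128 (.node 11 2008 false 128 (.leaf none) .nil) .nil)
  .nil) .nil) .nil) (.node 6 47 false 255 (.node 7 24 false 128 (.node 8 152 true 128 (.node 9 456
  false 128 (.node 10 968 true 128 (.node 11 2032 false 128 (.leaf none) .nil) .nil) .nil) .nil)
  (.node 7 112 false 255 (.node 8 240 true 255 (.node 9 456 false 255 (.node 10 968 true 255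
  (.node 11 1944 false 255 (.leaf none) .nil) .nil) .nil) .nil) .nil)) .nil)) .nil)) (.node 4 15
  true 156 (.node 5 7 false 156 (.node 6 39 true 156 (.node 7 96 false 156 (.node 8 224 true 156
  (.node 9 480 true 156 (.node 10 920 false 156 (.node 11 1944 true 156 (.leaf none) .nil) .nil)
  .nil) .nil) .nil) .nil) .nil) .nil)) .nil) .nil)) .nil) .nil

def searchTree4 : SearchTree :=
  .node 0 0 false 81 (.node 1 1 true 81 (.node 2 3 false 81 (.node 3 7 false 81 (.node 4 15 false
  81 (.node 5 23 false 65 (.node 6 59 false 65 (.node 7 79 false 65 (.node 8 60 false 64 (.node 9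
  412 false 64 (.node 10 992 false 64 (.node 11 2016 true 64 (.leaf (some [(3, 1), (4, 45)]))
  .nil) .nil) .nil) (.node 8 156 false 1 (.node 9 316 false 1 (.node 10 1016 false 1 (.node 11
  1956 false 1 (.leaf (some [(3, 1), (4, 1)])) .nil) .nil) .nil) (.node 8 216 false 1 (.node 9 472
  true 1 (.node 10 956 false 1 (.node 11 2016 false 1 (.leaf (some [(3, 1), (4, 1)])) .nil) .nil)
  .nil) .nil))) .nil) .nil) (.node 5 27 false 17 (.node 6 47 false 17 (.node 7 55 false 17 (.node
  8 248 false 17 (.node 9 348 false 17 (.node 10 964 false 17 (.node 11 1988 true 1 (.leaf (some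
  [(3, 1), (4, 1), (5, 6)])) (.node 11 1988 true 16 (.leaf (some [(5, 6)])) .nil)) .nil) .nil)
  .nil) .nil) .nil) .nil)) .nil) (.node 3 7 true 65 (.node 4 15 false 65 (.node 5 15 false 65
  (.node 6 19 false 64 (.node 7 83 true 64 (.node 8 220 false 64 (.node 9 316 false 64 (.node 10
  992 false 64 (.node 11 2016 true 64 (.leaf (some [(3, 1), (4, 109), (5, 1056)])) .nil) .nil)
  .nil) .nil) .nil) (.node 6 60 false 1 (.node 7 51 false 1 (.node 8 224 false 1 (.node 9 480 true
  1 (.node 10 976 false 1 (.node 11 2000 true 1 (.leaf (some [(5, 7)])) .nil) .nil) .nil) .nil)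
  .nil) .nil)) .nil) .nil) .nil)) .nil) .nil) .nil

def searchTree5 : SearchTree :=
  .node 0 0 false 14 (.node 1 1 true 14 (.node 2 3 false 14 (.node 3 7 true 14 (.node 4 15 false
  14 (.node 5 15 false 14 (.node 6 60 false 14 (.node 7 51 false 14 (.node 8 224 false 14 (.node 9
  480 true 14 (.node 10 976 false 14 (.node 11 2000 true 2 (.leaf (some [(5, 7)])) (.node 11 2000
  true 4 (.leaf (some [(5, 6)])) (.node 11 2000 true 8 (.leaf (some [(5, 6)])) .nil))) .nil) .nil)
  .nil) .nil) .nil) .nil) .nil) .nil) .nil) .nil) .nil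

def searchTree6 : SearchTree :=
  .node 0 0 false 144 (.node 1 1 true 144 (.node 2 3 false 144 (.node 3 7 true 144 (.node 4 15
  false 144 (.node 5 15 false 144 (.node 6 60 false 144 (.node 7 51 false 144 (.node 8 224 false
  144 (.node 9 480 true 144 (.node 10 976 false 144 (.node 11 2000 true 16 (.leaf (some [(5, 6)]))
  (.node 11 2000 true 128 (.leaf (some [(4, 128), (5, 4)])) .nil)) .nil) .nil) .nil) .nil) .nil)
  .nil) .nil) .nil) .nil) .nil) .nil

def searchTree7 : SearchTree :=
  .node 0 0 false 99 (.node 1 1 true 99 (.node 2 3 false 96 (.node 3 7 true 96 (.node 4 15 false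
  96 (.node 5 15 false 96 (.node 6 60 false 96 (.node 7 124 false 64 (.node 8 224 false 64 (.node
  9 480 true 64 (.node 10 931 false 64 (.node 11 1875 false 64 (.leaf (some [(5, 1024)])) .nil)
  .nil) .nil) .nil) (.node 7 124 true 96 (.node 8 19 false 96 (.node 9 275 true 96 (.node 10 992
  false 96 (.node 11 2016 true 64 (.leaf (some [(3, 1), (4, 33)])) (.node 11 2016 true 32 (.leaf
  (some [(4, 33)])) .nil)) .nil) .nil) .nil) .nil)) .nil) .nil) .nil) .nil) (.node 2 3 true 3
  (.node 3 7 false 3 (.node 4 15 false 3 (.node 5 15 false 3 (.node 6 55 false 3 (.node 7 96 false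
  3 (.node 8 224 true 3 (.node 9 480 true 3 (.node 10 920 false 3 (.node 11 1944 true 1 (.leaf
  (some [(4, 99), (5, 7)])) (.node 11 1944 true 2 (.leaf (some [(5, 7)])) .nil)) .nil) .nil) .nil)
  .nil) .nil) .nil) .nil) .nil) .nil)) .nil) .nil

def searchTree8 : SearchTree :=
  .node 0 0 false 19 (.node 1 1 true 19 (.node 2 3 true 19 (.node 3 7 false 19 (.node 4 15 false
  19 (.node 5 15 false 2 (.node 6 55 false 2 (.node 7 96 false 2 (.node 8 224 true 2 (.node 9 480
  true 2 (.node 10 984 false 2 (.node 11 1960 false 2 (.leaf (some [(5, 1)])) .nil) .nil) .nil)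
  .nil) .nil) .nil) (.node 5 23 false 19 (.node 6 15 false 2 (.node 7 96 false 2 (.node 8 224 true
  2 (.node 9 480 true 2 (.node 10 952 false 2 (.node 11 2008 false 2 (.leaf (some [(3, 1), (4, 3),
  (5, 7)])) .nil) .nil) .nil) .nil) .nil) (.node 6 47 false 19 (.node 7 24 false 19 (.node 8 152
  true 19 (.node 9 456 false 19 (.node 10 968 true 19 (.node 11 2032 false 1 (.leaf (some [(5,
  3)])) (.node 11 2032 false 2 (.leaf (some [(5, 3)])) (.node 11 2032 false 16 (.leaf (some [(5,
  2)])) .nil))) .nil) .nil) .nil) .nil) .nil)) .nil)) (.node 4 15 true 2 (.node 5 7 false 2 (.node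
  6 39 true 2 (.node 7 96 false 2 (.node 8 224 true 2 (.node 9 480 true 2 (.node 10 920 false 2
  (.node 11 1944 true 2 (.leaf (some [(5, 7)])) .nil) .nil) .nil) .nil) .nil) .nil) .nil) .nil))
  .nil) .nil) .nil) .nil

def searchTree9 : SearchTree :=
  .node 0 0 false 131038 (.node 1 1 true 131038 (.node 2 3 false 131038 (.node 3 7 false 46364
  (.node 4 15 false 46364 (.node 5 15 false 45068 (.node 6 39 false 12292 (.node 7 83 false 4100
  (.node 8 220 false 4096 (.node 9 440 false 4096 (.node 10 952 true 4096 (.node 11 2020 false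
  4096 (.leaf none) .nil) .nil) .nil) (.node 8 236 false 4 (.node 9 380 false 4 (.node 10 980
  false 4 (.node 11 2040 false 4 (.leaf none) .nil) .nil) .nil) .nil)) (.node 7 91 false 8192
  (.node 8 184 false 8192 (.node 9 440 true 8192 (.node 10 980 false 8192 (.node 11 1908 false
  8192 (.leaf none) .nil) .nil) .nil) .nil) .nil)) (.node 6 55 false 36864 (.node 7 59 false 36864
  (.node 8 240 false 36864 (.node 9 496 true 36864 (.node 10 940 false 36864 (.node 11 1948 false
  36864 (.leaf none) .nil) .nil) .nil) .nil) .nil) (.node 6 59 false 12 (.node 7 115 false 12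
  (.node 8 248 false 12 (.node 9 380 false 12 (.node 10 916 false 12 (.node 11 1956 false 12
  (.leaf none) .nil) .nil) .nil) .nil) .nil) .nil))) (.node 5 23 false 46356 (.node 6 15 false 4
  (.node 7 91 false 4 (.node 8 227 false 4 (.node 9 504 false 4 (.node 10 996 false 4 (.node 11
  1660 false 4 (.leaf none) .nil) .nil) .nil) .nil) .nil) (.node 6 39 false 256 (.node 7 99 false
  256 (.node 8 204 false 256 (.node 9 460 true 256 (.node 10 952 false 256 (.node 11 1976 true 256
  (.leaf none) .nil) .nil) .nil) .nil) .nil) (.node 6 59 false 46100 (.node 7 79 false 46100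
  (.node 8 60 false 46084 (.node 9 412 false 46084 (.node 10 992 false 46084 (.node 11 2016 true
  46084 (.leaf none) .nil) .nil) .nil) (.node 8 156 false 8212 (.node 9 316 false 8212 (.node 10
  1016 false 8212 (.node 11 1956 false 8212 (.leaf none) .nil) .nil) .nil) (.node 8 216 false 8212
  (.node 9 472 true 8212 (.node 10 956 false 8212 (.node 11 2016 false 8212 (.leaf none) .nil)
  .nil) .nil) .nil))) .nil) .nil))) (.node 5 27 false 45056 (.node 6 15 false 36864 (.node 7 103
  false 36864 (.node 8 180 false 36864 (.node 9 436 true 36864 (.node 10 980 false 36864 (.node 11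
  1912 false 36864 (.leaf none) .nil) .nil) .nil) .nil) .nil) (.node 6 47 false 45056 (.node 7 55
  false 45056 (.node 8 248 false 45056 (.node 9 348 false 45056 (.node 10 964 false 45056 (.node
  11 1988 true 45056 (.leaf none) .nil) .nil) .nil) .nil) .nil) .nil)) .nil))) .nil) (.node 3 7
  true 131014 (.node 4 15 false 131014 (.node 5 15 false 131014 (.node 6 19 false 45062 (.node 7
  83 true 45062 (.node 8 220 false 45062 (.node 9 316 false 45062 (.node 10 992 false 45062 (.node
  11 2016 true 45062 (.leaf none) .nil) .nil) .nil) .nil) .nil) (.node 6 44 false 1156 (.node 7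
  108 true 1156 (.node 8 220 false 1156 (.node 9 243 false 1156 (.node 10 819 false 1156 (.node 11
  2000 false 1156 (.leaf none) .nil) .nil) .nil) .nil) .nil) (.node 6 60 false 93124 (.node 7 51
  false 92928 (.node 8 224 false 92928 (.node 9 480 true 92928 (.node 10 976 false 92928 (.node 11
  2000 true 92928 (.leaf none) .nil) .nil) .nil) .nil) (.node 7 108 false 27588 (.node 8 227 false
  27588 (.node 9 403 false 27588 (.node 10 976 false 27588 (.node 11 2000 true 27588 (.leaf none)
  .nil) .nil) .nil) (.node 8 240 false 768 (.node 9 496 true 768 (.node 10 931 false 768 (.node 11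
  1939 false 768 (.leaf none) .nil) .nil) .nil) .nil)) .nil)) .nil))) .nil) .nil) .nil)) .nil)
  .nil) .nil

def searchTree10 : SearchTree :=
  .node 0 0 false 131070 (.node 1 1 true 131070 (.node 2 3 false 130038 (.node 3 7 true 130022
  (.node 4 15 false 130022 (.node 5 15 false 130022 (.node 6 60 false 130022 (.node 7 124 false
  27620 (.node 8 224 false 27620 (.node 9 480 true 27620 (.node 10 931 false 27620 (.node 11 1875
  false 27620 (.leaf none) .nil) .nil) .nil) .nil) (.node 7 124 true 130022 (.node 8 19 false
  36870 (.node 9 275 true 36870 (.node 10 992 false 36870 (.node 11 2016 true 36870 (.leaf none)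
  .nil) .nil) .nil) (.node 8 240 false 130020 (.node 9 496 true 130020 (.node 10 787 false 130020
  (.node 11 1827 false 130020 (.leaf none) .nil) .nil) .nil) .nil)) .nil)) .nil) .nil) .nil)
  (.node 3 7 false 22 (.node 4 15 false 22 (.node 5 15 false 16 (.node 6 59 false 16 (.node 7 115
  false 16 (.node 8 248 false 16 (.node 9 380 false 16 (.node 10 916 false 16 (.node 11 1956 false
  16 (.leaf (some [(5, 16)])) .nil) .nil) .nil) .nil) .nil) .nil) (.node 5 27 false 6 (.node 6 15
  false 4 (.node 7 103 false 4 (.node 8 180 false 4 (.node 9 436 true 4 (.node 10 980 false 4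
  (.node 11 1912 false 4 (.leaf (some [(5, 4)])) .nil) .nil) .nil) .nil) .nil) (.node 6 47 false 2
  (.node 7 55 false 2 (.node 8 248 false 2 (.node 9 348 false 2 (.node 10 964 false 2 (.node 11
  1988 true 2 (.leaf (some [(5, 2)])) .nil) .nil) .nil) .nil) .nil) .nil)) .nil)) .nil) .nil))
  (.node 2 3 true 131064 (.node 3 7 false 131064 (.node 4 15 false 131064 (.node 5 15 false 131064
  (.node 6 55 false 131064 (.node 7 96 false 131064 (.node 8 224 true 131064 (.node 9 480 true
  131064 (.node 10 920 false 36864 (.node 11 1944 true 36864 (.leaf none) .nil) (.node 10 984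
  false 131064 (.node 11 1960 false 131064 (.leaf none) .nil) .nil)) .nil) .nil) (.node 7 112
  false 36864 (.node 8 240 true 36864 (.node 9 472 false 36864 (.node 10 1000 false 36864 (.node
  11 1976 false 36864 (.leaf none) .nil) .nil) .nil) .nil) .nil)) .nil) (.node 5 23 false 131064
  (.node 6 47 false 131064 (.node 7 24 false 131056 (.node 8 152 true 131056 (.node 9 456 false
  131056 (.node 10 968 true 131056 (.node 11 2032 false 131056 (.leaf none) .nil) .nil) .nil)
  .nil) (.node 7 112 false 122872 (.node 8 240 true 122872 (.node 9 456 false 122872 (.node 10 968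
  true 122872 (.node 11 1944 false 122872 (.leaf none) .nil) .nil) .nil) .nil) .nil)) .nil) .nil))
  (.node 4 15 true 54120 (.node 5 7 false 54120 (.node 6 39 true 54120 (.node 7 96 false 54120
  (.node 8 224 true 54120 (.node 9 480 true 54120 (.node 10 920 false 54120 (.node 11 1944 true
  54120 (.leaf none) .nil) .nil) .nil) .nil) .nil) .nil) .nil) .nil)) .nil) .nil)) .nil) .nil

def searchTree11 : SearchTree :=
  .node 0 0 false 15 (.node 1 1 true 15 (.node 2 3 false 15 (.node 3 7 false 12 (.node 4 15 false
  12 (.node 5 27 false 12 (.node 6 47 false 12 (.node 7 55 false 12 (.node 8 248 false 12 (.node 9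
  348 false 12 (.node 10 964 false 12 (.node 11 1988 true 4 (.leaf (some [(5, 6)])) (.node 11 1988
  true 8 (.leaf (some [(5, 6)])) .nil)) .nil) (.node 9 484 false 4 (.node 10 996 true 4 (.node 11
  2012 false 4 (.leaf (some [(5, 4)])) .nil) .nil) .nil)) .nil) .nil) .nil) .nil) .nil) (.node 3 7
  true 3 (.node 4 15 false 3 (.node 5 15 false 3 (.node 6 19 false 2 (.node 7 83 true 2 (.node 8
  224 false 2 (.node 9 480 true 2 (.node 10 992 true 2 (.node 11 1852 false 2 (.leaf (some [(5,
  2)])) .nil) .nil) .nil) .nil) .nil) (.node 6 28 false 2 (.node 7 92 true 2 (.node 8 224 false 2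
  (.node 9 480 true 2 (.node 10 992 true 2 (.node 11 1843 false 2 (.leaf (some [(5, 2)])) .nil)
  .nil) .nil) .nil) .nil) (.node 6 60 false 1 (.node 7 51 false 1 (.node 8 224 false 1 (.node 9
  480 true 1 (.node 10 976 false 1 (.node 11 2000 true 1 (.leaf (some [(5, 7)])) .nil) .nil) .nil)
  .nil) .nil) .nil))) .nil) .nil) .nil)) .nil) .nil) .nil

def searchTree12 : SearchTree :=
  .node 0 0 false 2 (.node 1 1 true 2 (.node 2 3 false 2 (.node 3 7 true 2 (.node 4 15 false 2
  (.node 5 15 false 2 (.node 6 60 false 2 (.node 7 51 false 2 (.node 8 224 false 2 (.node 9 480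
  true 2 (.node 10 976 false 2 (.node 11 2000 true 2 (.leaf (some [(5, 6)])) .nil) .nil) .nil)
  .nil) .nil) .nil) .nil) .nil) .nil) .nil) .nil) .nil

def searchTree13 : SearchTree :=
  .node 0 0 false 4121 (.node 1 1 true 4121 (.node 2 3 false 4120 (.node 3 7 true 4120 (.node 4 15
  false 4120 (.node 5 15 false 4120 (.node 6 60 false 4120 (.node 7 51 false 4104 (.node 8 224
  false 4104 (.node 9 480 true 4104 (.node 10 976 false 4104 (.node 11 2000 true 8 (.leaf (some
  [(5, 6)])) (.node 11 2000 true 4096 (.leaf (some [(5, 4)])) .nil)) .nil) .nil) .nil) (.node 7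
  124 true 16 (.node 8 240 false 16 (.node 9 496 true 16 (.node 10 787 false 16 (.node 11 1827
  false 16 (.leaf (some [(5, 1040)])) .nil) .nil) .nil) .nil) .nil)) .nil) .nil) .nil) .nil)
  (.node 2 3 true 1 (.node 3 7 false 1 (.node 4 15 false 1 (.node 5 15 false 1 (.node 6 55 false 1
  (.node 7 96 false 1 (.node 8 224 true 1 (.node 9 480 true 1 (.node 10 920 false 1 (.node 11 1944
  true 1 (.leaf (some [(5, 1)])) .nil) .nil) .nil) .nil) .nil) .nil) .nil) .nil) .nil) .nil))
  .nil) .nil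

def searchTree14 : SearchTree :=
  .node 0 0 false 3 (.node 1 1 true 3 (.node 2 3 true 3 (.node 3 7 false 3 (.node 4 15 false 3
  (.node 5 15 false 1 (.node 6 55 false 1 (.node 7 96 false 1 (.node 8 224 true 1 (.node 9 480
  true 1 (.node 10 984 false 1 (.node 11 1960 false 1 (.leaf (some [(5, 1)])) .nil) .nil) .nil)
  .nil) .nil) .nil) (.node 5 23 false 3 (.node 6 47 false 3 (.node 7 24 false 3 (.node 8 152 true
  3 (.node 9 456 false 3 (.node 10 968 true 3 (.node 11 2032 false 1 (.leaf (some [(5, 1)]))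
  (.node 11 2032 false 2 (.leaf (some [(5, 11)])) .nil)) .nil) .nil) .nil) .nil) .nil) .nil))
  .nil) .nil) .nil) .nil) .nil

def searchTree15 : SearchTree :=
  .node 0 0 false 1023 (.node 1 1 true 1023 (.node 2 3 false 799 (.node 3 7 false 31 (.node 4 15
  false 31 (.node 5 15 false 4 (.node 6 55 false 4 (.node 7 59 false 4 (.node 8 240 false 4 (.node
  9 496 true 4 (.node 10 940 false 4 (.node 11 1948 false 4 (.leaf none) .nil) .nil) .nil) .nil)
  .nil) .nil) (.node 5 23 false 27 (.node 6 39 false 1 (.node 7 99 false 1 (.node 8 204 false 1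
  (.node 9 460 true 1 (.node 10 952 false 1 (.node 11 1976 true 1 (.leaf none) .nil) .nil) .nil)
  .nil) .nil) (.node 6 59 false 27 (.node 7 79 false 27 (.node 8 60 false 27 (.node 9 412 false 27
  (.node 10 992 false 27 (.node 11 2016 true 27 (.leaf none) .nil) .nil) .nil) (.node 8 156 false
  16 (.node 9 316 false 16 (.node 10 1016 false 16 (.node 11 1956 false 16 (.leaf none) .nil)
  .nil) .nil) (.node 8 216 false 24 (.node 9 472 true 24 (.node 10 956 false 24 (.node 11 2016
  false 24 (.leaf none) .nil) .nil) .nil) .nil))) .nil) .nil)) (.node 5 27 false 30 (.node 6 47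
  false 30 (.node 7 55 false 30 (.node 8 248 false 30 (.node 9 348 false 30 (.node 10 964 false 30
  (.node 11 1988 true 30 (.leaf none) .nil) .nil) .nil) .nil) .nil) .nil) .nil))) .nil) (.node 3 7
  true 775 (.node 4 15 false 775 (.node 5 15 false 775 (.node 6 60 false 775 (.node 7 51 false 773
  (.node 8 224 false 773 (.node 9 480 true 773 (.node 10 976 false 773 (.node 11 2000 true 768
  (.leaf none) (.node 11 2000 true 1 (.leaf (some [(5, 6)])) (.node 11 2000 true 4 (.leaf (some
  [(5, 4)])) .nil))) .nil) .nil) .nil) (.node 7 108 false 1 (.node 8 240 false 1 (.node 9 496 true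
  1 (.node 10 931 false 1 (.node 11 1939 false 1 (.leaf none) .nil) .nil) .nil) .nil) (.node 7 124
  true 7 (.node 8 240 false 7 (.node 9 496 true 7 (.node 10 787 false 7 (.node 11 1827 false 7
  (.leaf none) .nil) .nil) .nil) .nil) .nil))) (.node 6 19 false 2 (.node 7 83 true 2 (.node 8 224
  false 2 (.node 9 480 true 2 (.node 10 992 true 2 (.node 11 1852 false 2 (.leaf (some [(5, 6)]))
  .nil) .nil) .nil) .nil) .nil) (.node 6 28 false 2 (.node 7 92 true 2 (.node 8 224 false 2 (.node
  9 480 true 2 (.node 10 992 true 2 (.node 11 1843 false 2 (.leaf (some [(5, 6)])) .nil) .nil)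
  .nil) .nil) .nil) .nil))) .nil) .nil) .nil)) (.node 2 3 true 1023 (.node 3 7 false 1023 (.node 4
  15 false 1023 (.node 5 15 false 1023 (.node 6 55 false 1023 (.node 7 96 false 1023 (.node 8 224
  true 1023 (.node 9 480 true 1023 (.node 10 920 false 996 (.node 11 1944 true 996 (.leaf none)
  .nil) (.node 10 984 false 1023 (.node 11 1960 false 1023 (.leaf none) .nil) .nil)) .nil) .nil)
  (.node 7 112 false 7 (.node 8 240 true 7 (.node 9 472 false 7 (.node 10 1000 false 7 (.node 11
  1976 false 7 (.leaf none) .nil) .nil) .nil) .nil) .nil)) .nil) (.node 5 23 false 1021 (.node 6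
  47 false 1021 (.node 7 24 false 1021 (.node 8 152 true 1021 (.node 9 456 false 1021 (.node 10
  968 true 1021 (.node 11 2032 false 1020 (.leaf none) (.node 11 2032 false 1 (.leaf (some [(5,
  2)])) .nil)) .nil) .nil) .nil) (.node 7 112 false 5 (.node 8 240 true 5 (.node 9 456 false 5
  (.node 10 968 true 5 (.node 11 1944 false 5 (.leaf none) .nil) .nil) .nil) .nil) .nil)) .nil)
  .nil)) .nil) .nil) .nil)) .nil) .nil

def searchTree16 : SearchTree :=
  .node 0 0 false 31 (.node 1 1 true 31 (.node 2 3 false 27 (.node 3 7 false 16 (.node 4 15 false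
  16 (.node 5 15 false 16 (.node 6 39 false 16 (.node 7 91 false 16 (.node 8 184 false 16 (.node 9
  440 true 16 (.node 10 980 false 16 (.node 11 1908 false 16 (.leaf none) .nil) .nil) .nil) .nil)
  .nil) .nil) (.node 5 23 false 16 (.node 6 59 false 16 (.node 7 79 false 16 (.node 8 60 false 16
  (.node 9 412 false 16 (.node 10 992 false 16 (.node 11 2016 true 16 (.leaf none) .nil) .nil)
  .nil) .nil) .nil) .nil) (.node 5 27 false 16 (.node 6 47 false 16 (.node 7 55 false 16 (.node 8
  248 false 16 (.node 9 348 false 16 (.node 10 964 false 16 (.node 11 1988 true 16 (.leaf none)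
  .nil) .nil) .nil) .nil) .nil) .nil) .nil))) .nil) (.node 3 7 true 27 (.node 4 15 false 27 (.node
  5 15 false 27 (.node 6 19 false 26 (.node 7 83 true 26 (.node 8 220 false 26 (.node 9 316 false
  26 (.node 10 992 false 26 (.node 11 2016 true 26 (.leaf none) .nil) .nil) .nil) .nil) .nil)
  (.node 6 60 false 27 (.node 7 51 false 27 (.node 8 224 false 27 (.node 9 480 true 27 (.node 10
  976 false 27 (.node 11 2000 true 27 (.leaf none) .nil) .nil) .nil) .nil) (.node 7 124 true 8
  (.node 8 19 false 8 (.node 9 275 true 8 (.node 10 992 false 8 (.node 11 2016 true 8 (.leaf none)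
  .nil) .nil) .nil) .nil) .nil)) .nil)) .nil) .nil) .nil)) (.node 2 3 true 31 (.node 3 7 false 31
  (.node 4 15 false 31 (.node 5 15 false 31 (.node 6 55 false 31 (.node 7 96 false 31 (.node 8 224
  true 31 (.node 9 480 true 31 (.node 10 920 false 31 (.node 11 1944 true 31 (.leaf none) .nil)
  (.node 10 984 false 31 (.node 11 1960 false 31 (.leaf none) .nil) .nil)) .nil) .nil) (.node 7
  112 false 4 (.node 8 240 true 4 (.node 9 472 false 4 (.node 10 1000 false 4 (.node 11 1976 false
  4 (.leaf none) .nil) .nil) .nil) .nil) .nil)) .nil) (.node 5 23 false 31 (.node 6 15 false 30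
  (.node 7 96 false 30 (.node 8 224 true 30 (.node 9 480 true 30 (.node 10 952 false 30 (.node 11
  2008 false 30 (.leaf none) .nil) .nil) .nil) .nil) .nil) (.node 6 47 false 31 (.node 7 24 false
  31 (.node 8 152 true 31 (.node 9 456 false 31 (.node 10 968 true 31 (.node 11 2032 false 31
  (.leaf none) .nil) .nil) .nil) .nil) (.node 7 112 false 4 (.node 8 240 true 4 (.node 9 456 false
  4 (.node 10 968 true 4 (.node 11 1944 false 4 (.leaf none) .nil) .nil) .nil) .nil) .nil)) .nil))
  .nil)) (.node 4 15 true 15 (.node 5 7 false 15 (.node 6 39 true 15 (.node 7 96 false 15 (.node 8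
  224 true 15 (.node 9 480 true 15 (.node 10 920 false 15 (.node 11 1944 true 15 (.leaf none)
  .nil) .nil) .nil) .nil) .nil) .nil) .nil) .nil)) .nil) .nil)) .nil) .nil

/-- The trees to be searched, with the groups of the second combinations. -/
def searchTrees : List (ℕ × SearchTree) := [
  (3, searchTree1), (4, searchTree2), (4, searchTree3), (4, searchTree4), (4, searchTree5), (4,
  searchTree6), (4, searchTree7), (4, searchTree8), (5, searchTree9), (5, searchTree10), (5,
  searchTree11), (5, searchTree12), (5, searchTree13), (5, searchTree14), (6, searchTree15), (7,
  searchTree16)]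

def deadReps : List (List Code) := [
  [(0, 1), (0, 1), (0, 1), (2, 3), (4, 5), (5, 6), (3, 5), (3, 4), (1, 2), (1, 3), (1, 3), (1,
  3)], [(0, 1), (0, 1), (3, 4), (3, 4), (3, 5), (5, 6), (1, 2), (4, 5), (2, 3), (2, 3), (1, 3),
  (1, 3)], [(0, 1), (0, 1), (0, 1), (2, 3), (4, 5), (5, 6), (3, 5), (3, 4), (1, 2), (1, 2), (1,
  3), (1, 3)], [(0, 1), (0, 1), (0, 1), (2, 3), (4, 5), (5, 6), (3, 5), (3, 4), (1, 4), (1, 2),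
  (1, 3), (1, 3)], [(0, 1), (0, 1), (2, 3), (5, 6), (5, 6), (3, 4), (4, 5), (3, 5), (3, 5), (1,
  2), (1, 3), (1, 3)], [(1, 2), (1, 2), (1, 3), (1, 3), (4, 5), (5, 6), (2, 3), (3, 5), (3, 4),
  (3, 4), (0, 1), (0, 1)], [(0, 1), (0, 1), (0, 1), (2, 3), (4, 5), (5, 6), (3, 5), (3, 4), (1,
  2), (1, 2), (1, 2), (1, 3)], [(0, 1), (0, 1), (0, 1), (2, 3), (4, 5), (5, 6), (3, 5), (3, 4),
  (1, 4), (1, 2), (1, 2), (1, 3)], [(0, 1), (0, 1), (0, 1), (2, 3), (4, 5), (5, 6), (3, 5), (3,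
  4), (1, 4), (1, 4), (1, 2), (1, 3)], [(0, 1), (0, 1), (0, 1), (2, 3), (4, 5), (5, 6), (3, 5),
  (3, 4), (1, 5), (1, 4), (1, 2), (1, 3)], [(0, 1), (0, 1), (2, 3), (2, 3), (4, 5), (5, 6), (1,
  3), (1, 4), (3, 5), (3, 4), (3, 4), (1, 2)], [(0, 1), (0, 1), (2, 3), (2, 3), (4, 5), (5, 6),
  (1, 3), (1, 4), (3, 5), (3, 5), (3, 4), (1, 2)], [(1, 2), (1, 2), (1, 3), (1, 5), (4, 5), (3,
  5), (3, 4), (5, 6), (5, 6), (2, 3), (0, 1), (0, 1)], [(0, 1), (0, 1), (2, 3), (2, 5), (4, 5),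
  (3, 5), (3, 4), (5, 6), (5, 6), (1, 3), (1, 3), (1, 2)], [(0, 1), (0, 1), (2, 3), (5, 6), (5,
  6), (3, 4), (1, 4), (1, 3), (1, 2), (4, 5), (3, 5), (1, 5)], [(0, 1), (0, 1), (2, 3), (2, 4),
  (5, 6), (3, 4), (3, 5), (1, 4), (1, 3), (4, 5), (1, 2), (1, 2)], [(0, 1), (0, 1), (2, 3), (2,
  3), (4, 5), (5, 6), (1, 3), (1, 5), (1, 4), (3, 5), (3, 4), (1, 2)], [(0, 1), (0, 1), (2, 3),
  (2, 5), (4, 5), (3, 5), (3, 4), (5, 6), (5, 6), (1, 4), (1, 3), (1, 2)], [(1, 2), (1, 4), (1,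
  4), (3, 4), (3, 5), (5, 6), (2, 5), (1, 3), (2, 3), (4, 5), (0, 1), (0, 1)], [(0, 1), (0, 1),
  (2, 4), (3, 4), (3, 5), (5, 6), (2, 3), (1, 4), (1, 5), (1, 3), (1, 2), (4, 5)], [(0, 1), (0,
  1), (3, 4), (3, 4), (5, 6), (6, 7), (2, 3), (4, 6), (4, 5), (1, 2), (1, 3), (1, 3)], [(0, 1),
  (0, 1), (3, 4), (3, 4), (5, 6), (6, 7), (2, 3), (4, 6), (4, 5), (1, 2), (1, 4), (1, 3)], [(1,
  2), (1, 3), (1, 3), (1, 4), (5, 6), (6, 7), (2, 3), (4, 6), (4, 5), (0, 1), (3, 4), (3, 4)],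
  [(1, 3), (1, 3), (2, 3), (2, 4), (5, 6), (6, 7), (4, 6), (4, 5), (1, 2), (0, 1), (3, 4), (3,
  4)], [(1, 2), (1, 2), (1, 3), (4, 5), (4, 6), (6, 7), (5, 6), (1, 4), (3, 4), (2, 3), (0, 1),
  (0, 1)], [(0, 1), (0, 1), (3, 4), (3, 4), (5, 6), (6, 7), (2, 3), (4, 6), (4, 5), (1, 2), (1,
  2), (1, 3)], [(1, 2), (1, 3), (1, 3), (1, 4), (5, 6), (6, 7), (2, 3), (4, 6), (4, 5), (0, 1),
  (0, 1), (3, 4)], [(0, 1), (0, 1), (2, 3), (4, 6), (5, 6), (4, 5), (6, 7), (3, 5), (3, 4), (1,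
  2), (1, 3), (1, 3)], [(0, 1), (0, 1), (2, 3), (4, 5), (4, 6), (6, 7), (5, 6), (2, 4), (3, 4),
  (1, 3), (1, 4), (1, 2)], [(0, 1), (0, 1), (3, 4), (3, 4), (5, 6), (6, 7), (2, 3), (4, 6), (4,
  5), (1, 5), (1, 3), (1, 2)], [(1, 2), (1, 3), (1, 3), (1, 4), (5, 6), (6, 7), (2, 3), (4, 6),
  (4, 5), (3, 5), (3, 4), (0, 1)], [(1, 3), (1, 3), (2, 3), (2, 4), (5, 6), (6, 7), (4, 6), (4,
  5), (1, 2), (0, 1), (3, 5), (3, 4)], [(0, 1), (2, 5), (3, 4), (3, 4), (6, 7), (1, 4), (1, 2),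
  (5, 6), (2, 3), (1, 3), (4, 5), (4, 6)], [(0, 1), (0, 1), (3, 4), (3, 5), (6, 7), (4, 5), (4,
  6), (2, 3), (5, 6), (1, 2), (1, 2), (1, 3)], [(0, 1), (0, 1), (2, 3), (4, 5), (4, 6), (6, 7),
  (5, 6), (2, 4), (3, 4), (1, 3), (1, 3), (1, 2)], [(0, 1), (0, 1), (2, 3), (4, 5), (4, 6), (6,
  7), (5, 6), (2, 4), (3, 4), (1, 5), (1, 3), (1, 2)], [(0, 1), (0, 1), (3, 4), (3, 5), (6, 7),
  (4, 5), (4, 6), (2, 3), (5, 6), (1, 5), (1, 2), (1, 3)], [(0, 1), (0, 1), (3, 4), (3, 6), (5,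
  6), (4, 6), (4, 5), (2, 3), (6, 7), (1, 5), (1, 3), (1, 2)], [(1, 2), (1, 3), (1, 5), (4, 5),
  (4, 6), (6, 7), (2, 3), (1, 4), (3, 6), (3, 4), (5, 6), (0, 1)], [(1, 2), (1, 3), (1, 3), (4,
  5), (6, 7), (7, 8), (2, 3), (5, 7), (5, 6), (0, 1), (3, 4), (3, 5)], [(0, 1), (3, 4), (3, 4),
  (3, 5), (6, 7), (7, 8), (1, 2), (5, 7), (5, 6), (4, 5), (2, 3), (1, 3)], [(0, 1), (0, 1), (2,
  3), (4, 5), (6, 7), (7, 8), (5, 7), (5, 6), (3, 4), (1, 3), (1, 5), (1, 2)], [(0, 1), (0, 1),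
  (2, 3), (5, 6), (5, 7), (7, 8), (3, 4), (6, 7), (4, 5), (3, 5), (1, 2), (1, 3)], [(1, 2), (1,
  3), (1, 3), (4, 5), (6, 7), (7, 8), (2, 3), (5, 7), (5, 6), (0, 1), (3, 4), (3, 4)], [(1, 2),
  (1, 3), (1, 3), (4, 5), (6, 7), (7, 8), (2, 3), (5, 7), (5, 6), (0, 1), (3, 6), (3, 4)], [(1,
  2), (1, 4), (3, 4), (3, 5), (6, 7), (7, 8), (5, 7), (5, 6), (1, 3), (2, 3), (0, 1), (4, 5)],
  [(1, 2), (1, 3), (4, 5), (4, 5), (6, 7), (7, 8), (2, 3), (0, 1), (5, 7), (1, 4), (5, 6), (3,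
  4)], [(1, 2), (1, 5), (3, 4), (3, 4), (6, 7), (7, 8), (5, 7), (5, 6), (0, 1), (2, 3), (1, 3),
  (4, 5)], [(1, 2), (1, 6), (3, 4), (3, 5), (7, 8), (5, 6), (5, 7), (1, 3), (4, 5), (2, 3), (6,
  7), (0, 1)], [(0, 1), (0, 1), (2, 3), (4, 5), (6, 7), (7, 8), (5, 7), (5, 6), (3, 4), (1, 3),
  (1, 2), (1, 2)], [(0, 1), (0, 1), (2, 3), (4, 5), (6, 7), (7, 8), (5, 7), (5, 6), (3, 4), (1,
  3), (1, 3), (1, 2)], [(0, 1), (0, 1), (2, 3), (4, 5), (6, 7), (7, 8), (5, 7), (5, 6), (3, 4),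
  (1, 4), (1, 3), (1, 2)], [(0, 1), (0, 1), (2, 3), (4, 5), (6, 7), (7, 8), (5, 7), (5, 6), (3,
  4), (1, 6), (1, 3), (1, 2)], [(1, 2), (1, 3), (1, 4), (5, 6), (5, 7), (7, 8), (3, 4), (6, 7),
  (1, 5), (2, 3), (4, 5), (0, 1)], [(1, 2), (1, 3), (1, 4), (5, 6), (5, 7), (7, 8), (3, 4), (6,
  7), (2, 3), (2, 5), (4, 5), (0, 1)], [(0, 1), (2, 3), (4, 5), (6, 7), (6, 8), (8, 9), (1, 3),
  (7, 8), (1, 2), (5, 6), (3, 4), (3, 6)], [(1, 2), (1, 3), (1, 6), (4, 5), (7, 8), (8, 9), (5,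
  6), (2, 3), (6, 8), (6, 7), (0, 1), (3, 4)], [(0, 1), (3, 4), (3, 4), (5, 6), (7, 8), (8, 9),
  (1, 2), (6, 8), (6, 7), (4, 5), (2, 3), (1, 3)], [(0, 1), (2, 3), (4, 5), (6, 7), (6, 8), (8,
  9), (3, 5), (7, 8), (3, 4), (1, 2), (1, 3), (5, 6)], [(1, 2), (1, 3), (1, 4), (5, 6), (7, 8),
  (8, 9), (3, 4), (6, 8), (6, 7), (2, 3), (4, 5), (0, 1)], [(0, 1), (2, 3), (4, 5), (6, 7), (8,
  9), (9, 10), (1, 3), (7, 9), (7, 8), (5, 6), (1, 2), (3, 4)]]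

def aliveReps : List (List Code) := [
  [(1, 2), (1, 2), (1, 2), (1, 3), (1, 3), (3, 4), (3, 4), (0, 1), (0, 1), (0, 1), (2, 3), (2,
  3)], [(2, 3), (2, 3), (2, 3), (0, 1), (2, 4), (4, 5), (1, 3), (1, 2), (1, 2), (1, 2), (3, 4),
  (3, 4)], [(1, 2), (1, 2), (1, 2), (1, 3), (1, 4), (3, 4), (4, 5), (0, 1), (0, 1), (0, 1), (2,
  4), (2, 3)], [(0, 1), (0, 1), (2, 3), (2, 3), (2, 4), (4, 5), (3, 4), (3, 4), (1, 2), (1, 2),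
  (1, 2), (1, 3)], [(2, 3), (2, 3), (2, 4), (2, 4), (0, 1), (1, 3), (3, 4), (3, 4), (1, 2), (1,
  2), (1, 2), (4, 5)], [(3, 4), (3, 4), (3, 4), (0, 1), (3, 5), (5, 6), (1, 2), (1, 3), (1, 3),
  (1, 3), (4, 5), (2, 3)], [(1, 3), (1, 3), (1, 3), (1, 2), (4, 5), (2, 3), (5, 6), (3, 5), (3,
  5), (3, 4), (3, 4), (0, 1)], [(3, 4), (3, 4), (3, 5), (3, 5), (0, 1), (1, 2), (4, 5), (5, 6),
  (1, 3), (1, 3), (2, 3), (2, 3)], [(0, 1), (0, 1), (0, 1), (2, 3), (2, 4), (4, 5), (3, 4), (1,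
  3), (1, 3), (1, 4), (1, 2), (1, 2)], [(0, 1), (0, 1), (2, 3), (2, 3), (2, 4), (4, 5), (1, 3),
  (1, 3), (3, 4), (3, 4), (1, 2), (1, 2)], [(1, 3), (1, 3), (1, 3), (1, 2), (4, 5), (2, 3), (5,
  6), (0, 1), (0, 1), (3, 4), (3, 4), (3, 5)], [(1, 2), (1, 2), (1, 4), (1, 4), (1, 3), (3, 4),
  (4, 5), (4, 5), (2, 3), (2, 4), (0, 1), (0, 1)], [(1, 2), (1, 2), (3, 4), (3, 4), (1, 4), (2,
  4), (0, 1), (0, 1), (1, 3), (2, 3), (4, 5), (4, 5)], [(1, 2), (1, 2), (1, 3), (1, 3), (4, 5),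
  (5, 6), (2, 3), (2, 3), (0, 1), (0, 1), (3, 5), (3, 4)], [(0, 1), (0, 1), (3, 4), (3, 4), (3,
  5), (5, 6), (1, 2), (1, 4), (1, 3), (1, 3), (2, 3), (4, 5)], [(0, 1), (0, 1), (3, 5), (3, 5),
  (4, 5), (3, 4), (1, 2), (1, 4), (5, 6), (2, 3), (1, 3), (1, 3)], [(1, 3), (1, 3), (5, 6), (5,
  6), (1, 2), (2, 3), (0, 1), (0, 1), (3, 4), (4, 5), (1, 5), (3, 5)], [(1, 5), (1, 5), (1, 2),
  (3, 4), (3, 5), (4, 5), (1, 3), (2, 3), (5, 6), (5, 6), (0, 1), (0, 1)], [(1, 2), (1, 2), (1,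
  3), (1, 3), (4, 5), (5, 6), (2, 3), (2, 4), (0, 1), (0, 1), (3, 4), (3, 5)], [(1, 3), (1, 3),
  (1, 2), (1, 4), (1, 5), (4, 5), (2, 3), (5, 6), (3, 5), (3, 4), (0, 1), (0, 1)], [(3, 4), (3,
  4), (3, 4), (0, 1), (5, 6), (6, 7), (1, 2), (1, 3), (1, 3), (4, 6), (4, 5), (2, 3)], [(0, 1),
  (0, 1), (3, 5), (3, 5), (3, 4), (4, 5), (5, 6), (5, 6), (2, 3), (1, 2), (1, 2), (1, 3)], [(1,
  2), (1, 2), (1, 4), (3, 4), (3, 5), (5, 6), (1, 3), (4, 5), (2, 5), (0, 1), (0, 1), (2, 3)],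
  [(1, 3), (1, 3), (1, 4), (2, 3), (2, 5), (5, 6), (1, 2), (4, 5), (0, 1), (0, 1), (3, 5), (3,
  4)], [(1, 3), (1, 3), (1, 4), (2, 3), (2, 5), (5, 6), (4, 5), (1, 2), (3, 4), (3, 4), (3, 5),
  (0, 1)], [(1, 3), (1, 3), (1, 4), (2, 3), (2, 5), (4, 5), (5, 6), (1, 2), (3, 5), (3, 5), (3,
  4), (0, 1)], [(1, 3), (1, 3), (1, 2), (4, 5), (4, 6), (2, 3), (6, 7), (5, 6), (0, 1), (3, 5),
  (3, 4), (3, 4)], [(1, 2), (1, 2), (4, 5), (4, 5), (1, 3), (3, 5), (5, 6), (5, 6), (3, 4), (0,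
  1), (0, 1), (2, 3)], [(1, 4), (1, 4), (1, 2), (1, 3), (5, 6), (6, 7), (3, 4), (2, 3), (0, 1),
  (0, 1), (4, 5), (4, 6)], [(1, 3), (1, 3), (2, 3), (4, 5), (4, 6), (5, 6), (1, 2), (6, 7), (3,
  5), (3, 5), (0, 1), (3, 4)], [(1, 3), (1, 3), (1, 2), (4, 5), (4, 6), (5, 6), (2, 3), (6, 7),
  (3, 5), (3, 6), (0, 1), (3, 4)], [(3, 4), (3, 4), (1, 2), (1, 4), (5, 6), (6, 7), (2, 4), (0,
  1), (2, 3), (1, 3), (4, 6), (4, 5)], [(0, 1), (0, 1), (2, 3), (4, 6), (5, 6), (4, 5), (6, 7),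
  (3, 4), (1, 5), (1, 3), (1, 4), (1, 2)], [(0, 1), (0, 1), (2, 3), (4, 5), (4, 6), (5, 6), (6,
  7), (3, 5), (3, 4), (1, 2), (1, 4), (1, 3)], [(1, 2), (1, 4), (3, 4), (3, 5), (6, 7), (2, 4),
  (0, 1), (4, 5), (1, 3), (2, 3), (5, 6), (4, 6)], [(3, 5), (3, 5), (0, 1), (3, 4), (6, 7), (4,
  5), (1, 2), (7, 8), (5, 6), (5, 7), (2, 3), (1, 3)], [(0, 1), (2, 3), (2, 5), (4, 5), (4, 6),
  (3, 6), (6, 7), (1, 3), (1, 4), (3, 4), (5, 6), (1, 2)], [(1, 2), (1, 5), (3, 4), (3, 5), (6,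
  7), (4, 5), (1, 3), (2, 3), (0, 1), (5, 7), (5, 6), (7, 8)], [(3, 4), (3, 4), (0, 1), (5, 6),
  (5, 7), (1, 2), (7, 8), (6, 7), (1, 3), (4, 5), (4, 5), (2, 3)], [(1, 2), (3, 4), (3, 6), (5,
  6), (5, 7), (7, 8), (1, 5), (4, 5), (1, 3), (6, 7), (2, 3), (0, 1)], [(1, 2), (1, 3), (1, 4),
  (5, 6), (5, 7), (2, 3), (4, 6), (3, 4), (0, 1), (6, 7), (7, 8), (4, 5)]]

def slots : List (ℕ × ℕ) := [
  (3, 0), (4, 0), (4, 1), (4, 2), (4, 3), (5, 0), (5, 1), (5, 2), (4, 4), (4, 5), (5, 3), (4, 6),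
  (4, 7), (5, 4), (5, 5), (5, 6), (5, 7), (5, 8), (5, 9), (5, 10), (6, 0), (5, 11), (5, 12), (5,
  13), (5, 14), (5, 15), (6, 1), (5, 16), (6, 2), (6, 3), (6, 4), (6, 5), (6, 6), (6, 7), (6, 8),
  (7, 0), (6, 9), (7, 1), (7, 2), (7, 3), (7, 4)]

/-- Pairs of combinations without a solution: the number of the first, and the group of the second
with a mask of places in the group. -/
def deadPairs : List (ℕ × ℕ × ℕ) := [
  (16, 4, 255), (21, 3, 1), (27, 3, 1), (21, 4, 255), (16, 3, 1), (8, 4, 255), (13, 4, 255), (0,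
  4, 156), (27, 4, 255), (5, 4, 252), (20, 4, 255), (33, 3, 1), (9, 4, 142), (10, 4, 255), (20, 3,
  1), (3, 4, 143), (13, 3, 1), (14, 4, 191), (0, 5, 54120), (4, 4, 139), (5, 5, 131064), (18, 4,
  255), (15, 4, 255), (17, 4, 255), (11, 4, 130), (24, 4, 255), (6, 5, 131056), (19, 4, 146), (1,
  5, 36864), (10, 5, 122872), (0, 7, 15), (11, 5, 45062), (23, 4, 162), (1, 6, 996), (9, 5,
  36870), (25, 4, 158), (28, 3, 1), (13, 5, 130020), (2, 4, 128), (31, 3, 1), (6, 4, 128), (22, 4,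
  158), (32, 3, 1), (1, 7, 31), (14, 5, 27620), (6, 6, 1020), (29, 4, 226), (15, 5, 27588), (36,
  3, 1), (6, 7, 31), (30, 4, 226), (5, 6, 1023), (26, 4, 226), (34, 3, 1), (33, 4, 238), (16, 5,
  1156), (31, 4, 254), (19, 5, 46084), (28, 4, 254), (7, 5, 92928), (18, 6, 1), (35, 4, 238), (20,
  6, 7), (2, 7, 30), (32, 4, 238), (1, 4, 128), (34, 4, 238), (38, 4, 252), (5, 7, 31), (36, 4,
  238), (19, 6, 27), (31, 5, 12), (29, 5, 8212), (7, 7, 27), (11, 7, 26), (30, 5, 8212), (10, 6,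
  5), (10, 7, 4), (20, 7, 4), (17, 6, 1), (26, 6, 30), (13, 6, 7), (26, 5, 45056), (20, 5, 36864),
  (18, 5, 768), (29, 6, 24), (40, 4, 32), (23, 5, 8192), (33, 5, 4), (37, 4, 172), (9, 7, 8), (32,
  5, 4), (25, 5, 36864), (28, 5, 36864), (17, 5, 256), (7, 6, 768), (30, 6, 16), (19, 7, 16), (23,
  7, 16), (26, 7, 16), (28, 6, 4), (22, 5, 4096)]

def deadTriples : List (ℕ × ℕ × ℕ) := [
  (0, 0, 0), (0, 0, 1), (0, 0, 2), (0, 0, 5), (0, 0, 6), (0, 0, 7), (0, 0, 9), (0, 0, 11), (0, 0,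
  19), (0, 0, 23), (26, 0, 0), (29, 0, 0), (30, 0, 0), (40, 0, 0), (1, 0, 1), (1, 0, 2), (1, 0,
  5), (1, 0, 6), (1, 0, 7), (9, 0, 1), (1, 0, 11), (19, 1, 0), (23, 1, 0), (26, 1, 0), (29, 1, 0),
  (30, 1, 0), (2, 2, 0), (0, 2, 5), (0, 2, 6), (0, 2, 7), (5, 0, 5), (6, 0, 5), (7, 0, 5), (6, 0,
  6), (7, 0, 6), (26, 0, 6), (7, 0, 7), (26, 0, 7), (9, 0, 9), (9, 11, 0), (19, 9, 0), (11, 11,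
  0), (19, 11, 0), (1, 1, 1), (1, 1, 2), (1, 1, 5), (1, 1, 6), (1, 1, 7), (1, 1, 9), (1, 1, 11),
  (19, 1, 1), (23, 1, 1), (26, 1, 1), (29, 1, 1), (30, 1, 1), (2, 2, 1), (1, 2, 5), (1, 2, 6), (1,
  2, 7), (1, 5, 5), (6, 1, 5), (7, 1, 5), (6, 1, 6), (7, 1, 6), (26, 1, 6), (7, 1, 7), (26, 1, 7),
  (9, 9, 1), (9, 11, 1), (19, 9, 1), (11, 11, 1), (19, 11, 1), (2, 2, 2), (2, 2, 5), (2, 2, 6),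
  (2, 2, 7), (5, 2, 5), (6, 2, 5), (7, 2, 5), (6, 2, 6), (7, 2, 6), (7, 2, 7), (3, 6, 6), (7, 3,
  6), (3, 26, 6), (7, 3, 7), (3, 26, 7), (11, 11, 3), (19, 11, 3), (4, 6, 6), (7, 4, 6), (4, 26,
  6), (7, 4, 7), (4, 26, 7), (11, 11, 4), (19, 11, 4), (5, 5, 5), (6, 5, 5), (7, 5, 5), (6, 6, 5),
  (7, 5, 6), (7, 5, 7), (6, 6, 6), (7, 6, 6), (6, 8, 6), (6, 6, 10), (6, 20, 6), (26, 6, 6), (7,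
  6, 7), (7, 8, 6), (7, 10, 6), (7, 20, 6), (26, 7, 6), (26, 8, 6), (26, 10, 6), (7, 8, 7), (7,
  10, 7), (7, 12, 7), (7, 20, 7), (7, 22, 7), (25, 7, 7), (26, 7, 7), (7, 28, 7), (38, 7, 7), (26,
  8, 7), (26, 10, 7), (7, 12, 12), (9, 9, 9), (9, 11, 9), (19, 9, 9), (11, 11, 9), (19, 11, 9),
  (11, 11, 11), (11, 11, 14), (11, 11, 19), (14, 11, 19), (13, 13, 13), (13, 13, 19), (31, 13, 13)]

def deadMasks : List ℕ := [
  1097824990488, 2197336618264, 2199023255320, 548069177151, 548069177151, 2199023255320,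
  2198955096576, 1923771001344, 277486763839, 2199022728700, 277486763839, 2199022712292,
  549755809663, 2146951167, 27785215, 27787263, 655359, 1507327, 1507327, 1101237130724,
  275253182271, 65535, 374882175, 1101198326500, 65535, 374882175, 1101505509924, 16383,
  374357887, 1686649572, 1686649572, 8191, 6911, 6911, 6911, 6911, 6911, 6911, 1056639, 2791,
  76024550]

set_option maxHeartbeats 40000000 in
-- many evaluations by the kernel
theorem run_searchTrees :
    ∀ x ∈ searchTrees, run group x.2 4294967295 0 [] (group x.1) = true := by
  simp only [searchTrees, List.forall_mem_cons]
  refine ⟨?_, ?_, ?_, ?_, ?_, ?_, ?_, ?_, ?_, ?_, ?_, ?_, ?_, ?_, ?_, ?_, by simp⟩ <;>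
    decide +kernel

/-! ### The combinations that have a solution -/

theorem Sol.not_mem_deadReps {X Y Z : List Code} (hY : Pos Y) (hZ : Pos Z) (h : Sol X Y Z) :
    X ∉ deadReps := by
  intro hX
  have hdead : ∀ X ∈ deadReps, X.length = 12 ∧ CodeSearch.color (coEdges X (pairsBelow 12)) 0 0 = true := by
    decide +kernel
  have hes : ∀ e ∈ pairsBelow 12, e.u < e.v ∧ e.v < 12 := by decide +kernel
  obtain ⟨h1, h2⟩ := hdead X hX
  rw [h.color_eq_false h1 hY hZ hes] at h2
  exact absurd h2 (by simp)

def rep (i : ℕ) : List Code := aliveReps.getD i []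

def slot (i : ℕ) : ℕ × ℕ := slots.getD i (0, 0)

theorem rep_length : ∀ i < 41, (rep i).length = 12 := by decide +kernel

theorem rep_pos : ∀ i < 41, Pos (rep i) := by decide +kernel

theorem slot_lt : ∀ i < 41, (slot i).2 < 32 := by decide +kernel

instance (Q : List Code) (g : Geo) : Decidable (g.Valid Q) := inferInstanceAs (Decidable (_ ∧ _))

theorem rep_fits (i : ℕ) (hi : i < 41) : Fits (slot i).2 (group (slot i).1) (rep i) := by
  have h : ∀ i < 41, ((group (slot i).1).map Item.code).Nodup ∧
      (group (slot i).1).length ≤ 16 ∧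
      (∀ p ∈ rep i, p ∈ (group (slot i).1).map Item.code) ∧
      ∀ it ∈ group (slot i).1, it.g.Valid ((group (slot i).1).map Item.code) ∧
        ∀ k < (rep i).count it.code, it.mp.testBit (32 * k + (slot i).2) = true := by
    decide +kernel
  obtain ⟨h1, h2, h3, h4⟩ := h i hi
  exact ⟨h1, h2, h3, h4⟩

theorem testBit_full {t : ℕ} (ht : t < 32) : (4294967295 : ℕ).testBit t = true := by
  rw [show (4294967295 : ℕ) = 2 ^ 32 - 1 by norm_num, Nat.testBit_two_pow_sub_one]
  simpa using ht

/-- Some tree has a branch for `X`, meant for the combinations in `M` of group `s`. -/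
def isSearched (s M : ℕ) (q : Option (ℕ × ℕ)) (X : List Code) : Bool :=
  searchTrees.any fun x => x.1.beq s && x.2.mem M q (rowsFrom [] X)

theorem Sol.false_of_isSearched {i j M : ℕ} {q : Option (ℕ × ℕ)} {Z : List Code} (hi : i < 41)
    (hj : j < 41) (hZ : Pos Z) (hM : M.testBit (slot j).2 = true)
    (hs : isSearched (slot j).1 M q (rep i) = true) (hq : ∀ x ∈ q, Fits x.2 (group x.1) Z)
    (h : Sol (rep i) (rep j) Z) : False := by
  rw [isSearched, List.any_eq_true] at hs
  obtain ⟨x, hx, hs⟩ := hs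
  rw [Bool.and_eq_true, Nat.beq_eq] at hs
  have hrun := run_searchTrees x hx
  rw [hs.1] at hrun
  exact h.run (rep_length _ hi) hZ (rep_fits j hj) (testBit_full (slot_lt j hj)) hM hs.2 hrun hq

def pairDead (i j : ℕ) : Bool :=
  deadPairs.any fun x => x.1.beq i && x.2.1.beq (slot j).1 && x.2.2.testBit (slot j).2

theorem Sol.not_pairDead {i j : ℕ} (hi : i < 41) (hj : j < 41) {Z : List Code} (hZ : Pos Z)
    (h : Sol (rep i) (rep j) Z) : pairDead i j = false := by
  rw [← Bool.not_eq_true]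
  intro hd
  have hmem : ∀ x ∈ deadPairs, isSearched x.2.1 x.2.2 none (rep x.1) = true := by
    decide +kernel
  rw [pairDead, List.any_eq_true] at hd
  obtain ⟨x, hx, hd⟩ := hd
  rw [Bool.and_eq_true, Bool.and_eq_true, Nat.beq_eq, Nat.beq_eq] at hd
  obtain ⟨⟨rfl, h2⟩, h3⟩ := hd
  have hm := hmem x hx
  rw [h2] at hm
  exact h.false_of_isSearched hi hj hZ h3 hm (by simp)

theorem Sol.not_mem_deadTriples {x : ℕ × ℕ × ℕ} (hx : x ∈ deadTriples)
    (h : Sol (rep x.1) (rep x.2.1) (rep x.2.2)) : False := by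
  have hmem : ∀ x ∈ deadTriples, (x.1 < 41 ∧ x.2.1 < 41 ∧ x.2.2 < 41) ∧
      isSearched (slot x.2.1).1 (2 ^ (slot x.2.1).2) (some (slot x.2.2)) (rep x.1) = true := by
    decide +kernel
  obtain ⟨⟨h1, h2, h3⟩, hm⟩ := hmem x hx
  refine h.false_of_isSearched h1 h2 (rep_pos _ h3) ?_ hm ?_
  · rw [Nat.testBit_two_pow]; simp
  · intro y hy
    rw [Option.mem_def, Option.some.injEq] at hy
    subst hy
    exact rep_fits _ h3

def deadMask (i : ℕ) : ℕ := deadMasks.getD i 0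

theorem Sol.testBit_deadMask {i j : ℕ} (hi : i < 41) (hj : j < 41) {Z : List Code} (hZ : Pos Z)
    (h : Sol (rep i) (rep j) Z) : (deadMask i).testBit j = false := by
  have hmask : ∀ i < 41, ∀ j < 41, (deadMask i).testBit j = true →
      (pairDead i j || pairDead j i) = true := by
    decide +kernel
  rw [← Bool.not_eq_true]
  intro hd
  have := hmask i hi j hj hd
  rw [h.not_pairDead hi hj hZ, h.swap.not_pairDead hj hi hZ] at this
  exact absurd this (by simp)

/-- The triple `(i, j, k)` is listed, in some order, among those without a solution. -/
def tripleDead (i j k : ℕ) : Bool :=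
  deadTriples.any fun x =>
    (2 ^ x.1 + 2 ^ x.2.1 + 2 ^ x.2.2 : ℕ).beq (2 ^ i + 2 ^ j + 2 ^ k) &&
      (x == (i, j, k) || x == (i, k, j) || x == (j, i, k) || x == (j, k, i) || x == (k, i, j) ||
        x == (k, j, i))

theorem Sol.not_tripleDead {i j k : ℕ} (h : Sol (rep i) (rep j) (rep k)) :
    tripleDead i j k = false := by
  rw [← Bool.not_eq_true]
  intro hd
  rw [tripleDead, List.any_eq_true] at hd
  obtain ⟨x, hx, hd⟩ := hd
  simp only [Bool.and_eq_true, Bool.or_eq_true, beq_iff_eq] at hd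
  rcases hd.2 with ((((rfl | rfl) | rfl) | rfl) | rfl) | rfl
  · exact h.not_mem_deadTriples hx
  · exact h.rotate.rotate.swap.not_mem_deadTriples hx
  · exact h.swap.not_mem_deadTriples hx
  · exact h.rotate.not_mem_deadTriples hx
  · exact h.rotate.rotate.not_mem_deadTriples hx
  · exact h.rotate.swap.not_mem_deadTriples hx

def edgesTable : List ℕ := aliveReps.map edgeCount

/-- The number of the combination `λ^♣`. -/
abbrev clubIdx : ℕ := 12

/-- The number of the combination `λ^♠`. -/
abbrev spadeIdx : ℕ := 7

def tripleOk (i j k : ℕ) : Bool :=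
  (deadMask i).testBit k || (deadMask j).testBit k ||
    Nat.blt (edgesTable.getD i 0 + edgesTable.getD j 0 + edgesTable.getD k 0) 66 ||
    tripleDead i j k || (i.beq j && j.beq k && (i.beq clubIdx || i.beq spadeIdx))

theorem tripleOk_all : ∀ j < 41, ∀ i < j + 1, (deadMask i).testBit j = true ∨
    ∀ k < 41, k < j ∨ tripleOk i j k = true := by
  decide +kernel

theorem Sol.special_of_le {i j k : ℕ} (hij : i ≤ j) (hjk : j ≤ k) (hk : k < 41)
    (h : Sol (rep i) (rep j) (rep k)) : i = j ∧ j = k ∧ (i = clubIdx ∨ i = spadeIdx) := by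
  have hj : j < 41 := by omega
  have hi : i < 41 := by omega
  have he : ∀ i < 41, edgesTable.getD i 0 = edgeCount (rep i) := by
    decide +kernel
  rcases tripleOk_all j hj i (by omega) with h1 | h1
  · rw [h.testBit_deadMask hi hj (rep_pos k hk)] at h1
    exact absurd h1 (by simp)
  rcases h1 k hk with h1 | h1
  · omega
  have h2 := h.choose_le
  rw [rep_length i hi, ← he i hi, ← he j hj, ← he k hk] at h2
  rw [tripleOk, h.rotate.rotate.swap.testBit_deadMask hi hk (rep_pos j hj),
    h.rotate.testBit_deadMask hj hk (rep_pos i hi), h.not_tripleDead] at h1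
  simp only [Bool.false_or, Bool.or_false, Bool.or_eq_true, Bool.and_eq_true, Nat.beq_eq,
    Nat.blt_eq] at h1
  have h66 : (12 : ℕ).choose 2 = 66 := by decide
  omega

theorem Sol.special {i j k : ℕ} (hi : i < 41) (hj : j < 41) (hk : k < 41)
    (h : Sol (rep i) (rep j) (rep k)) : i = j ∧ j = k ∧ (i = clubIdx ∨ i = spadeIdx) := by
  rcases le_total i j with h1 | h1 <;> rcases le_total j k with h2 | h2 <;>
    rcases le_total i k with h3 | h3
  · exact h.special_of_le h1 h2 hk
  · exact h.special_of_le h1 h2 hk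
  · have := h.rotate.rotate.swap.special_of_le h3 h2 hj
    omega
  · have := h.rotate.rotate.special_of_le h3 h1 hj
    omega
  · have := h.swap.special_of_le h1 h3 hk
    omega
  · have := h.rotate.special_of_le h2 h3 hi
    omega
  · have := h.rotate.swap.special_of_le h2 h1 hi
    omega
  · have := h.rotate.swap.special_of_le h2 h1 hi
    omega

/-! ### Enumeration of the combinations with given support -/

/-- The codes of the family `I(s)`. -/
def fam (s : ℕ) : List Code :=
  (0, 1) :: (s, s + 1) :: (List.range (s + 1)).flatMap fun j =>
    ((List.range j).filter fun i => decide (1 ≤ i)).map fun i => (i, j)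

/-- The codes of the family `S(s)`. -/
def core (s : ℕ) : List Code :=
  (if s = 3 then [(1, 3)] else [(1, 3), (s - 2, s)]) ++
    (List.range (s + 1)).map fun i => (i, i + 1)

def pos (p : Code) : ℕ := 11 * p.1 + p.2

/-- The number of copies of each code, as digits to the base `16` above the lowest `64` bits; the
lowest bits hold a sum that only serves to tell the numbers apart quickly. -/
def pack (X : List Code) : ℕ := (X.map fun p => 2 ^ 64 * 16 ^ pos p + pos p ^ 4).sum

theorem pack_eq (X : List Code) :
    pack X = 2 ^ 64 * (X.map fun p => 16 ^ pos p).sum + (X.map fun p => pos p ^ 4).sum := by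
  induction X with
  | nil => rfl
  | cons a X ih =>
    simp only [pack, List.map_cons, List.sum_cons] at ih ⊢
    rw [ih]; ring

theorem pos_injective {p q : Code} (hp : p.2 < 11) (hq : q.2 < 11) (h : pos p = pos q) :
    p = q := by
  unfold pos at h
  ext <;> omega

theorem exists_digits (X : List Code) {p : Code} (hp : p.2 < 11) (hX : ∀ q ∈ X, q.2 < 11) :
    ∃ A B, (X.map fun q => 16 ^ pos q).sum = A + X.count p * 16 ^ pos p + 16 ^ (pos p + 1) * B ∧
      16 * A ≤ X.length * 16 ^ pos p := by
  induction X with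
  | nil => exact ⟨0, 0, by simp, by simp⟩
  | cons a X ih =>
    obtain ⟨A, B, h1, h2⟩ := ih fun q hq => hX q (List.mem_cons_of_mem _ hq)
    rw [List.map_cons, List.sum_cons, h1, List.length_cons]
    rcases Nat.lt_trichotomy (pos a) (pos p) with h | h | h
    · refine ⟨A + 16 ^ pos a, B, ?_, ?_⟩
      · rw [List.count_cons_of_ne (by rintro rfl; omega)]; ring
      · have : 16 ^ (pos a + 1) ≤ 16 ^ pos p := Nat.pow_le_pow_right (by norm_num) h
        rw [pow_succ] at this
        linarith
    · have := pos_injective (hX a (by simp)) hp h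
      subst this
      refine ⟨A, B, ?_, ?_⟩
      · rw [List.count_cons_self]; ring
      · exact h2.trans (Nat.mul_le_mul_right _ (by omega))
    · refine ⟨A, B + 16 ^ (pos a - (pos p + 1)), ?_, ?_⟩
      · rw [List.count_cons_of_ne (by rintro rfl; omega), mul_add, ← pow_add,
          Nat.add_sub_cancel' h]; ring
      · exact h2.trans (Nat.mul_le_mul_right _ (by omega))

theorem pack_digit {X : List Code} (hX : ∀ q ∈ X, q.1 < 11 ∧ q.2 < 11) (hlen : X.length < 16)
    {p : Code} (hp : p.2 < 11) : (pack X >>> (64 + 4 * pos p)) % 16 = X.count p := by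
  have hlow : (X.map fun q => pos q ^ 4).sum < 2 ^ 64 := by
    have : (X.map fun q => pos q ^ 4).sum ≤ X.length * 2 ^ 28 := by
      clear hlen
      induction X with
      | nil => simp
      | cons a X ih =>
        have ih := ih fun q hq => hX q (List.mem_cons_of_mem _ hq)
        have ha := hX a (by simp)
        have : pos a ^ 4 ≤ 128 ^ 4 := Nat.pow_le_pow_left (by unfold pos; omega) 4
        rw [List.map_cons, List.sum_cons, List.length_cons]
        norm_num at this ⊢
        omega
    omega
  obtain ⟨A, B, h1, h2⟩ := exists_digits X hp fun q hq => (hX q hq).2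
  have h3 : pack X >>> (64 + 4 * pos p) = X.count p + 16 * B := by
    rw [Nat.shiftRight_add, Nat.shiftRight_eq_div_pow (pack X), pack_eq,
      Nat.mul_add_div (by norm_num), Nat.div_eq_of_lt hlow, Nat.add_zero,
      Nat.shiftRight_eq_div_pow, pow_mul, show (2 : ℕ) ^ 4 = 16 by norm_num, h1,
      show A + X.count p * 16 ^ pos p + 16 ^ (pos p + 1) * B =
        A + 16 ^ pos p * (X.count p + 16 * B) by ring,
      Nat.add_mul_div_left _ _ (by positivity), Nat.div_eq_of_lt, Nat.zero_add]
    have h4 : X.length * 16 ^ pos p < 16 * 16 ^ pos p :=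
      Nat.mul_lt_mul_of_pos_right hlen (by positivity)
    omega
  have h4 : X.count p ≤ X.length := List.count_le_length
  rw [h3]
  omega

theorem perm_of_pack_eq {X Y : List Code} (hX : ∀ q ∈ X, q.1 < 11 ∧ q.2 < 11)
    (hY : ∀ q ∈ Y, q.1 < 11 ∧ q.2 < 11) (hX' : X.length < 16) (hY' : Y.length < 16)
    (h : pack X = pack Y) : X.Perm Y := by
  rw [List.perm_iff_count]
  intro p
  by_cases hp : p.2 < 11
  · rw [← pack_digit hX hX' hp, h, pack_digit hY hY' hp]
  · rw [List.count_eq_zero_of_not_mem fun hc => hp (hX p hc).2,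
      List.count_eq_zero_of_not_mem fun hc => hp (hY p hc).2]

theorem pack_perm {X Y : List Code} (h : X.Perm Y) : pack X = pack Y := (h.map _).sum_eq

/-- Tests `leaf` on the sums of `b` numbers in `ps`, added to `N`. -/
noncomputable def enumSums (leaf : ℕ → Bool) (ps : List ℕ) : ℕ → ℕ → Bool :=
  List.rec (motive := fun _ => ℕ → ℕ → Bool)
    (fun b N => Nat.rec (motive := fun _ => Bool) (leaf N) (fun _ _ => true) b)
    (fun p _ ih b => Nat.rec (motive := fun _ => ℕ → Bool) leaf
      (fun b ihb N => band (force ihb (Nat.add N p)) (ih (Nat.succ b) N)) b) ps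

theorem enumSums_sound {leaf : ℕ → Bool} {ps : List ℕ} {b N : ℕ}
    (h : enumSums leaf ps b N = true) {E : List ℕ} (hE : ∀ p ∈ E, p ∈ ps) (hlen : E.length = b) :
    leaf (N + E.sum) = true := by
  induction ps generalizing b N E with
  | nil =>
    have : E = [] := List.eq_nil_iff_forall_not_mem.2 fun p hp => by simpa using hE p hp
    subst this
    subst hlen
    exact h
  | cons p ps ih =>
    induction b generalizing N E with
    | zero =>
      rw [List.length_eq_zero_iff] at hlen
      subst hlen
      exact h
    | succ b ihb =>
      obtain ⟨h1, h2⟩ := band_eq_true.1 h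
      rw [force_eq] at h1
      by_cases hp : p ∈ E
      · have hperm := List.perm_cons_erase hp
        rw [hperm.sum_eq, List.sum_cons, ← Nat.add_assoc]
        refine ihb h1 (fun q hq => hE q (List.mem_of_mem_erase hq)) ?_
        rw [List.length_erase_of_mem hp, hlen, Nat.add_sub_cancel]
      · refine ih h2 (fun q hq => ?_) hlen
        rcases List.mem_cons.1 (hE q hq) with rfl | hq'
        · exact absurd hq hp
        · exact hq'

/-- The reflection of `I(s)`. -/
def refl (s : ℕ) (p : Code) : Code := (s + 1 - p.2, s + 1 - p.1)

/-- The automorphism of `I(s)` that exchanges the end-points `0`, `1` and `1`, `2`. -/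
def shear (p : Code) : Code :=
  match p with
  | (0, 1) => (1, 2)
  | (1, 2) => (0, 1)
  | (1, j) => (2, j)
  | (2, j) => (1, j)
  | p => p

/-- Some automorphisms of `I(s)` with their inverses. -/
def words (s : ℕ) : List ((Code → Code) × (Code → Code)) :=
  let r := refl s
  let t := shear
  [(id, id), (r, r), (t, t), (r ∘ t, t ∘ r), (t ∘ r, r ∘ t), (r ∘ t ∘ r, r ∘ t ∘ r),
    (t ∘ r ∘ t, t ∘ r ∘ t), (r ∘ t ∘ r ∘ t, t ∘ r ∘ t ∘ r), (t ∘ r ∘ t ∘ r, r ∘ t ∘ r ∘ t)]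

/-- Sets of codes of which no two touch. -/
def indepSets : ℕ → List (List Code)
  | 3 => [
    [(0, 1), (2, 3)], [(3, 4), (1, 2)], [(1, 2), (1, 3)], [(0, 1), (3, 4)], [(1, 3), (2, 3)]]
  | 4 => [
    [(1, 3), (1, 4), (2, 3), (2, 4)], [(0, 1), (2, 4), (3, 4)], [(4, 5), (1, 2), (1, 3)], [(0, 1),
    (4, 5), (2, 3)], [(1, 2), (1, 4), (3, 4)], [(0, 1), (2, 3), (2, 4)], [(4, 5), (1, 3), (2, 3)]]
  | 5 => [
    [(0, 1), (2, 4), (2, 5), (3, 4), (3, 5)], [(5, 6), (1, 3), (1, 4), (2, 3), (2, 4)], [(1, 2),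
    (1, 4), (1, 5), (3, 4), (3, 5)], [(1, 3), (1, 5), (2, 3), (2, 5), (4, 5)], [(0, 1), (5, 6),
    (2, 3), (2, 4)], [(1, 2), (1, 3), (1, 5), (4, 5)], [(0, 1), (2, 5), (3, 5), (4, 5)], [(5, 6),
    (1, 2), (1, 4), (3, 4)], [(5, 6), (1, 2), (1, 3), (1, 4)], [(0, 1), (5, 6), (2, 4), (3, 4)],
    [(0, 1), (2, 3), (2, 5), (4, 5)], [(1, 2), (1, 5), (3, 5), (4, 5)], [(1, 3), (1, 4), (1, 5),
    (2, 3), (2, 4), (2, 5)]]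
  | 6 => [
    [(1, 3), (1, 5), (1, 6), (2, 3), (2, 5), (2, 6), (4, 5), (4, 6)], [(0, 1), (2, 3), (2, 6), (4,
    6), (5, 6)], [(6, 7), (1, 2), (1, 3), (1, 5), (4, 5)], [(0, 1), (6, 7), (2, 4), (2, 5), (3,
    4), (3, 5)], [(1, 2), (1, 4), (1, 6), (3, 4), (3, 6), (5, 6)], [(0, 1), (6, 7), (2, 3), (2,
    5), (4, 5)], [(1, 2), (1, 3), (1, 6), (4, 6), (5, 6)], [(0, 1), (2, 4), (2, 6), (3, 4), (3,
    6), (5, 6)], [(6, 7), (1, 3), (1, 4), (1, 5), (2, 3), (2, 4), (2, 5)], [(1, 2), (1, 5), (1,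
    6), (3, 5), (3, 6), (4, 5), (4, 6)], [(6, 7), (1, 2), (1, 4), (1, 5), (3, 4), (3, 5)], [(0,
    1), (2, 5), (2, 6), (3, 5), (3, 6), (4, 5), (4, 6)], [(1, 3), (1, 4), (1, 6), (2, 3), (2, 4),
    (2, 6), (5, 6)]]
  | 7 => [
    [(1, 3), (1, 4), (1, 6), (1, 7), (2, 3), (2, 4), (2, 6), (2, 7), (5, 6), (5, 7)], [(7, 8), (1,
    3), (1, 5), (1, 6), (2, 3), (2, 5), (2, 6), (4, 5), (4, 6)], [(0, 1), (2, 4), (2, 6), (2, 7),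
    (3, 4), (3, 6), (3, 7), (5, 6), (5, 7)], [(1, 3), (1, 5), (1, 7), (2, 3), (2, 5), (2, 7), (4,
    5), (4, 7), (6, 7)], [(1, 2), (1, 4), (1, 6), (1, 7), (3, 4), (3, 6), (3, 7), (5, 6), (5, 7)],
    [(0, 1), (2, 3), (2, 6), (2, 7), (4, 6), (4, 7), (5, 6), (5, 7)], [(0, 1), (7, 8), (2, 4), (2,
    6), (3, 4), (3, 6), (5, 6)], [(0, 1), (2, 4), (2, 7), (3, 4), (3, 7), (5, 7), (6, 7)], [(7,
    8), (1, 2), (1, 3), (1, 5), (1, 6), (4, 5), (4, 6)], [(1, 2), (1, 3), (1, 6), (1, 7), (4, 6),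
    (4, 7), (5, 6), (5, 7)], [(0, 1), (2, 3), (2, 5), (2, 7), (4, 5), (4, 7), (6, 7)], [(1, 2),
    (1, 4), (1, 7), (3, 4), (3, 7), (5, 7), (6, 7)], [(7, 8), (1, 2), (1, 3), (1, 4), (1, 6), (5,
    6)]]
  | 8 => [
    [(1, 3), (1, 5), (1, 7), (1, 8), (2, 3), (2, 5), (2, 7), (2, 8), (4, 5), (4, 7), (4, 8), (6,
    7), (6, 8)], [(0, 1), (8, 9), (2, 3), (2, 5), (2, 7), (4, 5), (4, 7), (6, 7)], [(1, 2), (1,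
    3), (1, 5), (1, 8), (4, 5), (4, 8), (6, 8), (7, 8)]]
  | _ => []

/-- The representatives that belong to `I(s)`. -/
def repsOf (s : ℕ) : List (List Code) :=
  (aliveReps ++ deadReps).filter fun r =>
    (r.any fun p => p.1.beq s && p.2.beq (s + 1)) && r.all fun p => p.2.ble (s + 1)

def weight (N : ℕ) (D : List Code) : ℕ :=
  (D.map fun p => Nat.mod (Nat.shiftRight N (64 + 4 * pos p)) 16).sum

def isCounted (s N : ℕ) : Bool :=
  ((indepSets s).any fun D => Nat.blt 5 (weight N D)) ||
    (repsOf s).any fun r => (words s).any fun w => N.beq (pack (r.map w.1))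

abbrev EnumOk (s : ℕ) : Prop :=
  enumSums (isCounted s) ((fam s).map fun p => 2 ^ 64 * 16 ^ pos p + pos p ^ 4)
    (12 - (core s).length) (pack (core s)) = true

theorem enumOk_three : EnumOk 3 := by decide +kernel

theorem enumOk_four : EnumOk 4 := by decide +kernel

theorem enumOk_five : EnumOk 5 := by decide +kernel

theorem enumOk_six : EnumOk 6 := by decide +kernel

theorem enumOk_seven : EnumOk 7 := by decide +kernel

theorem enumOk_eight : EnumOk 8 := by decide +kernel

theorem enumOk_nine : EnumOk 9 := by decide +kernel

theorem enumOk {s : ℕ} (hs : 3 ≤ s) (hs' : s ≤ 9) : EnumOk s := by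
  interval_cases s
  exacts [enumOk_three, enumOk_four, enumOk_five, enumOk_six, enumOk_seven, enumOk_eight,
    enumOk_nine]

/-- The list `X` of codes stands for a combination in `L(s,12)`. -/
structure Admissible (s : ℕ) (X : List Code) : Prop where
  three_le : 3 ≤ s
  le_nine : s ≤ 9
  length_eq : X.length = 12
  core_subset : ∀ p ∈ core s, p ∈ X
  subset_fam : ∀ p ∈ X, p ∈ fam s
  indep : ∀ D : List Code, D.Nodup → (∀ p ∈ D, p ∈ fam s) → (∀ p ∈ D, ∀ q ∈ D, ¬ Touch p q) →
    (D.map fun p => X.count p).sum ≤ 5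

theorem fam_bounds {s : ℕ} (hs : 3 ≤ s) (hs' : s ≤ 9) :
    ∀ p ∈ fam s, p.1 < p.2 ∧ p.1 < 11 ∧ p.2 < 11 := by
  have h : ∀ s < 10, 3 ≤ s → ∀ p ∈ fam s, p.1 < p.2 ∧ p.1 < 11 ∧ p.2 < 11 := by decide +kernel
  exact h s (by omega) hs

theorem repsOf_spec {s : ℕ} (hs : 3 ≤ s) (hs' : s ≤ 9) :
    ∀ r ∈ repsOf s, r.length = 12 ∧ ∀ p ∈ r, p ∈ fam s := by
  have h : ∀ s < 10, 3 ≤ s → ∀ r ∈ repsOf s, r.length = 12 ∧ ∀ p ∈ r, p ∈ fam s := by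
    decide +kernel
  exact h s (by omega) hs

theorem words_spec {s : ℕ} (hs : 3 ≤ s) (hs' : s ≤ 9) : ∀ w ∈ words s, ∀ p ∈ fam s,
    w.2 (w.1 p) = p ∧ w.1 p ∈ fam s ∧ ∀ q ∈ fam s, Touch p q → Touch (w.2 p) (w.2 q) := by
  have h : ∀ s < 10, 3 ≤ s → ∀ w ∈ words s, ∀ p ∈ fam s,
      w.2 (w.1 p) = p ∧ w.1 p ∈ fam s ∧ ∀ q ∈ fam s, Touch p q → Touch (w.2 p) (w.2 q) := by
    decide +kernel
  exact h s (by omega) hs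

theorem indepSets_spec {s : ℕ} (hs' : s ≤ 9) : ∀ D ∈ indepSets s,
    D.Nodup ∧ (∀ p ∈ D, p ∈ fam s) ∧ ∀ p ∈ D, ∀ q ∈ D, ¬ Touch p q := by
  have h1 : ∀ s < 10, ∀ D ∈ indepSets s, D.Nodup := by decide +kernel
  have h2 : ∀ s < 10, ∀ D ∈ indepSets s, ∀ p ∈ D, p ∈ fam s := by decide +kernel
  have h3 : ∀ s < 10, ∀ D ∈ indepSets s, ∀ p ∈ D, ∀ q ∈ D, ¬ Touch p q := by decide +kernel
  exact fun D hD => ⟨h1 s (by omega) D hD, h2 s (by omega) D hD, h3 s (by omega) D hD⟩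

theorem core_nodup {s : ℕ} (hs : 3 ≤ s) (hs' : s ≤ 9) : (core s).Nodup := by
  have h : ∀ s < 10, 3 ≤ s → (core s).Nodup := by decide +kernel
  exact h s (by omega) hs

theorem Admissible.exists_perm_map {s : ℕ} {X : List Code} (h : Admissible s X) :
    ∃ r ∈ repsOf s, ∃ w ∈ words s, X.Perm (r.map w.1) := by
  obtain ⟨hs, hs', hlen, hcore, hfam, hind⟩ := h
  have hb : ∀ q ∈ X, q.1 < 11 ∧ q.2 < 11 := fun q hq => (fam_bounds hs hs' q (hfam q hq)).2
  obtain ⟨E, hE⟩ : ∃ E, X.Perm (core s ++ E) :=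
    let ⟨_, h1, h2⟩ := List.subperm_of_subset (core_nodup hs hs') hcore
    let ⟨E, h3⟩ := h2.exists_perm_append
    ⟨E, h3.trans (h1.append_right E)⟩
  have hEfam : ∀ p ∈ E, p ∈ fam s := fun p hp => hfam p (hE.mem_iff.2 (by simp [hp]))
  have hleaf := enumSums_sound (enumOk hs hs')
    (E := E.map fun p => 2 ^ 64 * 16 ^ CodeSearch.pos p + CodeSearch.pos p ^ 4)
    (fun x hx => by
      obtain ⟨p, hp, rfl⟩ := List.mem_map.1 hx
      exact List.mem_map_of_mem (hEfam p hp))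
    (by
      have := hE.length_eq
      rw [List.length_append, hlen] at this
      rw [List.length_map]
      omega)
  have hN : pack (core s) +
      (E.map fun p => 2 ^ 64 * 16 ^ CodeSearch.pos p + CodeSearch.pos p ^ 4).sum = pack X := by
    rw [pack_perm hE, pack, pack, List.map_append, List.sum_append]
  rw [hN, isCounted, Bool.or_eq_true] at hleaf
  rcases hleaf with hD | hr
  · exfalso
    obtain ⟨D, hD, hw⟩ := List.any_eq_true.1 hD
    obtain ⟨h1, h2, h3⟩ := indepSets_spec hs' D hD
    have h4 := hind D h1 h2 h3
    have h5 : weight (pack X) D = (D.map fun p => X.count p).sum := by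
      unfold weight
      congr 1
      refine List.map_congr_left fun p hp => ?_
      exact pack_digit hb (by omega) (fam_bounds hs hs' p (h2 p hp)).2.2
    rw [h5, Nat.blt_eq] at hw
    omega
  · obtain ⟨r, hr, hw⟩ := List.any_eq_true.1 hr
    obtain ⟨w, hw, he⟩ := List.any_eq_true.1 hw
    rw [Nat.beq_eq] at he
    obtain ⟨h1, h2⟩ := repsOf_spec hs hs' r hr
    refine ⟨r, hr, w, hw, perm_of_pack_eq hb ?_ (by omega) (by rw [List.length_map]; omega) he⟩
    intro q hq
    obtain ⟨p, hp, rfl⟩ := List.mem_map.1 hq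
    exact (fam_bounds hs hs' _ (words_spec hs hs' w hw p (h2 p hp)).2.1).2

/-- A representative that takes the place of `X` in every solution. -/
theorem Admissible.exists_rep {s : ℕ} {X : List Code} (h : Admissible s X) :
    ∃ r ∈ repsOf s, (∃ w ∈ words s, X.Perm (r.map w.1)) ∧ ∀ Y Z, Sol X Y Z → Sol r Y Z := by
  obtain ⟨r, hr, w, hw, hX⟩ := h.exists_perm_map
  have hwords := words_spec h.three_le h.le_nine w hw
  refine ⟨r, hr, ⟨w, hw, hX⟩, fun Y Z hS => ?_⟩
  have h1 := hS.map (f := w.2) fun p hp q hq => (hwords p (h.subset_fam p hp)).2.2 q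
    (h.subset_fam q hq)
  refine h1.perm ((hX.map w.2).trans ?_)
  rw [List.map_map]
  have h2 : r.map (w.2 ∘ w.1) = r.map id := List.map_congr_left fun p hp =>
    (hwords p ((repsOf_spec h.three_le h.le_nine r hr).2 p hp)).1
  rw [h2, List.map_id]

theorem exists_rep_eq {s : ℕ} {r : List Code} (hr : r ∈ repsOf s) (hdead : r ∉ deadReps) :
    ∃ i < 41, r = rep i := by
  rw [repsOf, List.mem_filter, List.mem_append] at hr
  rcases hr.1 with h | h
  · obtain ⟨i, hi, rfl⟩ := List.mem_iff_getElem.1 h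
    exact ⟨i, hi, by rw [rep, List.getD_eq_getElem]⟩
  · exact absurd h hdead

theorem special_spec {s : ℕ} (hs : 3 ≤ s) (hs' : s ≤ 9) :
    (rep clubIdx ∈ repsOf s → s = 4 ∧ ∀ w ∈ words s, ((rep clubIdx).map w.1).Perm (rep clubIdx)) ∧
    (rep spadeIdx ∈ repsOf s →
      s = 5 ∧ ∀ w ∈ words s, ((rep spadeIdx).map w.1).Perm (rep spadeIdx)) := by
  have h1 : ∀ s < 10, 3 ≤ s → rep clubIdx ∈ repsOf s → s = 4 := by decide +kernel
  have h2 : ∀ s < 10, 3 ≤ s → rep spadeIdx ∈ repsOf s → s = 5 := by decide +kernel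
  have h4 : ∀ w ∈ words 4, ((rep clubIdx).map w.1).Perm (rep clubIdx) := by
    simp only [← List.isPerm_iff]
    decide +kernel
  have h5 : ∀ w ∈ words 5, ((rep spadeIdx).map w.1).Perm (rep spadeIdx) := by
    simp only [← List.isPerm_iff]
    decide +kernel
  have h1 := h1 s (by omega) hs
  have h2 := h2 s (by omega) hs
  exact ⟨fun hr => ⟨h1 hr, h1 hr ▸ h4⟩, fun hr => ⟨h2 hr, h2 hr ▸ h5⟩⟩

/-- The codes of `λ^♣`, and those of `λ^♠`. -/
def IsClub (s : ℕ) (X : List Code) : Prop := s = 4 ∧ X.Perm (rep clubIdx)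

def IsSpade (s : ℕ) (X : List Code) : Prop := s = 5 ∧ X.Perm (rep spadeIdx)

theorem Sol.club_or_spade {s : Fin 3 → ℕ} {X : Fin 3 → List Code}
    (hX : ∀ i, Admissible (s i) (X i)) (h : Sol (X 0) (X 1) (X 2)) :
    (∀ i, IsClub (s i) (X i)) ∨ ∀ i, IsSpade (s i) (X i) := by
  choose r hr hw hSol using fun i => (hX i).exists_rep
  have hpos : ∀ i, Pos (r i) := fun i p hp => (fam_bounds (hX i).three_le (hX i).le_nine p
    ((repsOf_spec (hX i).three_le (hX i).le_nine _ (hr i)).2 p hp)).1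
  have h0 : Sol (r 0) (r 1) (r 2) :=
    (hSol 2 _ _ (hSol 1 _ _ (hSol 0 _ _ h).rotate).rotate).rotate
  have hdead : ∀ i, r i ∉ deadReps := by
    intro i
    fin_cases i
    · exact h0.not_mem_deadReps (hpos 1) (hpos 2)
    · exact h0.rotate.not_mem_deadReps (hpos 2) (hpos 0)
    · exact h0.rotate.rotate.not_mem_deadReps (hpos 0) (hpos 1)
  choose n hn hrn using fun i => exists_rep_eq (hr i) (hdead i)
  rw [hrn 0, hrn 1, hrn 2] at h0
  obtain ⟨h1, h2, h3⟩ := h0.special (hn 0) (hn 1) (hn 2)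
  have hall : ∀ i, n i = n 0 := by
    intro i
    fin_cases i
    exacts [rfl, h1.symm, (h1.trans h2).symm]
  have hsp := fun i => special_spec (hX i).three_le (hX i).le_nine
  rcases h3 with h3 | h3
  · left
    intro i
    obtain ⟨w, hw, hp⟩ := hw i
    have hri : r i = rep clubIdx := by rw [hrn i, hall i, h3]
    obtain ⟨h4, h5⟩ := (hsp i).1 (hri ▸ hr i)
    rw [hri] at hp
    exact ⟨h4, hp.trans (h5 w hw)⟩
  · right
    intro i
    obtain ⟨w, hw, hp⟩ := hw i
    have hri : r i = rep spadeIdx := by rw [hrn i, hall i, h3]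
    obtain ⟨h4, h5⟩ := (hsp i).2 (hri ▸ hr i)
    rw [hri] at hp
    exact ⟨h4, hp.trans (h5 w hw)⟩

/-! ### Intervals and their codes -/

theorem itv_touch_iff (I J : Itv) : I.Touch J ↔ I.hi = J.lo ∨ J.hi = I.lo := by
  have hI := I.lo_lt_hi
  have hJ := J.lo_lt_hi
  constructor
  · rintro ⟨x, hx⟩
    rw [Itv.toSet, Itv.toSet, Set.Icc_inter_Icc, Set.Icc_eq_singleton_iff] at hx
    obtain ⟨h1, h2⟩ := hx
    rw [← h2] at h1
    rcases le_total I.lo J.lo with h3 | h3 <;> rcases le_total I.hi J.hi with h4 | h4 <;>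
      simp only [h3, h4, sup_of_le_right, sup_of_le_left, inf_of_le_left, inf_of_le_right] at h1
    · exact Or.inl h1.symm
    · exact absurd h1 hJ.ne
    · exact absurd h1 hI.ne
    · exact Or.inr h1.symm
  · intro h
    rcases h with h | h
    · refine ⟨I.hi, ?_⟩
      rw [Itv.toSet, Itv.toSet, Set.Icc_inter_Icc, Set.Icc_eq_singleton_iff,
        sup_of_le_right (by linarith), inf_of_le_left (by linarith)]
      exact ⟨h.symm, rfl⟩
    · refine ⟨I.lo, ?_⟩
      rw [Itv.toSet, Itv.toSet, Set.Icc_inter_Icc, Set.Icc_eq_singleton_iff,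
        sup_of_le_left (by linarith), inf_of_le_right (by linarith)]
      exact ⟨rfl, h⟩

/-- The interval with the given code (or `[0, 1]`). -/
noncomputable def itvOf (p : Code) : Itv :=
  if h : p.1 < p.2 then ⟨p.1, p.2, Nat.cast_lt.2 h⟩ else ⟨0, 1, zero_lt_one⟩

noncomputable def codeOf (I : Itv) : Code := (⌊I.lo⌋₊, ⌊I.hi⌋₊)

theorem itvOf_lo {p : Code} (h : p.1 < p.2) : (itvOf p).lo = p.1 := by rw [itvOf, dif_pos h]

theorem itvOf_hi {p : Code} (h : p.1 < p.2) : (itvOf p).hi = p.2 := by rw [itvOf, dif_pos h]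

theorem codeOf_itvOf {p : Code} (h : p.1 < p.2) : codeOf (itvOf p) = p := by
  rw [codeOf, itvOf_lo h, itvOf_hi h, Nat.floor_natCast, Nat.floor_natCast]

theorem mem_fam {s : ℕ} {p : Code} : p ∈ fam s ↔
    p = (0, 1) ∨ p = (s, s + 1) ∨ 1 ≤ p.1 ∧ p.1 < p.2 ∧ p.2 ≤ s := by
  obtain ⟨i, j⟩ := p
  simp only [fam, List.mem_cons, List.mem_flatMap, List.mem_range, List.mem_map, List.mem_filter,
    decide_eq_true_eq, Prod.mk.injEq]
  constructor
  · rintro (h | h | ⟨b, hb, a, ⟨h1, h2⟩, rfl, rfl⟩)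
    · exact Or.inl h
    · exact Or.inr (Or.inl h)
    · exact Or.inr (Or.inr ⟨h2, h1, by omega⟩)
  · rintro (h | h | ⟨h1, h2, h3⟩)
    · exact Or.inl h
    · exact Or.inr (Or.inl h)
    · exact Or.inr (Or.inr ⟨j, by omega, i, ⟨h2, h1⟩, rfl, rfl⟩)

theorem pos_of_mem_fam {s : ℕ} {p : Code} (h : p ∈ fam s) : p.1 < p.2 := by
  rcases mem_fam.1 h with rfl | rfl | h
  · exact Nat.zero_lt_one
  · exact Nat.lt_succ_self s
  · exact h.2.1

theorem itvOf_mem {s : ℕ} {p : Code} (h : p ∈ fam s) : itvOf p ∈ itvFamily s := by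
  have hp := pos_of_mem_fam h
  change _ ∨ _ ∨ _
  rw [itvOf_lo hp, itvOf_hi hp]
  rcases mem_fam.1 h with rfl | rfl | ⟨h1, h2, h3⟩
  · left; norm_num
  · right; left; simp
  · exact Or.inr (Or.inr ⟨p.1, p.2, h1, h2, h3, rfl, rfl⟩)

theorem exists_itvOf {s : ℕ} {I : Itv} (h : I ∈ itvFamily s) : ∃ p ∈ fam s, I = itvOf p := by
  have key : ∀ p : Code, p ∈ fam s → I.lo = p.1 → I.hi = p.2 → ∃ p ∈ fam s, I = itvOf p :=
    fun p hp h1 h2 => ⟨p, hp, Itv.ext (h1.trans (itvOf_lo (pos_of_mem_fam hp)).symm)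
      (h2.trans (itvOf_hi (pos_of_mem_fam hp)).symm)⟩
  rcases h with ⟨h1, h2⟩ | ⟨h1, h2⟩ | ⟨i, j, h1, h2, h3, h4, h5⟩
  · exact key (0, 1) (mem_fam.2 (Or.inl rfl)) (by simpa using h1) (by simpa using h2)
  · exact key (s, s + 1) (mem_fam.2 (Or.inr (Or.inl rfl))) (by simpa using h1)
      (by simpa using h2)
  · exact key (i, j) (mem_fam.2 (Or.inr (Or.inr ⟨h1, h2, h3⟩))) h4 h5

theorem itvOf_codeOf {s : ℕ} {I : Itv} (h : I ∈ itvFamily s) : itvOf (codeOf I) = I := by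
  obtain ⟨p, hp, rfl⟩ := exists_itvOf h
  rw [codeOf_itvOf (pos_of_mem_fam hp)]

theorem codeOf_mem {s : ℕ} {I : Itv} (h : I ∈ itvFamily s) : codeOf I ∈ fam s := by
  obtain ⟨p, hp, rfl⟩ := exists_itvOf h
  rwa [codeOf_itvOf (pos_of_mem_fam hp)]

theorem touch_codeOf {s t : ℕ} {I J : Itv} (hI : I ∈ itvFamily s) (hJ : J ∈ itvFamily t) :
    Touch (codeOf I) (codeOf J) ↔ I.Touch J := by
  obtain ⟨p, hp, rfl⟩ := exists_itvOf hI
  obtain ⟨q, hq, rfl⟩ := exists_itvOf hJ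
  have hp := pos_of_mem_fam hp
  have hq := pos_of_mem_fam hq
  rw [itv_touch_iff, codeOf_itvOf hp, codeOf_itvOf hq, itvOf_lo hp, itvOf_lo hq, itvOf_hi hp,
    itvOf_hi hq, Nat.cast_inj, Nat.cast_inj, Touch]

theorem itvOf_mem_core {s : ℕ} (hs : 3 ≤ s) {p : Code} (h : p ∈ core s) :
    p ∈ fam s ∧ itvOf p ∈ coreFamily s := by
  have hp : p = (1, 3) ∨ p = (s - 2, s) ∨ ∃ i ≤ s, p = (i, i + 1) := by
    rw [core, List.mem_append, List.mem_map] at h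
    rcases h with h | ⟨i, hi, rfl⟩
    · split_ifs at h with h3
      · exact Or.inl (by simpa using h)
      · rcases List.mem_cons.1 h with h | h
        · exact Or.inl h
        · exact Or.inr (Or.inl (by simpa using h))
    · exact Or.inr (Or.inr ⟨i, by simpa [Nat.lt_succ_iff] using hi, rfl⟩)
  have hpos : p.1 < p.2 := by
    rcases hp with rfl | rfl | ⟨i, -, rfl⟩ <;> simp; omega
  have hfam : p ∈ fam s := by
    rw [mem_fam]
    rcases hp with rfl | rfl | ⟨i, hi, rfl⟩
    · exact Or.inr (Or.inr ⟨by norm_num, by norm_num, hs⟩)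
    · exact Or.inr (Or.inr ⟨by simp; omega, hpos, le_rfl⟩)
    · rcases Nat.eq_zero_or_pos i with rfl | h0
      · exact Or.inl rfl
      · rcases Nat.lt_or_ge i s with h1 | h1
        · exact Or.inr (Or.inr ⟨h0, hpos, h1⟩)
        · obtain rfl : i = s := by omega
          exact Or.inr (Or.inl rfl)
  refine ⟨hfam, ?_⟩
  change _ ∨ _ ∨ _
  rw [itvOf_lo hpos, itvOf_hi hpos]
  rcases hp with rfl | rfl | ⟨i, hi, rfl⟩
  · right; left; norm_num
  · right; right
    refine ⟨?_, rfl⟩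
    have : 2 ≤ s := by omega
    push_cast [this]; ring
  · left; exact ⟨i, hi, rfl, by push_cast; ring⟩

/-! ### Combinations as lists of codes -/

/-- The combination that consists of the given intervals. -/
noncomputable def combOf {α : Type*} (l : List α) : α →₀ ℕ :=
  (l.map fun x => Finsupp.single x 1).sum

theorem combOf_apply {α : Type*} [DecidableEq α] (l : List α) (x : α) :
    combOf l x = l.count x := by
  induction l with
  | nil => rfl
  | cons a l ih =>
    rw [combOf, List.map_cons, List.sum_cons, Finsupp.add_apply, ← combOf, ih, List.count_cons,
      Finsupp.single_apply]
    simp only [beq_iff_eq]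
    omega

theorem combOf_perm {α : Type*} {l l' : List α} (h : l.Perm l') : combOf l = combOf l' :=
  (h.map _).sum_eq

theorem mapDomain_combOf {α β : Type*} (f : α → β) (l : List α) :
    (combOf l).mapDomain f = combOf (l.map f) := by
  induction l with
  | nil => exact Finsupp.mapDomain_zero
  | cons a l ih =>
    rw [combOf, List.map_cons, List.sum_cons, Finsupp.mapDomain_add, Finsupp.mapDomain_single,
      ← combOf, ih, combOf, combOf, List.map_cons, List.map_cons, List.sum_cons]

theorem size_combOf {α : Type*} (l : List α) : Comb.size (combOf l) = l.length := by
  induction l with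
  | nil => exact Finsupp.sum_zero_index
  | cons a l ih =>
    rw [Comb.size] at ih ⊢
    rw [combOf, List.map_cons, List.sum_cons, Finsupp.sum_add_index' (fun _ => rfl)
      (fun _ _ _ => rfl), Finsupp.sum_single_index rfl, ← combOf, ih, List.length_cons,
      Nat.add_comm]

theorem combOf_toList {α : Type*} (C : Finset α) {β : Type*} (f : α → β) :
    ∑ x ∈ C, Finsupp.single (f x) 1 = combOf (C.toList.map f) := by
  rw [combOf, List.map_map, ← Finset.sum_map_toList]
  rfl

/-- The total multiplicity of an independent set is at most the independence number. -/
theorem sum_le_alpha (γ : Itv →₀ ℕ) (D : Finset Itv)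
    (hD : ∀ I ∈ D, ∀ J ∈ D, ¬ I.Touch J) : ∑ I ∈ D, γ I ≤ Comb.alpha γ := by
  have hfin : Finite (Σ I : Itv, Fin (γ I)) := by
    have : Function.Injective (fun x : Σ I : Itv, Fin (γ I) =>
        (⟨⟨x.1, Finsupp.mem_support_iff.2 (by
          intro h
          exact absurd x.2.2 (by omega))⟩, x.2⟩ : Σ I : γ.support, Fin (γ I))) := by
      rintro ⟨a, b⟩ ⟨c, d⟩ h
      simp only [Sigma.mk.injEq, Subtype.mk.injEq] at h
      obtain ⟨rfl, h⟩ := h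
      simpa using h
    exact Finite.of_injective _ this
  have hind : (Comb.graph itvGraph γ).IsIndepSet
      (D.sigma fun I => (Finset.univ : Finset (Fin (γ I))) : Finset _) := by
    rintro ⟨I, i⟩ hI ⟨J, j⟩ hJ - hadj
    rw [Finset.mem_coe, Finset.mem_sigma] at hI hJ
    exact hD I hI.1 J hJ.1 hadj
  have := hind.card_le_indepNum
  rw [Finset.card_sigma] at this
  simpa [Comb.alpha] using this

theorem admissible_of_mem {s : ℕ} (hs : 3 ≤ s) (hs' : s ≤ 9) {γ : Itv →₀ ℕ}
    (hγ : γ ∈ setLsv s 12) {X : List Code} (hfam : ∀ p ∈ X, p ∈ fam s)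
    (hX : γ = combOf (X.map itvOf)) : Admissible s X := by
  obtain ⟨⟨-, halpha, -⟩, ⟨hcore, -⟩, hsize⟩ := hγ
  have hcount : ∀ p ∈ fam s, γ (itvOf p) = X.count p := by
    classical
    intro p hp
    rw [hX, combOf_apply, List.count_eq_countP, List.countP_map, List.count_eq_countP]
    refine List.countP_congr fun q hq => ?_
    simp only [Function.comp_apply, beq_iff_eq]
    constructor
    · intro h
      rw [← codeOf_itvOf (pos_of_mem_fam (hfam q hq)), h, codeOf_itvOf (pos_of_mem_fam hp)]
    · exact congrArg _
  refine ⟨hs, hs', ?_, fun p hp => ?_, hfam, fun D hD hDfam hDind => ?_⟩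
  · rw [hX, size_combOf, List.length_map] at hsize
    exact hsize
  · obtain ⟨h1, h2⟩ := itvOf_mem_core hs hp
    have h3 := hcore h2
    rw [Finset.mem_coe, Finsupp.mem_support_iff, hcount p h1] at h3
    exact List.count_pos_iff.1 (Nat.pos_of_ne_zero h3)
  · classical
    have hinj : Set.InjOn itvOf (D.toFinset : Set Code) := by
      intro p hp q hq h
      have hp : p ∈ fam s := hDfam p (by simpa using hp)
      have hq : q ∈ fam s := hDfam q (by simpa using hq)
      rw [← codeOf_itvOf (pos_of_mem_fam hp), h, codeOf_itvOf (pos_of_mem_fam hq)]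
    have h1 := sum_le_alpha γ (D.toFinset.image itvOf) (by
      intro I hI J hJ
      obtain ⟨p, hp, rfl⟩ := Finset.mem_image.1 hI
      obtain ⟨q, hq, rfl⟩ := Finset.mem_image.1 hJ
      rw [List.mem_toFinset] at hp hq
      rw [← touch_codeOf (itvOf_mem (hDfam p hp)) (itvOf_mem (hDfam q hq)),
        codeOf_itvOf (pos_of_mem_fam (hDfam p hp)), codeOf_itvOf (pos_of_mem_fam (hDfam q hq))]
      exact hDind p hp q hq)
    rw [Finset.sum_image hinj] at h1
    have h2 : (D.map fun p => X.count p).sum = ∑ p ∈ D.toFinset, γ (itvOf p) := by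
      rw [List.sum_toFinset _ hD]
      congr 1
      exact List.map_congr_left fun p hp => (hcount p (hDfam p hp)).symm
    rw [h2]
    exact h1.trans halpha

/-! ### Automorphisms of `I(s)` -/

theorem pushComb_apply {s : ℕ} (f : FamilyAut s) (γ : Itv →₀ ℕ) (I : itvFamily s) :
    pushComb f γ (f I : Itv) = γ I :=
  Finsupp.mapDomain_apply (Subtype.val_injective.comp f.injective) _ I

theorem pushComb_apply_of_notMem {s : ℕ} (f : FamilyAut s) (γ : Itv →₀ ℕ) {J : Itv}
    (hJ : J ∉ itvFamily s) : pushComb f γ J = 0 := by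
  refine Finsupp.mapDomain_of_notMem_range _ _ ?_
  rintro ⟨I, rfl⟩
  exact hJ (f I).2

/-- The number of codes in `I(s)` that touch `p`. -/
def degree (s : ℕ) (p : Code) : ℕ := ((fam s).toFinset.filter fun q => Touch p q).card

theorem ncard_neighborSet {s : ℕ} (I : itvFamily s) :
    ((itvGraph.induce (itvFamily s)).neighborSet I).ncard = degree s (codeOf I) := by
  have hinj : Function.Injective fun J : itvFamily s => codeOf J := by
    intro J K h
    have := congrArg itvOf h
    dsimp only at this
    rw [itvOf_codeOf J.2, itvOf_codeOf K.2] at this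
    exact Subtype.ext this
  rw [← Set.ncard_image_of_injective _ hinj, degree, ← Set.ncard_coe_finset]
  congr 1
  ext p
  rw [Set.mem_image, Finset.mem_coe, Finset.mem_filter, List.mem_toFinset]
  constructor
  · rintro ⟨J, hJ, rfl⟩
    exact ⟨codeOf_mem J.2, (touch_codeOf I.2 J.2).2 hJ⟩
  · rintro ⟨hp, ht⟩
    refine ⟨⟨itvOf p, itvOf_mem hp⟩, ?_, codeOf_itvOf (pos_of_mem_fam hp)⟩
    rw [← codeOf_itvOf (pos_of_mem_fam hp)] at ht
    exact (touch_codeOf I.2 (itvOf_mem hp)).1 ht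

theorem degree_codeOf {s : ℕ} (f : FamilyAut s) (I : itvFamily s) :
    degree s (codeOf (f I)) = degree s (codeOf I) := by
  rw [← ncard_neighborSet, ← ncard_neighborSet]
  exact (Nat.card_congr (f.mapNeighborSet I)).symm

/-- A combination whose multiplicities depend on the degrees only is fixed by automorphisms. -/
theorem pushComb_eq_self {s : ℕ} (f : FamilyAut s) {X : List Code} (hfam : ∀ p ∈ X, p ∈ fam s)
    (hdeg : ∀ p ∈ fam s, ∀ q ∈ fam s, degree s p = degree s q → X.count p = X.count q) :
    pushComb f (combOf (X.map itvOf)) = combOf (X.map itvOf) := by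
  classical
  have hcount : ∀ I ∈ itvFamily s, combOf (X.map itvOf) I = X.count (codeOf I) := by
    intro I hI
    obtain ⟨p, hp, rfl⟩ := exists_itvOf hI
    rw [combOf_apply, List.count_eq_countP, List.countP_map, List.count_eq_countP]
    refine List.countP_congr fun q hq => ?_
    simp only [Function.comp_apply, beq_iff_eq]
    constructor
    · intro h
      rw [← h, codeOf_itvOf (pos_of_mem_fam (hfam q hq))]
    · rintro rfl
      rw [codeOf_itvOf (pos_of_mem_fam hp)]
  ext J
  by_cases hJ : J ∈ itvFamily s
  · obtain ⟨I, hI⟩ := f.surjective ⟨J, hJ⟩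
    have hJ' : J = (f I : Itv) := by rw [hI]
    subst hJ'
    rw [pushComb_apply, hcount _ I.2, hcount _ (f I).2]
    exact hdeg _ (codeOf_mem I.2) _ (codeOf_mem (f I).2) (degree_codeOf f I).symm
  · rw [pushComb_apply_of_notMem f _ hJ, combOf_apply, eq_comm, List.count_eq_zero]
    intro hc
    obtain ⟨p, hp, rfl⟩ := List.mem_map.1 hc
    exact hJ (itvOf_mem (hfam p hp))

/-- The elements of `I(s)` are moved back by `f`. -/
noncomputable def pull {s : ℕ} (f : FamilyAut s) (J : Itv) : Itv :=
  open scoped Classical in if h : J ∈ itvFamily s then (f.symm ⟨J, h⟩ : Itv) else J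

theorem mapDomain_pull {s : ℕ} (f : FamilyAut s) {γ : Itv →₀ ℕ}
    (hγ : (γ.support : Set Itv) ⊆ itvFamily s) : (pushComb f γ).mapDomain (pull f) = γ := by
  rw [pushComb, ← Finsupp.mapDomain_comp]
  have h : (pull f ∘ fun I : itvFamily s => (f I : Itv)) = Subtype.val := by
    funext I
    rw [Function.comp_apply, pull, dif_pos (f I).2, Subtype.coe_eta, RelIso.symm_apply_apply]
  rw [h]
  ext J
  by_cases hJ : J ∈ itvFamily s
  · exact Finsupp.mapDomain_apply Subtype.val_injective _ (⟨J, hJ⟩ : itvFamily s)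
  · rw [Finsupp.mapDomain_of_notMem_range]
    · by_contra hc
      exact hJ (hγ (Finsupp.mem_support_iff.2 (Ne.symm hc)))
    · rintro ⟨I, rfl⟩
      exact hJ I.2

theorem pull_mem {s : ℕ} (f : FamilyAut s) {J : Itv} (hJ : J ∈ itvFamily s) :
    pull f J ∈ itvFamily s := by
  rw [pull, dif_pos hJ]
  exact (f.symm ⟨J, hJ⟩).2

theorem pull_touch {s : ℕ} (f : FamilyAut s) {I J : Itv} (hI : I ∈ itvFamily s)
    (hJ : J ∈ itvFamily s) (h : I.Touch J) : (pull f I).Touch (pull f J) := by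
  rw [pull, pull, dif_pos hI, dif_pos hJ]
  exact f.symm.map_adj_iff.2 (show (itvGraph.induce (itvFamily s)).Adj ⟨I, hI⟩ ⟨J, hJ⟩ from h)

theorem combOf_club : combOf ((rep clubIdx).map itvOf) = lamClub := by
  have h : (rep clubIdx).Perm [(0, 1), (0, 1), (1, 2), (1, 2), (1, 3), (1, 4), (2, 3), (2, 4),
      (3, 4), (3, 4), (4, 5), (4, 5)] := by
    rw [← List.isPerm_iff]; decide +kernel
  rw [combOf_perm (h.map _)]
  simp only [combOf, List.map_cons, List.map_nil, List.sum_cons, List.sum_nil, lamClub, itvTerm,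
    itvOf, two_nsmul]
  norm_num
  abel

theorem combOf_spade : combOf ((rep spadeIdx).map itvOf) = lamSpade := by
  have h : (rep spadeIdx).Perm [(0, 1), (1, 2), (1, 3), (1, 3), (2, 3), (2, 3), (3, 4), (3, 4),
      (3, 5), (3, 5), (4, 5), (5, 6)] := by
    rw [← List.isPerm_iff]; decide +kernel
  rw [combOf_perm (h.map _)]
  simp only [combOf, List.map_cons, List.map_nil, List.sum_cons, List.sum_nil, lamSpade, itvTerm,
    itvOf, two_nsmul]
  norm_num
  abel

theorem eq_club_or_eq_spade (R : ℕ → Set (Itv →₀ ℕ))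
    (hR : ∀ s : ℕ, 3 ≤ s → s ≤ 9 → IsSelection s 12 (R s))
    (γ : Fin 3 → (Itv →₀ ℕ)) (hN : γ ∈ setN R 12) (hsol : ConstructionSolvable γ) :
    (∀ i, γ i = lamClub) ∨ (∀ i, γ i = lamSpade) := by
  obtain ⟨C, hclique, hC⟩ := hsol
  choose s hs hs' hmem using hN.1
  have hex : ∀ i, ∃ μ ∈ setLsv (s i) 12, ∃ f : FamilyAut (s i), pushComb f μ = γ i := fun i =>
    (hR (s i) (hs i) (hs' i)).1 _ (hmem i)
  choose μ hμ f hf using hex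
  have hfam : ∀ i, ∀ B ∈ C, B i ∈ itvFamily (s i) := by
    intro i B hB
    by_contra hc
    have h0 := pushComb_apply_of_notMem (f i) (μ i) hc
    rw [hf i, hC i, Finsupp.finsetSum_apply, Finset.sum_eq_zero_iff] at h0
    simpa using h0 B hB
  set X : Fin 3 → List Code := fun i => C.toList.map fun B => codeOf (pull (f i) (B i)) with hXdef
  have hXfam : ∀ i, ∀ p ∈ X i, p ∈ fam (s i) := by
    intro i p hp
    obtain ⟨B, hB, rfl⟩ := List.mem_map.1 hp
    exact codeOf_mem (pull_mem (f i) (hfam i B (Finset.mem_toList.1 hB)))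
  have hμX : ∀ i, μ i = combOf ((X i).map itvOf) := by
    intro i
    rw [← mapDomain_pull (f i) (hμ i).2.1.2, hf i, hC i, combOf_toList C fun B => B i,
      mapDomain_combOf, List.map_map, List.map_map]
    congr 1
    exact List.map_congr_left fun B hB =>
      (itvOf_codeOf (pull_mem (f i) (hfam i B (Finset.mem_toList.1 hB)))).symm
  have hadm : ∀ i, Admissible (s i) (X i) := fun i =>
    admissible_of_mem (hs i) (hs' i) (hμ i) (hXfam i) (hμX i)
  have hSol : Sol (X 0) (X 1) (X 2) := by
    refine ⟨C.toList.map fun B => (codeOf (pull (f 0) (B 0)), codeOf (pull (f 1) (B 1)),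
      codeOf (pull (f 2) (B 2))), ?_, ?_, ?_, ?_⟩
    · rw [List.map_map]; exact List.Perm.refl _
    · rw [List.map_map]; exact List.Perm.refl _
    · rw [List.map_map]; exact List.Perm.refl _
    · rw [List.pairwise_map]
      refine C.nodup_toList.imp_of_mem fun {B B'} hB hB' hne => ?_
      rw [Finset.mem_toList] at hB hB'
      obtain ⟨i, hi⟩ := hclique hB hB' hne
      have ht := (touch_codeOf (pull_mem (f i) (hfam i B hB)) (pull_mem (f i) (hfam i B' hB'))).2
        (pull_touch (f i) (hfam i B hB) (hfam i B' hB') hi)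
      fin_cases i
      exacts [Or.inl ht, Or.inr (Or.inl ht), Or.inr (Or.inr ht)]
  have hγ : ∀ i, ∀ r : List Code, (X i).Perm r → (∀ p ∈ fam (s i), ∀ q ∈ fam (s i),
      degree (s i) p = degree (s i) q → r.count p = r.count q) → γ i = combOf (r.map itvOf) := by
    intro i r hr hdeg
    have h1 : μ i = combOf (r.map itvOf) := by rw [hμX i, combOf_perm (hr.map _)]
    rw [← hf i, h1]
    exact pushComb_eq_self (f i) (fun p hp => hXfam i p (hr.mem_iff.2 hp)) hdeg
  refine (Sol.club_or_spade hadm hSol).imp (fun h i => ?_) fun h i => ?_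
  · obtain ⟨h1, h2⟩ := h i
    rw [← combOf_club]
    refine hγ i _ h2 ?_
    rw [h1]
    decide +kernel
  · obtain ⟨h1, h2⟩ := h i
    rw [← combOf_spade]
    refine hγ i _ h2 ?_
    rw [h1]
    decide +kernel

end CodeSearch

theorem mainTheorem4 (R : ℕ → Set (Itv →₀ ℕ))
    (hR : ∀ s : ℕ, 3 ≤ s → s ≤ 9 → IsSelection s 12 (R s))
    (γ : Fin 3 → (Itv →₀ ℕ)) (hN : γ ∈ setN R 12) (hsol : ConstructionSolvable γ) :
    (∀ i, γ i = lamClub) ∨ (∀ i, γ i = lamSpade) :=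
  CodeSearch.eq_club_or_eq_spade R hR γ hN hsol
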